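/- A link diagram is *positive* if every crossing has sign $+$; it is *alternating* if over- and under-crossings alternate along every component; it is *positive-alternating* if it is both; it is *almost positive-alternating* if changing one of its crossings turns it into a positive-alternating diagram. For $\alpha/\beta\in\mathbb{Q}\cup\{\infty\}$ (with $\alpha,\beta$ coprime integers, $\beta=0$ giving the $\infty$-tangle), identify $\alpha/\beta$ with the standard alternating diagram $R(a_1,\dots,a_m)$ of the corresponding rational tangle, where $\alpha/\beta=a_m+\cfrac{1}{a_{m-1}+\cfrac{1}{\ddots+\cfrac1{a_1}}}$ with all $a_j\ge 0$ or all $a_j\le 0$ (horizontal twists being added on the right, vertical twists at the bottom). For $n\ge1$ the standard diagram $D(\alpha_1/\beta_1,\dots,\alpha_n/\beta_n)$ is the numerator closure of the sum of the rational tangles $\alpha_1/\beta_1,\dots,\alpha_n/\beta_n$, and the Montesinos link $C(\alpha_1/\beta_1,\dots,\alpha_n/\beta_n)$ is the link it represents. **Proposition.** Let $L$ be an oriented Montesinos link $C(\alpha_1/\beta_1,\dots,\alpha_n/\beta_n)$, and let $D=D(\alpha_1/\beta_1,\dots,\alpha_n/\beta_n)$ be its standard diagram, with the orientation of $L$. If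 $D$ is positive, then $L$ has an almost positive-alternating diagram. -/

import Mathlib

/-!
# Oriented link diagrams, positive and alternating diagrams, Montesinos links

A link diagram in the plane is cut by horizontal lines into elementary slices, read from the bottom
to the top.  Every slice consists of vertical strands together with exactly one local minimum, one
local maximum or one crossing.  Links are link diagrams up to planar isotopy and the
Reidemeister moves.
-/

/-- An elementary slice of a diagram.  `cup i o` is a local minimum which creates the strands number
`i` and `i + 1` (counted from the left, starting with `0`); `cap i` is a local maximum which joins
the strands `i` and `i + 1`; `cross i s` is a crossing of the strands `i` and `i + 1`.
If `s = true`, the over-strand of the crossing is the rising one, from the lower left to the upper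
right; if `s = false`, it is the other one, from the lower right to the upper left.
The parameter `O` is `Unit` for unoriented diagrams and `Bool` for oriented ones: `cup i true` has
its left leg oriented upwards and its right leg downwards, `cup i false` the other way round. -/
inductive Slice (O : Type) : Type
  | cup (i : ℕ) (o : O) : Slice O
  | cap (i : ℕ) : Slice O
  | cross (i : ℕ) (s : Bool) : Slice O
  deriving DecidableEq

namespace Slice

variable {O : Type}

/-- Forget the orientation. -/
def forget : Slice O → Slice Unit
  | cup i _ => cup i ()
  | cap i => cap i
  | cross i s => cross i s

/-- Put `k` further vertical strands on the left of a slice. -/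
def shift (k : ℕ) : Slice O → Slice O
  | cup i o => cup (k + i) o
  | cap i => cap (k + i)
  | cross i s => cross (k + i) s

/-- The number of vertical strands on the left of the minimum, maximum or crossing. -/
def pos : Slice O → ℕ
  | cup i _ => i
  | cap i => i
  | cross i _ => i

/-- The number of lower ends of the minimum, maximum or crossing. -/
def ins : Slice O → ℕ
  | cup _ _ => 0
  | cap _ => 2
  | cross _ _ => 2

/-- The number of upper ends of the minimum, maximum or crossing. -/
def outs : Slice O → ℕ
  | cup _ _ => 2
  | cap _ => 0
  | cross _ _ => 2

/-- The directions of the strands above an oriented slice, from those below it (`true` is upwards,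
`false` is downwards); `none` if the slice does not fit on top of these strands. -/
def act : Slice Bool → List Bool → Option (List Bool)
  | cup i b, w => if i ≤ w.length then some (w.take i ++ b :: (!b) :: w.drop i) else none
  | cap i, w =>
    match w.drop i with
    | a :: b :: r => if a = b then none else some (w.take i ++ r)
    | _ => none
  | cross i _, w =>
    match w.drop i with
    | a :: b :: r => some (w.take i ++ b :: a :: r)
    | _ => none

/-- The pieces of strands in a slice.  The end `Sum.inl j` is the `j`-th end at the bottom of the
slice, `Sum.inr j` the `j`-th end at its top.  The label is `none` for a piece that meets no
crossing, `some true` for an over-strand and `some false` for an under-strand.  Every piece is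
listed in one of its two directions only. -/
inductive Piece : Slice O → Option Bool → ℕ ⊕ ℕ → ℕ ⊕ ℕ → Prop
  | cup_left (i j : ℕ) (o : O) (h : j < i) : Piece (cup i o) none (.inl j) (.inr j)
  | cup_right (i j : ℕ) (o : O) (h : i ≤ j) : Piece (cup i o) none (.inl j) (.inr (j + 2))
  | cup (i : ℕ) (o : O) : Piece (cup i o) none (.inr i) (.inr (i + 1))
  | cap_left (i j : ℕ) (h : j < i) : Piece (cap i) none (.inl j) (.inr j)
  | cap_right (i j : ℕ) (h : i ≤ j) : Piece (cap i) none (.inl (j + 2)) (.inr j)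
  | cap (i : ℕ) : Piece (cap i) none (.inl i) (.inl (i + 1))
  | cross_left (i j : ℕ) (s : Bool) (h : j < i) : Piece (cross i s) none (.inl j) (.inr j)
  | cross_right (i j : ℕ) (s : Bool) (h : i + 2 ≤ j) : Piece (cross i s) none (.inl j) (.inr j)
  | cross_rising (i : ℕ) (s : Bool) : Piece (cross i s) (some s) (.inl i) (.inr (i + 1))
  | cross_falling (i : ℕ) (s : Bool) : Piece (cross i s) (some (!s)) (.inl (i + 1)) (.inr i)

end Slice

/-- Stack oriented slices on top of strands with the directions `w`; the result is the list of
directions of the strands at the top, or `none` if the slices do not fit together. -/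
def runSlices : List (Slice Bool) → List Bool → Option (List Bool)
  | [], w => some w
  | σ :: l, w => (σ.act w).bind (runSlices l)

/-- A diagram of an oriented link: consistently oriented slices, listed from the bottom to the top,
with no strands below the first and above the last one. -/
structure LinkDiagram : Type where
  slices : List (Slice Bool)
  closed : runSlices slices [] = some []

/-- The sign of a crossing `Slice.cross i s` whose strands have the directions `a` (lower left end)
and `b` (lower right end), where `true` is upwards. -/
def crossingSign (s a b : Bool) : ℤ := if s = (a == b) then 1 else -1

namespace LinkDiagram

/-- The directions of the strands just below the slice number `k`. -/
def level (D : LinkDiagram) (k : ℕ) : List Bool := (runSlices (D.slices.take k) []).getD []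

/-- A diagram is positive if every crossing has the sign `+`. -/
def IsPositive (D : LinkDiagram) : Prop :=
  ∀ (k i : ℕ) (s : Bool), D.slices[k]? = some (Slice.cross i s) →
    ∃ a b : Bool, (D.level k)[i]? = some a ∧ (D.level k)[i + 1]? = some b ∧ crossingSign s a b = 1

/-- The point of a diagram at an end of the slice number `k`: the pair of its level and its
position in the level.  The bottom of slice `k` is level `k`, its top is level `k + 1`. -/
def point (k : ℕ) : ℕ ⊕ ℕ → ℕ × ℕ
  | .inl j => (k, j)
  | .inr j => (k + 1, j)

/-- Following the orientation of the link from the point `P`, one runs through one slice, along a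
piece with the label `c`, and arrives at `Q`.  A slice is entered from its bottom on a strand
that is directed upwards, and from its top on a strand that is directed downwards. -/
def Runs (D : LinkDiagram) (c : Option Bool) (P Q : ℕ × ℕ) : Prop :=
  ∃ (k : ℕ) (σ : Slice Bool) (e f : ℕ ⊕ ℕ), D.slices[k]? = some σ ∧
    (σ.Piece c e f ∨ σ.Piece c f e) ∧ P = point k e ∧ Q = point k f ∧
    (D.level P.1)[P.2]? = some e.isLeft

/-- A diagram is alternating if over-crossings and under-crossings appear alternately along every
component: whenever one passes a crossing as over- or under-strand (`c`), runs on without meeting a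
crossing, and then passes a crossing as over- or under-strand (`c'`), then `c' ≠ c`. -/
def IsAlternating (D : LinkDiagram) : Prop :=
  ∀ (c c' : Bool) (P Q R S : ℕ × ℕ), D.Runs (some c) P Q →
    Relation.ReflTransGen (D.Runs none) Q R → D.Runs (some c') R S → c' ≠ c

/-- A positive-alternating diagram. -/
def IsPA (D : LinkDiagram) : Prop := D.IsPositive ∧ D.IsAlternating

/-- `D'` arises from `D` by changing one crossing. -/
def CrossingChange (D D' : LinkDiagram) : Prop :=
  ∃ (A B : List (Slice Bool)) (i : ℕ) (s : Bool),
    D.slices = A ++ Slice.cross i s :: B ∧ D'.slices = A ++ Slice.cross i (!s) :: B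

/-- An almost positive-alternating diagram: one crossing change makes it into a
positive-alternating diagram. -/
def IsAlmostPA (D : LinkDiagram) : Prop := ∃ D' : LinkDiagram, D.CrossingChange D' ∧ D'.IsPA

end LinkDiagram

/-- The local moves of sliced diagrams: planar isotopies (`exchange`, `zigzag`, `slide`) and the
Reidemeister moves. -/
inductive LocalMove : List (Slice Bool) → List (Slice Bool) → Prop
  /-- Two slices whose minima, maxima or crossings lie side by side change their heights. -/
  | exchange (g h : Slice Bool) :
      LocalMove [g, h.shift (g.pos + g.outs)] [h.shift (g.pos + g.ins), g]
  | zigzag_left (i : ℕ) (b : Bool) : LocalMove [.cup i b, .cap (i + 1)] []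
  | zigzag_right (i : ℕ) (b : Bool) : LocalMove [.cup (i + 1) b, .cap i] []
  /-- A strand crosses the right or the left leg of a minimum. -/
  | slide_cup (i : ℕ) (b s : Bool) :
      LocalMove [.cup i b, .cross (i + 1) s] [.cup (i + 1) b, .cross i (!s)]
  /-- A strand crosses the left or the right leg of a maximum. -/
  | slide_cap (i : ℕ) (s : Bool) :
      LocalMove [.cross i s, .cap (i + 1)] [.cross (i + 1) (!s), .cap i]
  | reidemeister1_right (i : ℕ) (b s : Bool) :
      LocalMove [.cup (i + 1) b, .cross i s, .cap (i + 1)] []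
  | reidemeister1_left (i : ℕ) (b s : Bool) :
      LocalMove [.cup i b, .cross (i + 1) s, .cap i] []
  | reidemeister2 (i : ℕ) (s : Bool) : LocalMove [.cross i s, .cross i (!s)] []
  /-- The condition says that one of the three strands lies above the two others, and one below. -/
  | reidemeister3 (i : ℕ) (s t u : Bool) (h : s = u → t = s) :
      LocalMove [.cross i s, .cross (i + 1) t, .cross i u]
        [.cross (i + 1) u, .cross i t, .cross (i + 1) s]

/-- One local move turns the diagram `D` into the diagram `D'`. -/
def LinkDiagram.Step (D D' : LinkDiagram) : Prop :=
  ∃ A B x y : List (Slice Bool), LocalMove x y ∧ D.slices = A ++ x ++ B ∧ D'.slices = A ++ y ++ B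

/-- Oriented links: diagrams up to the equivalence relation generated by the local moves. -/
def OrientedLink : Type := Quot LinkDiagram.Step

/-- `D` is a diagram of the oriented link `L`. -/
def LinkDiagram.Represents (D : LinkDiagram) (L : OrientedLink) : Prop :=
  Quot.mk LinkDiagram.Step D = L

/-! ### Standard diagrams of Montesinos links

A tangle is given by unoriented slices with two strands at the bottom (south-west, south-east) and
two strands at the top (north-west, north-east). -/

namespace Tangle

/-- The tangle `0`: two horizontal arcs. -/
def zero : List (Slice Unit) := [.cap 0, .cup 0 ()]

/-- The tangle `∞`: two vertical arcs. -/
def infty : List (Slice Unit) := []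

/-- The tangle `1` (if `s = true`) or `-1` (if `s = false`): one crossing, whose over-strand runs
from the south-west to the north-east for `1`. -/
def one (s : Bool) : List (Slice Unit) := [.cross 0 s]

/-- The sum: `T'` stands on the right of `T`, the eastern ends of `T` are joined to the western
ends of `T'`. -/
def add (T T' : List (Slice Unit)) : List (Slice Unit) :=
  .cup 1 () :: T ++ T'.map (Slice.shift 2) ++ [.cap 1]

/-- The vertical composition: `T'` stands below `T`, the southern ends of `T` are joined to the
northern ends of `T'`. -/
def mul (T T' : List (Slice Unit)) : List (Slice Unit) := T' ++ T

/-- The numerator: the two northern ends are joined, and so are the two southern ends. -/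
def numerator (T : List (Slice Unit)) : List (Slice Unit) := .cup 0 () :: T ++ [.cap 0]

/-- The standard (alternating) diagram of the rational tangle `p / q` (if `s = true`) or `-p / q`
(if `s = false`).  If `p / q = a + r / q` with a partial quotient `a`, then the last `a` twists are
horizontal ones, added on the right, by `x + 1 = x + 1 / 1`; if `p / q < 1`, then the last twists
are vertical ones, added at the bottom, by `1 / (1 + 1 / x)`.  So the numbers of successive twists
of the same kind are the partial quotients `a₁, …, aₘ ≥ 0` (up to the sign) of the continued
fraction `aₘ + 1 / (aₘ₋₁ + 1 / (⋯ + 1 / a₁))` of `p / q`, where `aₘ = 0` if `p / q < 1`. -/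
def ratAux (s : Bool) (p q : ℕ) : List (Slice Unit) :=
  if q = 0 then infty
  else if p = 0 then zero
  else if p = q then one s
  else if q < p then add (ratAux s (p - q) q) (one s)
  else mul (ratAux s p (q - p)) (one s)
termination_by p + q
decreasing_by all_goals omega

/-- The standard diagram of the rational tangle `α / β`, which is `∞` for `β = 0`. -/
def rat (α β : ℤ) : List (Slice Unit) := ratAux (decide (0 ≤ α * β)) α.natAbs β.natAbs

/-- The sum of a list of tangles. -/
def sum : List (List (Slice Unit)) → List (Slice Unit)
  | [] => zero
  | [T] => T
  | T :: T' :: l => add T (sum (T' :: l))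

end Tangle

/-- The unoriented standard diagram `D(α₁/β₁, …, αₙ/βₙ)`: the numerator of the sum of the rational
tangles `α₁/β₁, …, αₙ/βₙ`. -/
def montesinosDiagram {n : ℕ} (α β : Fin n → ℤ) : List (Slice Unit) :=
  Tangle.numerator (Tangle.sum (List.ofFn fun i => Tangle.rat (α i) (β i)))

/-- `D` is the standard diagram `D(α₁/β₁, …, αₙ/βₙ)` with some orientation; the oriented link that
it represents is the Montesinos link `C(α₁/β₁, …, αₙ/βₙ)` with this orientation. -/
def LinkDiagram.IsStandardMontesinos (D : LinkDiagram) {n : ℕ} (α β : Fin n → ℤ) : Prop :=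
  D.slices.map Slice.forget = montesinosDiagram α β

/-!
# Positive standard diagrams of Montesinos links

A quarter turn of the plane makes the sum of the tangles into a vertical composition of turned
tangles, that is, into a concatenation of words of slices, which is closed by one arc on either
side.  All isotopies are carried out for unoriented words.  The relation `Eqv n k x y` says that
every orientation of `x` is carried to one of `y`, with the writhe increased by `k`; the number `k`
does not depend on the orientation, as only the curls of the first Reidemeister move change the
writhe.  So a diagram can be shown to be positive without following its orientation: this means
that the writhe is the number of crossings (`LinkDiagram.isPositive_iff`).

The isotopies rest on one observation.  An end of a tangle which passes over two strands beside the
tangle can be swept across the tangle, and then passes over one strand only, up to a curl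
(`rotL_cross_cross`, `rotR_cross_cross`).  This has three consequences.
* Rational tangles are invariant under flypes and half turns (`FlypeInvariant.rotL`,
  `FlypeInvariant.ratAux`), so that half twists can be moved freely among them.
* A turned proper fraction `p / q` is `p / q - 1` followed by a half twist (`posWord_eqv`); both
  diagrams are alternating and have the same number of crossings apart from the half twist.
* A product of fractions between `-1` and `0` becomes a positive tangle with exactly one crossing
  of the wrong kind (`eqv_dealternator`).

Now let the standard diagram be positive, and look at the two strands below the turned tangles.
Their directions are parallel below every tangle, or antiparallel below every tangle.

If they are parallel, then positivity leaves only tangles `0` and `-p / q`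
(`turned_of_parallel`).  The standard diagram is alternating, and a negative curl makes it
almost positive-alternating (`exists_isAlmostPA_of_chk`).

If they are antiparallel, then negative tangles `-p / q` have `p < q`
(`turned_of_antiparallel`).  Hence the product is isotopic to proper fractions `p / q` and tangles
`∞` together with `a` half twists, where `-a` is at most the number of the fractions (`IsProduct`).
If `a` is not negative, or if there is a tangle `∞`, which absorbs the half twists as curls, then
the result is positive and alternating, and a negative curl is added as before.  Otherwise `-a` of
the fractions absorb the half twists and become fractions between `-1` and `0`, all crossings still
being positive (`IsProduct.exists_eqv`).  By `eqv_dealternator`, these are replaced by a tangle of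
the same kind as the other fractions, up to one crossing.  This crossing is negative, all others
are positive, and changing it makes the diagram positive and alternating.

A diagram is seen to be alternating by the checkerboard colouring of the plane: all its crossings
are of the same kind with respect to it (`Chk`, `LinkDiagram.isAlternating_of_chk`).
-/

/-! ### Running slices over enlarged lists of strands -/

namespace Slice

theorem shift_zero {O : Type} (σ : Slice O) : σ.shift 0 = σ := by
  cases σ <;> simp [shift]

theorem shift_shift {O : Type} (j k : ℕ) (σ : Slice O) :
    (σ.shift k).shift j = σ.shift (j + k) := by
  cases σ <;> simp [shift, Nat.add_assoc]

theorem forget_shift (k : ℕ) (σ : Slice Bool) : (σ.shift k).forget = σ.forget.shift k := by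
  cases σ <;> rfl

theorem act_shift (σ : Slice Bool) (u w : List Bool) :
    (σ.shift u.length).act (u ++ w) = (σ.act w).map (u ++ ·) := by
  cases σ with
  | cup i b =>
    by_cases h : i ≤ w.length <;>
      simp [shift, act, h, List.take_length_add_append, List.drop_length_add_append]
  | cap i =>
    simp only [shift, act, List.take_length_add_append, List.drop_length_add_append]
    rcases List.drop i w with _ | ⟨a, _ | ⟨b, r⟩⟩ <;> simp
    split <;> simp
  | cross i s =>
    simp only [shift, act, List.take_length_add_append, List.drop_length_add_append]
    rcases List.drop i w with _ | ⟨a, _ | ⟨b, r⟩⟩ <;> simp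

theorem act_append (σ : Slice Bool) {w w' : List Bool} (r : List Bool) (h : σ.act w = some w') :
    σ.act (w ++ r) = some (w' ++ r) := by
  cases σ with
  | cup i b =>
    simp only [act] at h ⊢
    split at h
    · rename_i hi
      obtain rfl := Option.some.inj h
      simp [hi, List.take_append_of_le_length, List.drop_append_of_le_length,
        Nat.le_add_right_of_le]
    · simp at h
  | cap i =>
    simp only [act] at h ⊢
    rcases hd : List.drop i w with _ | ⟨a, _ | ⟨b, q⟩⟩ <;> simp only [hd] at h <;> try simp at h
    have hi : i ≤ w.length := by
      by_contra hc
      rw [List.drop_eq_nil_of_le (by omega)] at hd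
      simp at hd
    rw [List.drop_append_of_le_length hi, List.take_append_of_le_length hi, hd]
    simp [h.1, ← h.2]
  | cross i s =>
    simp only [act] at h ⊢
    rcases hd : List.drop i w with _ | ⟨a, _ | ⟨b, q⟩⟩ <;> simp only [hd] at h <;> try simp at h
    have hi : i ≤ w.length := by
      by_contra hc
      rw [List.drop_eq_nil_of_le (by omega)] at hd
      simp at hd
    rw [List.drop_append_of_le_length hi, List.take_append_of_le_length hi, hd]
    simp [← h]

/-- The sign of a slice on top of strands with the directions `w`: the sign of its crossing, and
`0` for minima and maxima. -/
def sign : Slice Bool → List Bool → ℤ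
  | cross i s, w =>
    match w.drop i with
    | a :: b :: _ => crossingSign s a b
    | _ => 0
  | _, _ => 0

theorem sign_shift (σ : Slice Bool) (u w : List Bool) :
    (σ.shift u.length).sign (u ++ w) = σ.sign w := by
  cases σ <;> simp [shift, sign, List.drop_length_add_append]

theorem sign_append (σ : Slice Bool) {w w' : List Bool} (r : List Bool) (h : σ.act w = some w') :
    σ.sign (w ++ r) = σ.sign w := by
  cases σ with
  | cup i b => rfl
  | cap i => rfl
  | cross i s =>
    simp only [act, sign] at h ⊢
    rcases hd : List.drop i w with _ | ⟨a, _ | ⟨b, q⟩⟩ <;> simp only [hd] at h <;> try simp at h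
    have hi : i ≤ w.length := by
      by_contra hc
      rw [List.drop_eq_nil_of_le (by omega)] at hd
      simp at hd
    rw [List.drop_append_of_le_length hi, hd]
    simp

/-- The number of strands above an unoriented slice that is put on `n` strands; `none` if it does
not fit. -/
def width : Slice Unit → ℕ → Option ℕ
  | cup i _, n => if i ≤ n then some (n + 2) else none
  | cap i, n => if i + 2 ≤ n then some (n - 2) else none
  | cross i _, n => if i + 2 ≤ n then some n else none

theorem width_add (σ : Slice Unit) {n m : ℕ} (j : ℕ) (h : σ.width n = some m) :
    σ.width (n + j) = some (m + j) := by
  cases σ <;> simp [width] at h ⊢ <;> omega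

theorem width_shift (σ : Slice Unit) {n m : ℕ} (j : ℕ) (h : σ.width n = some m) :
    (σ.shift j).width (j + n) = some (j + m) := by
  cases σ <;> simp [width, shift] at h ⊢ <;> omega

theorem width_length (σ : Slice Bool) {w w' : List Bool} (h : σ.act w = some w') :
    σ.forget.width w.length = some w'.length := by
  cases σ with
  | cup i b =>
    simp only [act] at h
    split at h
    · rename_i hi
      obtain rfl := Option.some.inj h
      simp [forget, width, hi]; omega
    · simp at h
  | cap i =>
    simp only [act] at h
    rcases hd : List.drop i w with _ | ⟨a, _ | ⟨b, q⟩⟩ <;> simp only [hd] at h <;> try simp at h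
    have hl := congrArg List.length hd
    simp at hl
    simp [forget, width, ← h.2]; omega
  | cross i s =>
    simp only [act] at h
    rcases hd : List.drop i w with _ | ⟨a, _ | ⟨b, q⟩⟩ <;> simp only [hd] at h <;> try simp at h
    have hl := congrArg List.length hd
    simp at hl
    simp [forget, width, ← h]; omega

theorem width_eq_some_of_act (σ : Slice Bool) (w : List Bool) {m : ℕ} :
    σ.forget.width w.length = some m → ∀ w', σ.act w = some w' → w'.length = m := by
  intro h w' hw
  rw [width_length σ hw] at h
  exact Option.some.inj h

/-- A slice that fits on the strands `w` acts on `w ++ r` by acting on `w`. -/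
theorem act_append_of_width (σ : Slice Bool) (w r : List Bool) {m : ℕ}
    (h : σ.forget.width w.length = some m) : σ.act (w ++ r) = (σ.act w).map (· ++ r) := by
  cases hw : σ.act w with
  | some w' => simpa using act_append σ r hw
  | none =>
    cases σ with
    | cup i b => simp [forget, width, act] at h hw; omega
    | cap i =>
      simp only [forget, width] at h
      split at h
      · rename_i hi
        simp only [act] at hw ⊢
        rw [List.drop_append_of_le_length (by omega)]
        rcases hd : List.drop i w with _ | ⟨a, _ | ⟨b, q⟩⟩
        · have := congrArg List.length hd; simp at this; omega
        · have := congrArg List.length hd; simp at this; omega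
        · simp [hd] at hw
          simp [hw]
      · simp at h
    | cross i s =>
      simp only [forget, width] at h
      split at h
      · rename_i hi
        simp only [act] at hw ⊢
        rcases hd : List.drop i w with _ | ⟨a, _ | ⟨b, q⟩⟩
        · have := congrArg List.length hd; simp at this; omega
        · have := congrArg List.length hd; simp at this; omega
        · simp [hd] at hw
      · simp at h

theorem exists_shift_of_forget {σ : Slice Bool} {τ : Slice Unit} {j : ℕ}
    (h : σ.forget = τ.shift j) : ∃ σ₀ : Slice Bool, σ = σ₀.shift j ∧ σ₀.forget = τ := by
  cases σ <;> cases τ <;>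
    simp only [forget, shift, reduceCtorEq, cup.injEq, cap.injEq, cross.injEq] at h
  · rename_i i b i' _
    exact ⟨cup i' b, by simp [shift, h.1], rfl⟩
  · rename_i i i'
    exact ⟨cap i', by simp [shift, h], rfl⟩
  · rename_i i b i' s'
    exact ⟨cross i' s', by simp [shift, h.1, h.2], rfl⟩

end Slice

theorem runSlices_append (X Y : List (Slice Bool)) (w : List Bool) :
    runSlices (X ++ Y) w = (runSlices X w).bind (runSlices Y) := by
  induction X generalizing w with
  | nil => rfl
  | cons σ X ih =>
    simp only [List.cons_append, runSlices]
    cases σ.act w <;> simp [ih]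

theorem runSlices_shift (X : List (Slice Bool)) (u w : List Bool) :
    runSlices (X.map (Slice.shift u.length)) (u ++ w) = (runSlices X w).map (u ++ ·) := by
  induction X generalizing w with
  | nil => rfl
  | cons σ X ih =>
    simp only [List.map_cons, runSlices, Slice.act_shift]
    cases σ.act w <;> simp [ih]

theorem runSlices_append_right (X : List (Slice Bool)) {w w' : List Bool} (r : List Bool)
    (h : runSlices X w = some w') : runSlices X (w ++ r) = some (w' ++ r) := by
  induction X generalizing w with
  | nil => simpa [runSlices] using h
  | cons σ X ih =>
    simp only [runSlices] at h ⊢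
    cases hw : σ.act w with
    | none => simp [hw] at h
    | some v =>
      rw [Slice.act_append σ r hw]
      exact ih (by simpa [hw] using h)

/-- The writhe of slices on top of strands with the directions `w`: the sum of the signs of the
crossings. -/
def writhe : List (Slice Bool) → List Bool → ℤ
  | [], _ => 0
  | σ :: X, w => σ.sign w + writhe X ((σ.act w).getD [])

theorem writhe_append (X Y : List (Slice Bool)) {w w' : List Bool} (h : runSlices X w = some w') :
    writhe (X ++ Y) w = writhe X w + writhe Y w' := by
  induction X generalizing w with
  | nil =>
    obtain rfl := Option.some.inj h
    simp [writhe]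
  | cons σ X ih =>
    simp only [runSlices] at h
    cases hw : σ.act w with
    | none => simp [hw] at h
    | some v => simp [writhe, hw, ih (w := v) (by simpa [hw] using h), add_assoc]

theorem writhe_shift (X : List (Slice Bool)) (u : List Bool) {w w' : List Bool}
    (h : runSlices X w = some w') :
    writhe (X.map (Slice.shift u.length)) (u ++ w) = writhe X w := by
  induction X generalizing w with
  | nil => rfl
  | cons σ X ih =>
    simp only [runSlices] at h
    cases hw : σ.act w with
    | none => simp [hw] at h
    | some v =>
      simp [writhe, Slice.act_shift, Slice.sign_shift, hw, ih (w := v) (by simpa [hw] using h)]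

theorem writhe_append_right (X : List (Slice Bool)) {w w' : List Bool} (r : List Bool)
    (h : runSlices X w = some w') : writhe X (w ++ r) = writhe X w := by
  induction X generalizing w with
  | nil => rfl
  | cons σ X ih =>
    simp only [runSlices] at h
    cases hw : σ.act w with
    | none => simp [hw] at h
    | some v =>
      simp [writhe, Slice.act_append σ r hw, Slice.sign_append σ r hw, hw,
        ih (w := v) (by simpa [hw] using h)]

/-- The number of strands above unoriented slices that are put on `n` strands; `none` if they do
not fit. -/
def wd : List (Slice Unit) → ℕ → Option ℕ
  | [], n => some n
  | σ :: x, n => (σ.width n).bind (wd x)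

theorem wd_append (x y : List (Slice Unit)) (n : ℕ) : wd (x ++ y) n = (wd x n).bind (wd y) := by
  induction x generalizing n with
  | nil => rfl
  | cons σ x ih =>
    simp only [List.cons_append, wd]
    cases σ.width n <;> simp [ih]

theorem wd_add (x : List (Slice Unit)) {n m : ℕ} (j : ℕ) (h : wd x n = some m) :
    wd x (n + j) = some (m + j) := by
  induction x generalizing n with
  | nil => simpa [wd] using h
  | cons σ x ih =>
    simp only [wd] at h ⊢
    cases hw : σ.width n with
    | none => simp [hw] at h
    | some v =>
      rw [Slice.width_add σ j hw]
      exact ih (by simpa [hw] using h)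

/-- Put `k` further vertical strands on the left of unoriented slices. -/
abbrev sh (k : ℕ) (x : List (Slice Unit)) : List (Slice Unit) := x.map (Slice.shift k)

theorem sh_sh (j k : ℕ) (x : List (Slice Unit)) : sh j (sh k x) = sh (j + k) x := by
  simp [sh, Slice.shift_shift, Function.comp_def]

theorem sh_zero (x : List (Slice Unit)) : sh 0 x = x := by
  induction x with
  | nil => rfl
  | cons σ x ih => simpa [sh, Slice.shift_zero] using ih

theorem wd_sh (x : List (Slice Unit)) {n m : ℕ} (j : ℕ) (h : wd x n = some m) :
    wd (sh j x) (j + n) = some (j + m) := by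
  induction x generalizing n with
  | nil => simpa [wd] using h
  | cons σ x ih =>
    simp only [wd] at h
    simp only [sh, List.map_cons, wd]
    cases hw : σ.width n with
    | none => simp [hw] at h
    | some v =>
      rw [Slice.width_shift σ j hw]
      exact ih (by simpa [hw] using h)

theorem wd_length (X : List (Slice Bool)) {w w' : List Bool} (h : runSlices X w = some w') :
    wd (X.map Slice.forget) w.length = some w'.length := by
  induction X generalizing w with
  | nil => simpa [wd, runSlices] using congrArg (Option.map List.length) h
  | cons σ X ih =>
    simp only [runSlices] at h
    cases hw : σ.act w with
    | none => simp [hw] at h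
    | some v =>
      simp only [List.map_cons, wd, Slice.width_length σ hw]
      exact ih (w := v) (by simpa [hw] using h)

theorem runSlices_append_of_wd (X : List (Slice Bool)) (w r : List Bool) {m : ℕ}
    (h : wd (X.map Slice.forget) w.length = some m) :
    runSlices X (w ++ r) = (runSlices X w).map (· ++ r) := by
  induction X generalizing w with
  | nil => simp [runSlices]
  | cons σ X ih =>
    simp only [List.map_cons, wd] at h
    cases hσ : σ.forget.width w.length with
    | none => simp [hσ] at h
    | some v =>
      simp only [runSlices, Slice.act_append_of_width σ w r hσ]
      cases hw : σ.act w with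
      | none => simp
      | some w' =>
        have hl := Slice.width_eq_some_of_act σ w hσ w' hw
        simp only [Option.map_some, Option.bind_some]
        exact ih w' (by rw [hl]; simpa [hσ] using h)

theorem exists_map_shift_of_forget {X : List (Slice Bool)} {x : List (Slice Unit)} {j : ℕ}
    (h : X.map Slice.forget = sh j x) :
    ∃ X₀ : List (Slice Bool), X = X₀.map (Slice.shift j) ∧ X₀.map Slice.forget = x := by
  induction X generalizing x with
  | nil => cases x with
    | nil => exact ⟨[], rfl, rfl⟩
    | cons τ x => simp [sh] at h
  | cons σ X ih => cases x with
    | nil => simp [sh] at h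
    | cons τ x =>
      simp only [sh, List.map_cons, List.cons.injEq] at h
      obtain ⟨σ₀, rfl, rfl⟩ := Slice.exists_shift_of_forget h.1
      obtain ⟨X₀, rfl, rfl⟩ := ih h.2
      exact ⟨σ₀ :: X₀, rfl, rfl⟩

theorem map_forget_shift (j : ℕ) (X : List (Slice Bool)) :
    (X.map (Slice.shift j)).map Slice.forget = sh j (X.map Slice.forget) := by
  simp [sh, Function.comp_def, Slice.forget_shift]

/-! ### Framed isotopy of unoriented slices -/

theorem LocalMove.shift {x y : List (Slice Bool)} (j : ℕ) (h : LocalMove x y) :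
    LocalMove (x.map (Slice.shift j)) (y.map (Slice.shift j)) := by
  cases h with
  | exchange g h =>
    have hp : (g.shift j).pos = j + g.pos := by cases g <;> rfl
    have ho : (g.shift j).outs = g.outs := by cases g <;> rfl
    have hi : (g.shift j).ins = g.ins := by cases g <;> rfl
    have := LocalMove.exchange (g.shift j) h
    rw [hp, ho, hi] at this
    simpa [Slice.shift_shift, Nat.add_assoc] using this
  | zigzag_left i b => exact LocalMove.zigzag_left (j + i) b
  | zigzag_right i b => exact LocalMove.zigzag_right (j + i) b
  | slide_cup i b s => exact LocalMove.slide_cup (j + i) b s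
  | slide_cap i s => exact LocalMove.slide_cap (j + i) s
  | reidemeister1_right i b s => exact LocalMove.reidemeister1_right (j + i) b s
  | reidemeister1_left i b s => exact LocalMove.reidemeister1_left (j + i) b s
  | reidemeister2 i s => exact LocalMove.reidemeister2 (j + i) s
  | reidemeister3 i s t u h => exact LocalMove.reidemeister3 (j + i) s t u h

/-- Local moves between oriented words that run from the strands `w` to the strands `w'`. -/
def Conn (w w' : List Bool) : List (Slice Bool) → List (Slice Bool) → Prop :=
  Relation.EqvGen fun X Y => runSlices X w = some w' ∧ runSlices Y w = some w' ∧
    ∃ A B x y, LocalMove x y ∧ X = A ++ x ++ B ∧ Y = A ++ y ++ B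

theorem Conn.map {w w' v v' : List Bool} {X Y : List (Slice Bool)}
    (f : List (Slice Bool) → List (Slice Bool))
    (hf : ∀ X, runSlices X w = some w' → runSlices (f X) v = some v')
    (hm : ∀ A B x y, LocalMove x y → ∃ A' B' x' y', LocalMove x' y' ∧
      f (A ++ x ++ B) = A' ++ x' ++ B' ∧ f (A ++ y ++ B) = A' ++ y' ++ B')
    (h : Conn w w' X Y) : Conn v v' (f X) (f Y) := by
  induction h with
  | rel X Y h =>
    obtain ⟨hX, hY, A, B, x, y, hxy, rfl, rfl⟩ := h
    exact .rel _ _ ⟨hf _ hX, hf _ hY, hm A B x y hxy⟩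
  | refl X => exact .refl _
  | symm X Y _ ih => exact .symm _ _ ih
  | trans X Y Z _ _ ih₁ ih₂ => exact .trans _ _ _ ih₁ ih₂

theorem Conn.ctx {u w w' v : List Bool} {X Y : List (Slice Bool)} (A B : List (Slice Bool))
    (hA : runSlices A u = some w) (hB : runSlices B w' = some v) (h : Conn w w' X Y) :
    Conn u v (A ++ X ++ B) (A ++ Y ++ B) := by
  refine Conn.map (fun X => A ++ X ++ B) (fun X hX => by simp [runSlices_append, hA, hX, hB]) ?_ h
  intro A' B' x y hxy
  exact ⟨A ++ A', B' ++ B, x, y, hxy, by simp, by simp⟩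

theorem Conn.append_right {w w' : List Bool} {X Y : List (Slice Bool)} (r : List Bool)
    (h : Conn w w' X Y) : Conn (w ++ r) (w' ++ r) X Y :=
  Conn.map id (fun X hX => runSlices_append_right X r hX)
    (fun A B x y hxy => ⟨A, B, x, y, hxy, rfl, rfl⟩) h

theorem Conn.shift {w w' : List Bool} {X Y : List (Slice Bool)} (u : List Bool)
    (h : Conn w w' X Y) :
    Conn (u ++ w) (u ++ w') (X.map (Slice.shift u.length)) (Y.map (Slice.shift u.length)) := by
  refine Conn.map (List.map (Slice.shift u.length))
    (fun X hX => by simp [runSlices_shift, hX]) ?_ h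
  intro A B x y hxy
  exact ⟨A.map (Slice.shift u.length), B.map (Slice.shift u.length), _, _, hxy.shift u.length,
    by simp, by simp⟩

theorem Conn.represents {X Y : List (Slice Bool)} (h : Conn [] [] X Y)
    (hX : runSlices X [] = some []) (hY : runSlices Y [] = some []) {L : OrientedLink}
    (hL : (LinkDiagram.mk X hX).Represents L) : (LinkDiagram.mk Y hY).Represents L := by
  have key : ∀ X Y, Conn [] [] X Y → (∀ (hX : runSlices X [] = some [])
      (hY : runSlices Y [] = some []), Quot.mk LinkDiagram.Step ⟨X, hX⟩ =
        Quot.mk LinkDiagram.Step ⟨Y, hY⟩) ∧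
      (runSlices X [] = some [] ↔ runSlices Y [] = some []) := by
    intro X Y h
    induction h with
    | rel X Y h =>
      obtain ⟨hX, hY, A, B, x, y, hxy, e₁, e₂⟩ := h
      exact ⟨fun _ _ => Quot.sound ⟨A, B, x, y, hxy, e₁, e₂⟩, by simp [hX, hY]⟩
    | refl X => exact ⟨fun _ _ => rfl, Iff.rfl⟩
    | symm X Y _ ih => exact ⟨fun h₁ h₂ => (ih.1 h₂ h₁).symm, ih.2.symm⟩
    | trans X Y Z _ _ ih₁ ih₂ =>
      exact ⟨fun h₁ h₂ => (ih₁.1 h₁ (ih₁.2.1 h₁)).trans (ih₂.1 (ih₁.2.1 h₁) h₂),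
        ih₁.2.trans ih₂.2⟩
  rw [← hL]
  exact ((key X Y h).1 hX hY).symm

/-- Every orientation of `x` on at least `n` strands is turned by local moves into an orientation of
`y`, with the same directions at both ends and with a writhe that is larger by `k`. -/
def Lifts (n : ℕ) (k : ℤ) (x y : List (Slice Unit)) : Prop :=
  ∀ (w w' : List Bool) (X : List (Slice Bool)), n ≤ w.length → X.map Slice.forget = x →
    runSlices X w = some w' → ∃ Y : List (Slice Bool), Y.map Slice.forget = y ∧
      runSlices Y w = some w' ∧ Conn w w' X Y ∧ writhe Y w = writhe X w + k

/-- Framed isotopy of unoriented slices on at least `n` strands, where the framing, measured by the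
writhe, increases by `k`.  The change of the writhe does not depend on the orientation, as the
writhe changes only at the curls of the first Reidemeister move. -/
structure Eqv (n : ℕ) (k : ℤ) (x y : List (Slice Unit)) : Prop where
  fwd : Lifts n k x y
  bwd : Lifts n (-k) y x

theorem Lifts.refl (n : ℕ) (x : List (Slice Unit)) : Lifts n 0 x x :=
  fun _ _ X _ hX hw => ⟨X, hX, hw, .refl _, by simp⟩

theorem Lifts.trans {n : ℕ} {k l : ℤ} {x y z : List (Slice Unit)} (h₁ : Lifts n k x y)
    (h₂ : Lifts n l y z) : Lifts n (k + l) x z := by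
  intro w w' X hn hX hw
  obtain ⟨Y, hY, hYw, hXY, hk⟩ := h₁ w w' X hn hX hw
  obtain ⟨Z, hZ, hZw, hYZ, hl⟩ := h₂ w w' Y hn hY hYw
  exact ⟨Z, hZ, hZw, .trans _ _ _ hXY hYZ, by rw [hl, hk]; ring⟩

/-- The slices `a` below have to leave enough strands, for every number of strands at the bottom on
which they fit. -/
theorem Lifts.ctx_of_le {n m : ℕ} {k : ℤ} {x y : List (Slice Unit)} (a b : List (Slice Unit))
    (ha : ∀ N M, n ≤ N → wd a N = some M → m ≤ M) (h : Lifts m k x y) :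
    Lifts n k (a ++ x ++ b) (a ++ y ++ b) := by
  intro w w' X hn hX hw
  obtain ⟨X', B, rfl, hX', rfl⟩ := List.map_eq_append_iff.1 hX
  obtain ⟨A, X, rfl, rfl, rfl⟩ := List.map_eq_append_iff.1 hX'
  rw [runSlices_append, runSlices_append] at hw
  cases h₁ : runSlices A w with
  | none => simp [h₁] at hw
  | some w₁ =>
    cases h₂ : runSlices X w₁ with
    | none => simp [h₁, h₂] at hw
    | some w₂ =>
      have h₃ : runSlices B w₂ = some w' := by simpa [h₁, h₂] using hw
      obtain ⟨Y, hY, hYw, hXY, hk⟩ := h w₁ w₂ X (ha _ _ hn (wd_length A h₁)) rfl h₂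
      refine ⟨A ++ Y ++ B, by simp [hY], by simp [runSlices_append, h₁, hYw, h₃],
        hXY.ctx A B h₁ h₃, ?_⟩
      rw [writhe_append (A ++ Y) B (w' := w₂) (by simp [runSlices_append, h₁, hYw]),
        writhe_append (A ++ X) B (w' := w₂) (by simp [runSlices_append, h₁, h₂]),
        writhe_append A Y h₁, writhe_append A X h₁, hk]
      ring

theorem Lifts.sh {n : ℕ} {k : ℤ} {x y : List (Slice Unit)} (j : ℕ) (h : Lifts n k x y) :
    Lifts (j + n) k (sh j x) (sh j y) := by
  intro w w' X hn hX hw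
  obtain ⟨X, rfl, rfl⟩ := exists_map_shift_of_forget hX
  obtain ⟨u, v, rfl, rfl⟩ : ∃ u v, w = u ++ v ∧ j = u.length :=
    ⟨w.take j, w.drop j, by simp, by simp; omega⟩
  rw [runSlices_shift] at hw
  cases hv : runSlices X v with
  | none => simp [hv] at hw
  | some v' =>
    obtain rfl : u ++ v' = w' := by simpa [hv] using hw
    obtain ⟨Y, rfl, hYw, hXY, hk⟩ := h v v' X (by simp at hn; omega) rfl hv
    exact ⟨Y.map (Slice.shift u.length), map_forget_shift _ _, by simp [runSlices_shift, hYw],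
      hXY.shift u, by rw [writhe_shift Y u hYw, writhe_shift X u hv, hk]⟩

theorem Lifts.mono {n m : ℕ} {k : ℤ} {x y : List (Slice Unit)} (h : Lifts n k x y) (hnm : n ≤ m) :
    Lifts m k x y := fun w w' X hm => h w w' X (hnm.trans hm)

theorem Lifts.of_move {n : ℕ} {k : ℤ} {x y : List (Slice Unit)}
    (h : ∀ (w w' : List Bool) (X : List (Slice Bool)), n ≤ w.length → X.map Slice.forget = x →
      runSlices X w = some w' → ∃ Y : List (Slice Bool), Y.map Slice.forget = y ∧
        runSlices Y w = some w' ∧ (LocalMove X Y ∨ LocalMove Y X) ∧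
          writhe Y w = writhe X w + k) : Lifts n k x y := by
  intro w w' X hn hX hw
  obtain ⟨Y, hY, hYw, hXY, hk⟩ := h w w' X hn hX hw
  refine ⟨Y, hY, hYw, ?_, hk⟩
  rcases hXY with hXY | hXY
  · exact .rel _ _ ⟨hw, hYw, [], [], X, Y, hXY, by simp, by simp⟩
  · exact .symm _ _ (.rel _ _ ⟨hYw, hw, [], [], Y, X, hXY, by simp, by simp⟩)

namespace Eqv

theorem refl (n : ℕ) (x : List (Slice Unit)) : Eqv n 0 x x := ⟨.refl n x, by simpa using .refl n x⟩

theorem symm {n : ℕ} {k : ℤ} {x y : List (Slice Unit)} (h : Eqv n k x y) : Eqv n (-k) y x :=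
  ⟨h.bwd, by simpa using h.fwd⟩

theorem symm₀ {n : ℕ} {x y : List (Slice Unit)} (h : Eqv n 0 x y) : Eqv n 0 y x := by
  simpa using h.symm

theorem trans {n : ℕ} {k l : ℤ} {x y z : List (Slice Unit)} (h₁ : Eqv n k x y)
    (h₂ : Eqv n l y z) : Eqv n (k + l) x z :=
  ⟨h₁.fwd.trans h₂.fwd, by rw [neg_add_rev]; exact h₂.bwd.trans h₁.bwd⟩

theorem trans₀ {n : ℕ} {x y z : List (Slice Unit)} (h₁ : Eqv n 0 x y)
    (h₂ : Eqv n 0 y z) : Eqv n 0 x z := by simpa using h₁.trans h₂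

theorem ctx_of_le {n m : ℕ} {k : ℤ} {x y : List (Slice Unit)} (a b : List (Slice Unit))
    (h : Eqv m k x y) (ha : ∀ N M, n ≤ N → wd a N = some M → m ≤ M) :
    Eqv n k (a ++ x ++ b) (a ++ y ++ b) :=
  ⟨h.fwd.ctx_of_le a b ha, h.bwd.ctx_of_le a b ha⟩

theorem ctx {n m : ℕ} {k : ℤ} {x y : List (Slice Unit)} (a b : List (Slice Unit))
    (h : Eqv m k x y) (ha : wd a n = some m) : Eqv n k (a ++ x ++ b) (a ++ y ++ b) := by
  refine h.ctx_of_le a b fun N M hN hM => ?_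
  obtain ⟨j, rfl⟩ := Nat.exists_eq_add_of_le hN
  rw [wd_add a j ha] at hM
  have := Option.some.inj hM
  omega

theorem sh {n : ℕ} {k : ℤ} {x y : List (Slice Unit)} (j : ℕ) (h : Eqv n k x y) :
    Eqv (j + n) k (sh j x) (sh j y) := ⟨h.fwd.sh j, h.bwd.sh j⟩

theorem mono {n m : ℕ} {k : ℤ} {x y : List (Slice Unit)} (h : Eqv n k x y) (hnm : n ≤ m) :
    Eqv m k x y := ⟨h.fwd.mono hnm, h.bwd.mono hnm⟩

end Eqv

/-! ### The local moves as framed isotopies -/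

namespace Slice

theorem forget_eq_cup {σ : Slice Bool} {i : ℕ} : σ.forget = cup i () ↔ ∃ b, σ = cup i b := by
  cases σ <;> simp [forget]

theorem forget_eq_cap {σ : Slice Bool} {i : ℕ} : σ.forget = cap i ↔ σ = cap i := by
  cases σ <;> simp [forget]

theorem forget_eq_cross {σ : Slice Bool} {i : ℕ} {s : Bool} :
    σ.forget = cross i s ↔ σ = cross i s := by
  cases σ <;> simp [forget]

end Slice

theorem exists_cons_of_length {n : ℕ} {w : List Bool} (h : n + 1 ≤ w.length) :
    ∃ a r, w = a :: r ∧ n ≤ r.length := by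
  cases w with
  | nil => simp at h
  | cons a r => exact ⟨a, r, rfl, by simpa using h⟩

open Slice

theorem eqv_zigzag_left (i : ℕ) : Eqv (i + 1) 0 [cup i (), cap (i + 1)] [] := by
  suffices h : Eqv 1 0 [cup 0 (), cap 1] [] by simpa [sh, shift] using h.sh i
  constructor
  · refine Lifts.of_move fun w w' X hn hX hw => ?_
    obtain ⟨a, r, rfl, -⟩ := exists_cons_of_length hn
    simp only [List.map_eq_cons_iff, List.map_eq_nil_iff, forget_eq_cup, forget_eq_cap] at hX
    obtain ⟨_, _, rfl, ⟨b, rfl⟩, _, _, rfl, rfl, rfl⟩ := hX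
    refine ⟨[], rfl, ?_, .inl (.zigzag_left 0 b), ?_⟩
    · revert hw; cases a <;> cases b <;> simp [runSlices, act]
    · simp [writhe, sign]
  · refine Lifts.of_move fun w w' X hn hX hw => ?_
    obtain ⟨a, r, rfl, -⟩ := exists_cons_of_length hn
    obtain rfl := List.map_eq_nil_iff.1 hX
    refine ⟨[cup 0 a, cap 1], rfl, ?_, .inr (.zigzag_left 0 a), ?_⟩
    · revert hw; cases a <;> simp [runSlices, act]
    · simp [writhe, sign]

theorem eqv_zigzag_right (i : ℕ) : Eqv (i + 1) 0 [cup (i + 1) (), cap i] [] := by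
  suffices h : Eqv 1 0 [cup 1 (), cap 0] [] by simpa [sh, shift] using h.sh i
  constructor
  · refine Lifts.of_move fun w w' X hn hX hw => ?_
    obtain ⟨a, r, rfl, -⟩ := exists_cons_of_length hn
    simp only [List.map_eq_cons_iff, List.map_eq_nil_iff, forget_eq_cup, forget_eq_cap] at hX
    obtain ⟨_, _, rfl, ⟨b, rfl⟩, _, _, rfl, rfl, rfl⟩ := hX
    refine ⟨[], rfl, ?_, .inl (.zigzag_right 0 b), ?_⟩
    · revert hw; cases a <;> cases b <;> simp [runSlices, act]
    · simp [writhe, sign]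
  · refine Lifts.of_move fun w w' X hn hX hw => ?_
    obtain ⟨a, r, rfl, -⟩ := exists_cons_of_length hn
    obtain rfl := List.map_eq_nil_iff.1 hX
    refine ⟨[cup 1 !a, cap 0], rfl, ?_, .inr (.zigzag_right 0 !a), ?_⟩
    · revert hw; cases a <;> simp [runSlices, act]
    · simp [writhe, sign]

theorem eqv_slide_cup (i : ℕ) (s : Bool) :
    Eqv (i + 1) 0 [cup i (), cross (i + 1) s] [cup (i + 1) (), cross i (!s)] := by
  suffices h : Eqv 1 0 [cup 0 (), cross 1 s] [cup 1 (), cross 0 (!s)] by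
    simpa [sh, shift] using h.sh i
  constructor
  · refine Lifts.of_move fun w w' X hn hX hw => ?_
    obtain ⟨a, r, rfl, -⟩ := exists_cons_of_length hn
    simp only [List.map_eq_cons_iff, List.map_eq_nil_iff, forget_eq_cup, forget_eq_cross] at hX
    obtain ⟨_, _, rfl, ⟨b, rfl⟩, _, _, rfl, rfl, rfl⟩ := hX
    refine ⟨[cup 1 b, cross 0 !s], rfl, ?_, .inl (.slide_cup 0 b s), ?_⟩
    · revert hw; cases a <;> cases b <;> simp [runSlices, act]
    · cases a <;> cases b <;> cases s <;> simp [writhe, sign, act, crossingSign]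
  · refine Lifts.of_move fun w w' X hn hX hw => ?_
    obtain ⟨a, r, rfl, -⟩ := exists_cons_of_length hn
    simp only [List.map_eq_cons_iff, List.map_eq_nil_iff, forget_eq_cup, forget_eq_cross] at hX
    obtain ⟨_, _, rfl, ⟨b, rfl⟩, _, _, rfl, rfl, rfl⟩ := hX
    refine ⟨[cup 0 b, cross 1 s], rfl, ?_, .inr (.slide_cup 0 b s), ?_⟩
    · revert hw; cases a <;> cases b <;> simp [runSlices, act]
    · cases a <;> cases b <;> cases s <;> simp [writhe, sign, act, crossingSign]

theorem eqv_slide_cap (i : ℕ) (s : Bool) :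
    Eqv (i + 3) 0 [cross i s, cap (i + 1)] [cross (i + 1) (!s), cap i] := by
  suffices h : Eqv 3 0 [cross 0 s, cap 1] [cross 1 (!s), cap 0] by
    simpa [sh, shift] using h.sh i
  constructor
  · refine Lifts.of_move fun w w' X hn hX hw => ?_
    obtain ⟨a, w, rfl, hn₁⟩ := exists_cons_of_length hn
    obtain ⟨b, w, rfl, hn₂⟩ := exists_cons_of_length hn₁
    obtain ⟨c, r, rfl, -⟩ := exists_cons_of_length hn₂
    simp only [List.map_eq_cons_iff, List.map_eq_nil_iff, forget_eq_cap, forget_eq_cross] at hX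
    obtain ⟨_, _, rfl, rfl, _, _, rfl, rfl, rfl⟩ := hX
    refine ⟨[cross 1 !s, cap 0], rfl, ?_, .inl (.slide_cap 0 s), ?_⟩
    · revert hw; cases a <;> cases b <;> cases c <;> simp [runSlices, act]
    · revert hw
      cases a <;> cases b <;> cases c <;> cases s <;>
        simp [runSlices, writhe, sign, act, crossingSign]
  · refine Lifts.of_move fun w w' X hn hX hw => ?_
    obtain ⟨a, w, rfl, hn₁⟩ := exists_cons_of_length hn
    obtain ⟨b, w, rfl, hn₂⟩ := exists_cons_of_length hn₁
    obtain ⟨c, r, rfl, -⟩ := exists_cons_of_length hn₂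
    simp only [List.map_eq_cons_iff, List.map_eq_nil_iff, forget_eq_cap, forget_eq_cross] at hX
    obtain ⟨_, _, rfl, rfl, _, _, rfl, rfl, rfl⟩ := hX
    refine ⟨[cross 0 s, cap 1], rfl, ?_, .inr (.slide_cap 0 s), ?_⟩
    · revert hw; cases a <;> cases b <;> cases c <;> simp [runSlices, act]
    · revert hw
      cases a <;> cases b <;> cases c <;> cases s <;>
        simp [runSlices, writhe, sign, act, crossingSign]

/-- The writhe of a curl with a crossing of the given kind, for each of its orientations. -/
def curlSign (s : Bool) : ℤ := if s then 1 else -1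

theorem eqv_reidemeister1_right (i : ℕ) (s : Bool) :
    Eqv (i + 1) (-curlSign s) [cup (i + 1) (), cross i s, cap (i + 1)] [] := by
  suffices h : Eqv 1 (-curlSign s) [cup 1 (), cross 0 s, cap 1] [] by
    simpa [sh, shift] using h.sh i
  constructor
  · refine Lifts.of_move fun w w' X hn hX hw => ?_
    obtain ⟨a, r, rfl, -⟩ := exists_cons_of_length hn
    simp only [List.map_eq_cons_iff, List.map_eq_nil_iff, forget_eq_cup, forget_eq_cap,
      forget_eq_cross] at hX
    obtain ⟨_, _, rfl, ⟨b, rfl⟩, _, _, rfl, rfl, _, _, rfl, rfl, rfl⟩ := hX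
    refine ⟨[], rfl, ?_, .inl (.reidemeister1_right 0 b s), ?_⟩
    · revert hw; cases a <;> cases b <;> simp [runSlices, act]
    · revert hw
      cases a <;> cases b <;> cases s <;>
        simp [runSlices, writhe, sign, act, crossingSign, curlSign]
  · refine Lifts.of_move fun w w' X hn hX hw => ?_
    obtain ⟨a, r, rfl, -⟩ := exists_cons_of_length hn
    obtain rfl := List.map_eq_nil_iff.1 hX
    refine ⟨[cup 1 a, cross 0 s, cap 1], rfl, ?_, .inr (.reidemeister1_right 0 a s), ?_⟩
    · revert hw; cases a <;> simp [runSlices, act]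
    · cases a <;> cases s <;> simp [writhe, sign, act, crossingSign, curlSign]

theorem eqv_reidemeister2 (i : ℕ) (s : Bool) :
    Eqv (i + 2) 0 [cross i s, cross i (!s)] [] := by
  suffices h : Eqv 2 0 [cross 0 s, cross 0 (!s)] [] by simpa [sh, shift] using h.sh i
  constructor
  · refine Lifts.of_move fun w w' X hn hX hw => ?_
    obtain ⟨a, w, rfl, hn₁⟩ := exists_cons_of_length hn
    obtain ⟨b, r, rfl, -⟩ := exists_cons_of_length hn₁
    simp only [List.map_eq_cons_iff, List.map_eq_nil_iff, forget_eq_cross] at hX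
    obtain ⟨_, _, rfl, rfl, _, _, rfl, rfl, rfl⟩ := hX
    refine ⟨[], rfl, ?_, .inl (.reidemeister2 0 s), ?_⟩
    · revert hw; simp [runSlices, act]
    · cases a <;> cases b <;> cases s <;> simp [writhe, sign, act, crossingSign]
  · refine Lifts.of_move fun w w' X hn hX hw => ?_
    obtain ⟨a, w, rfl, hn₁⟩ := exists_cons_of_length hn
    obtain ⟨b, r, rfl, -⟩ := exists_cons_of_length hn₁
    obtain rfl := List.map_eq_nil_iff.1 hX
    refine ⟨[cross 0 s, cross 0 !s], rfl, ?_, .inr (.reidemeister2 0 s), ?_⟩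
    · revert hw; simp [runSlices, act]
    · cases a <;> cases b <;> cases s <;> simp [writhe, sign, act, crossingSign]

theorem eqv_reidemeister3 (i : ℕ) (s t u : Bool) (h : s = u → t = s) :
    Eqv (i + 3) 0 [cross i s, cross (i + 1) t, cross i u]
      [cross (i + 1) u, cross i t, cross (i + 1) s] := by
  suffices h : Eqv 3 0 [cross 0 s, cross 1 t, cross 0 u] [cross 1 u, cross 0 t, cross 1 s] by
    simpa [sh, shift] using h.sh i
  constructor
  · refine Lifts.of_move fun w w' X hn hX hw => ?_
    obtain ⟨a, w, rfl, hn₁⟩ := exists_cons_of_length hn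
    obtain ⟨b, w, rfl, hn₂⟩ := exists_cons_of_length hn₁
    obtain ⟨c, r, rfl, -⟩ := exists_cons_of_length hn₂
    simp only [List.map_eq_cons_iff, List.map_eq_nil_iff, forget_eq_cross] at hX
    obtain ⟨_, _, rfl, rfl, _, _, rfl, rfl, _, _, rfl, rfl, rfl⟩ := hX
    refine ⟨_, rfl, ?_, .inl (.reidemeister3 0 s t u h), ?_⟩
    · revert hw; simp [runSlices, act]
    · simp [writhe, sign, act]; ring
  · refine Lifts.of_move fun w w' X hn hX hw => ?_
    obtain ⟨a, w, rfl, hn₁⟩ := exists_cons_of_length hn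
    obtain ⟨b, w, rfl, hn₂⟩ := exists_cons_of_length hn₁
    obtain ⟨c, r, rfl, -⟩ := exists_cons_of_length hn₂
    simp only [List.map_eq_cons_iff, List.map_eq_nil_iff, forget_eq_cross] at hX
    obtain ⟨_, _, rfl, rfl, _, _, rfl, rfl, _, _, rfl, rfl, rfl⟩ := hX
    refine ⟨_, rfl, ?_, .inr (.reidemeister3 0 s t u h), ?_⟩
    · revert hw; simp [runSlices, act]
    · simp [writhe, sign, act]; ring

theorem runSlices_exchange (σ τ : Slice Bool) (v r : List Bool) {m : ℕ}
    (h : σ.forget.width v.length = some m) :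
    runSlices [σ, τ.shift m] (v ++ r) = runSlices [τ.shift v.length, σ] (v ++ r) ∧
      ((runSlices [σ, τ.shift m] (v ++ r)).isSome →
        writhe [σ, τ.shift m] (v ++ r) = writhe [τ.shift v.length, σ] (v ++ r)) := by
  simp only [runSlices, Slice.act_append_of_width σ v r h, act_shift]
  cases hv : σ.act v with
  | none =>
    cases hr : τ.act r <;> simp
    rw [Slice.act_append_of_width σ v _ h, hv]; rfl
  | some v' =>
    obtain rfl := Slice.width_eq_some_of_act σ v h v' hv
    simp only [Option.map_some, Option.bind_some, act_shift]
    cases hr : τ.act r with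
    | none => simp
    | some r' =>
      simp [act_append σ _ hv, writhe, act_shift, hr, sign_shift, sign_append σ _ hv, add_comm]

/-- Two slices side by side change their heights. -/
theorem eqv_exchange_slice (σ τ : Slice Unit) {n m : ℕ} (h : σ.width n = some m) :
    Eqv n 0 [σ, τ.shift m] [τ.shift n, σ] := by
  -- the strands between the two slices are added to `τ`
  obtain ⟨e, hn, hm⟩ : ∃ e, n = σ.pos + σ.ins + e ∧ m = σ.pos + σ.outs + e := by
    rcases σ with ⟨i, o⟩ | i | ⟨i, s⟩ <;> simp only [width, Option.ite_none_right_eq_some,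
      Option.some.injEq] at h
    · exact ⟨n - i, by simp only [pos, ins]; omega, by simp only [pos, outs]; omega⟩
    · exact ⟨n - (i + 2), by simp only [pos, ins]; omega, by simp only [pos, outs]; omega⟩
    · exact ⟨n - (i + 2), by simp only [pos, ins]; omega, by simp only [pos, outs]; omega⟩
  have hlm : ∀ σ' τ' : Slice Bool, σ'.forget = σ →
      LocalMove [σ', τ'.shift m] [τ'.shift n, σ'] := by
    rintro σ' τ' rfl
    have hp : σ'.forget.pos = σ'.pos := by cases σ' <;> rfl
    have ho : σ'.forget.outs = σ'.outs := by cases σ' <;> rfl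
    have hi : σ'.forget.ins = σ'.ins := by cases σ' <;> rfl
    have := LocalMove.exchange σ' (τ'.shift e)
    rwa [shift_shift, shift_shift, ← hp, ← ho, ← hi, ← hn, ← hm] at this
  constructor
  · refine Lifts.of_move fun w w' X hl hX hw => ?_
    simp only [List.map_eq_cons_iff, List.map_eq_nil_iff] at hX
    obtain ⟨σ', _, rfl, rfl, τ', _, rfl, hτ, rfl⟩ := hX
    obtain ⟨τ', rfl, rfl⟩ := exists_shift_of_forget hτ
    obtain ⟨v, r, rfl, rfl⟩ : ∃ v r, w = v ++ r ∧ n = v.length :=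
      ⟨w.take n, w.drop n, by simp, by simp; omega⟩
    have := runSlices_exchange σ' τ' v r h
    refine ⟨[τ'.shift v.length, σ'], by simp [forget_shift], this.1 ▸ hw, .inl (hlm _ _ rfl), ?_⟩
    rw [this.2 (by simp [hw]), add_zero]
  · refine Lifts.of_move fun w w' X hl hX hw => ?_
    simp only [List.map_eq_cons_iff, List.map_eq_nil_iff] at hX
    obtain ⟨τ', _, rfl, hτ, σ', _, rfl, rfl, rfl⟩ := hX
    obtain ⟨τ', rfl, rfl⟩ := exists_shift_of_forget hτ
    obtain ⟨v, r, rfl, rfl⟩ : ∃ v r, w = v ++ r ∧ n = v.length :=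
      ⟨w.take n, w.drop n, by simp, by simp; omega⟩
    have := runSlices_exchange σ' τ' v r h
    refine ⟨[σ', τ'.shift m], by simp [forget_shift], this.1 ▸ hw, .inr (hlm _ _ rfl), ?_⟩
    rw [this.2 (by simp [this.1, hw])]; simp

theorem le_of_width_shift (τ : Slice Unit) {j n m : ℕ} (h : (τ.shift j).width n = some m) :
    j ≤ m := by
  cases τ <;> simp [width, shift] at h <;> omega

theorem eqv_commute_slice (σ : Slice Unit) (y : List (Slice Unit)) {n m : ℕ}
    (h : σ.width n = some m) : Eqv n 0 (σ :: sh m y) (sh n y ++ [σ]) := by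
  induction y with
  | nil => exact .refl _ _
  | cons τ y ih =>
    refine Eqv.trans₀ (y := τ.shift n :: σ :: sh m y) ?_ ?_
    · simpa using (eqv_exchange_slice σ τ h).ctx [] (sh m y) rfl
    · have := ih.ctx_of_le (n := n) [τ.shift n] [] fun N M hN hM => by
        cases hw : (τ.shift n).width N with
        | none => simp [wd, hw] at hM
        | some v =>
          obtain rfl : v = M := by simpa [wd, hw] using hM
          exact le_of_width_shift τ hw
      simpa using this

/-- Two words side by side change their heights. -/
theorem eqv_commute (x y : List (Slice Unit)) {n m : ℕ} (h : wd x n = some m) :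
    Eqv n 0 (x ++ sh m y) (sh n y ++ x) := by
  induction x generalizing n with
  | nil =>
    obtain rfl := Option.some.inj h
    simpa using Eqv.refl n (sh n y)
  | cons σ x ih =>
    simp only [wd] at h
    cases hw : σ.width n with
    | none => simp [hw] at h
    | some v =>
      have h₁ := (ih (n := v) (by simpa [hw] using h)).ctx (n := n) [σ] [] (by simp [wd, hw])
      have h₂ := (eqv_commute_slice σ y hw).ctx (n := n) [] x rfl
      simpa using h₁.trans₀ (by simpa using h₂)

instance (n : ℕ) (k : ℤ) : Trans (Eqv n 0) (Eqv n k) (Eqv n k) :=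
  ⟨fun h₁ h₂ => by simpa using h₁.trans h₂⟩

instance (n : ℕ) (k : ℤ) : Trans (Eqv n k) (Eqv n 0) (Eqv n k) :=
  ⟨fun h₁ h₂ => by simpa using h₁.trans h₂⟩

theorem Eqv.within {n m m' : ℕ} {k : ℤ} {x y u v : List (Slice Unit)} (h : Eqv m k x y)
    (a b : List (Slice Unit)) (ha : wd a n = some m') (hm : m ≤ m') (hu : u = a ++ x ++ b)
    (hv : v = a ++ y ++ b) : Eqv n k u v := by
  subst hu hv
  exact (h.mono hm).ctx a b ha

theorem map_shift_shift (j k : ℕ) (x : List (Slice Unit)) :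
    (x.map (Slice.shift k)).map (Slice.shift j) = x.map (Slice.shift (j + k)) := sh_sh j k x

/-! ### Curls and sweeping a strand across a word -/

theorem eqv_reidemeister2' (i : ℕ) (s : Bool) :
    Eqv (i + 2) 0 [cross i (!s), cross i s] [] := by
  simpa using eqv_reidemeister2 i (!s)

/-- A crossing on top of a minimum is a curl. -/
theorem eqv_curl_cup (i : ℕ) (s : Bool) :
    Eqv i (curlSign s) [cup i (), cross i s] [cup i ()] := by
  calc Eqv i 0 [cup i (), cross i s] [cup i (), cross i s, cup i (), cap (i + 1)] :=
        (eqv_zigzag_left i).symm₀.within [cup i (), cross i s] [] (m' := i + 2)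
          (by simp [wd, width]) (by omega) (by simp) (by simp)
    Eqv i 0 _ [cup i (), cup (i + 2) (), cross (i + 2) s, cap (i + 1)] :=
        (eqv_commute [cup i ()] [cup 0 (), cross 0 s] (n := i) (m := i + 2)
          (by simp [wd, width])).symm₀.within [] [cap (i + 1)] rfl le_rfl
          (by simp [shift]) (by simp [shift])
    Eqv i 0 _ [cup i (), cup (i + 2) (), cross (i + 1) (!s), cap (i + 2)] :=
        (eqv_slide_cap (i + 1) (!s)).symm₀.within [cup i (), cup (i + 2) ()] [] (m' := i + 4)
          (by simp [wd, width]) (by omega) (by simp) (by simp)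
    Eqv i (curlSign s) _ [cup i ()] := by
        have := (eqv_reidemeister1_right (i + 1) (!s)).within (n := i) [cup i ()] [] (m' := i + 2)
          (by simp [wd, width]) (by omega) rfl rfl
        have hs : -curlSign (!s) = curlSign s := by cases s <;> simp [curlSign]
        simpa [hs] using this

theorem eqv_curl_cap (i : ℕ) (s : Bool) :
    Eqv (i + 2) (curlSign s) [cross i s, cap i] [cap i] := by
  calc Eqv (i + 2) 0 [cross i s, cap i] [cup (i + 1) (), cap i, cross i s, cap i] :=
        (eqv_zigzag_right i).symm₀.within [] [cross i s, cap i] rfl (by omega) (by simp) (by simp)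
    Eqv (i + 2) 0 _ [cup (i + 1) (), cross (i + 2) s, cap (i + 2), cap i] :=
        (eqv_commute [cap i] [cross 0 s, cap 0] (n := i + 2) (m := i)
          (by simp [wd, width])).within [cup (i + 1) ()] [] (m' := i + 4)
          (by simp [wd, width]) (by omega) (by simp [shift]) (by simp [shift])
    Eqv (i + 2) 0 _ [cup (i + 2) (), cross (i + 1) (!s), cap (i + 2), cap i] :=
        (eqv_slide_cup (i + 1) s).within [] [cap (i + 2), cap i] rfl (by omega) (by simp) (by simp)
    Eqv (i + 2) (curlSign s) _ [cap i] := by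
        have := (eqv_reidemeister1_right (i + 1) (!s)).within (n := i + 2) [] [cap i] rfl
          (by omega) rfl rfl
        have hs : -curlSign (!s) = curlSign s := by cases s <;> simp [curlSign]
        simpa [hs] using this

/-- The strand number `j` moves to the right across `n` strands; it is the over-strand if
`s = true` and the under-strand otherwise. -/
def row (s : Bool) : ℕ → ℕ → List (Slice Unit)
  | _, 0 => []
  | j, n + 1 => cross j s :: row s (j + 1) n

theorem row_add (s : Bool) (j n m : ℕ) : row s j (n + m) = row s j n ++ row s (j + n) m := by
  induction n generalizing j with
  | zero => simp [row]
  | succ n ih =>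
    rw [Nat.succ_add, row, ih, row]
    simp [Nat.add_assoc, Nat.add_comm 1 n]

theorem sh_row (s : Bool) (k j n : ℕ) : sh k (row s j n) = row s (k + j) n := by
  induction n generalizing j with
  | zero => rfl
  | succ n ih =>
    have := ih (j + 1)
    simp only [sh] at this
    simp [row, shift, this, Nat.add_assoc]

theorem wd_row (s : Bool) (j n N : ℕ) (h : j + n + 1 ≤ N) : wd (row s j n) N = some N := by
  induction n generalizing j with
  | zero => rfl
  | succ n ih =>
    have h₁ : j + 2 ≤ N := by omega
    simpa [row, wd, width, h₁] using ih (j + 1) (by omega)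

theorem row_split (s : Bool) (i e : ℕ) : row s 0 (i + 2 + e) =
    row s 0 i ++ cross i s :: cross (i + 1) s :: row s (i + 2) e := by
  rw [row_add, row_add]
  simp [row]

/-- A strand that passes over, or under, all other strands moves from above one slice to below
it. -/
theorem eqv_sweep_slice (s : Bool) (σ : Slice Unit) {n m : ℕ} (h : σ.width n = some m) :
    Eqv (n + 1) 0 (σ.shift 1 :: row s 0 m) (row s 0 n ++ [σ]) := by
  rcases σ with ⟨i, ⟨⟩⟩ | i | ⟨i, t⟩
  · obtain ⟨e, rfl, rfl⟩ : ∃ e, n = i + e ∧ m = i + 2 + e := by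
      simp [width] at h; exact ⟨n - i, by omega, by omega⟩
    calc
      Eqv (i + e + 1) 0 (shift 1 (cup i ()) :: row s 0 (i + 2 + e))
          (row s 0 i ++ cup (i + 1) () :: cross i s :: cross (i + 1) s :: row s (i + 2) e) :=
        (eqv_commute (row s 0 i) [cup 0 ()] (wd_row s 0 i (i + 1) (by omega))).symm₀.within []
          (cross i s :: cross (i + 1) s :: row s (i + 2) e) rfl (by omega)
          (by simp [row_split, shift, Nat.add_comm 1]) (by simp [shift])
      Eqv (i + e + 1) 0 _
          (row s 0 i ++ cup i () :: cross (i + 1) (!s) :: cross (i + 1) s :: row s (i + 2) e) :=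
        (eqv_slide_cup i (!s)).symm₀.within (row s 0 i) (cross (i + 1) s :: row s (i + 2) e)
          (wd_row s 0 i _ (by omega)) (by omega) (by simp) (by simp)
      Eqv (i + e + 1) 0 _ (row s 0 i ++ cup i () :: row s (i + 2) e) :=
        (eqv_reidemeister2' (i + 1) s).within (row s 0 i ++ [cup i ()]) (row s (i + 2) e)
          (m' := i + e + 3) (by rw [wd_append, wd_row s 0 i _ (by omega)]; simp [wd, width]; omega)
          (by omega) (by simp) (by simp)
      Eqv (i + e + 1) 0 _ (row s 0 (i + e) ++ [cup i ()]) :=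
        (eqv_commute [cup i ()] (row s 0 e) (n := i) (m := i + 2) (by simp [wd, width])).within
          (row s 0 i) [] (wd_row s 0 i _ (by omega)) (by omega) (by simp [sh_row])
          (by simp [sh_row, row_add])
  · obtain ⟨e, rfl, rfl⟩ : ∃ e, m = i + e ∧ n = i + 2 + e := by
      simp [width] at h; exact ⟨n - i - 2, by omega, by omega⟩
    calc
      Eqv (i + 2 + e + 1) 0 (shift 1 (cap i) :: row s 0 (i + e))
          (row s 0 i ++ cap (i + 1) :: row s i e) :=
        (eqv_commute (row s 0 i) [cap 0] (wd_row s 0 i (i + 1) (by omega))).symm₀.within []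
          (row s i e) rfl (by omega)
          (by simp [row_add, shift, Nat.add_comm 1]) (by simp [shift])
      Eqv (i + 2 + e + 1) 0 _
          (row s 0 i ++ cross i s :: cross i (!s) :: cap (i + 1) :: row s i e) :=
        (eqv_reidemeister2 i s).symm₀.within (row s 0 i) (cap (i + 1) :: row s i e)
          (wd_row s 0 i _ (by omega)) (by omega) (by simp) (by simp)
      Eqv (i + 2 + e + 1) 0 _
          (row s 0 i ++ cross i s :: cross (i + 1) s :: cap i :: row s i e) :=
        (eqv_slide_cap i (!s)).within (row s 0 i ++ [cross i s]) (row s i e)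
          (m' := i + 2 + e + 1)
          (by rw [wd_append, wd_row s 0 i _ (by omega)]; simp [wd, width]; omega)
          (by omega) (by simp) (by simp)
      Eqv (i + 2 + e + 1) 0 _ (row s 0 (i + 2 + e) ++ [cap i]) :=
        (eqv_commute [cap i] (row s 0 e) (n := i + 2) (m := i) (by simp [wd, width])).within
          (row s 0 i ++ [cross i s, cross (i + 1) s]) [] (m' := i + 2 + e + 1)
          (by rw [wd_append, wd_row s 0 i _ (by omega)]; simp [wd, width,
            show i + 2 ≤ i + 2 + e + 1 by omega, show i + 1 + 2 ≤ i + 2 + e + 1 by omega])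
          (by omega) (by simp [sh_row])
          (by simp [sh_row, row_split])
  · obtain ⟨e, rfl, rfl⟩ : ∃ e, n = i + 2 + e ∧ m = i + 2 + e := by
      simp [width] at h; exact ⟨n - i - 2, by omega, by omega⟩
    calc
      Eqv (i + 2 + e + 1) 0 (shift 1 (cross i t) :: row s 0 (i + 2 + e))
          (row s 0 i ++ cross (i + 1) t :: cross i s :: cross (i + 1) s :: row s (i + 2) e) :=
        (eqv_commute (row s 0 i) [cross 0 t] (wd_row s 0 i (i + 1) (by omega))).symm₀.within []
          (cross i s :: cross (i + 1) s :: row s (i + 2) e) rfl (by omega)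
          (by simp [row_split, shift, Nat.add_comm 1]) (by simp [shift])
      Eqv (i + 2 + e + 1) 0 _
          (row s 0 i ++ cross i s :: cross (i + 1) s :: cross i t :: row s (i + 2) e) :=
        (eqv_reidemeister3 i s s t (fun _ => rfl)).symm₀.within (row s 0 i) (row s (i + 2) e)
          (wd_row s 0 i _ (by omega)) (by omega) (by simp) (by simp)
      Eqv (i + 2 + e + 1) 0 _ (row s 0 (i + 2 + e) ++ [cross i t]) :=
        (eqv_commute [cross i t] (row s 0 e) (n := i + 2) (m := i + 2)
          (by simp [wd, width])).within
          (row s 0 i ++ [cross i s, cross (i + 1) s]) [] (m' := i + 2 + e + 1)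
          (by rw [wd_append, wd_row s 0 i _ (by omega)]; simp [wd, width,
            show i + 2 ≤ i + 2 + e + 1 by omega, show i + 1 + 2 ≤ i + 2 + e + 1 by omega])
          (by omega) (by simp [sh_row])
          (by simp [sh_row, row_split])

theorem eqv_sweep (s : Bool) (x : List (Slice Unit)) {n m : ℕ} (h : wd x n = some m) :
    Eqv (n + 1) 0 (sh 1 x ++ row s 0 m) (row s 0 n ++ x) := by
  induction x generalizing n with
  | nil =>
    obtain rfl := Option.some.inj h
    simpa using Eqv.refl _ (row s 0 n)
  | cons σ x ih =>
    simp only [wd] at h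
    cases hw : σ.width n with
    | none => simp [hw] at h
    | some v =>
      have hw' := Slice.width_shift σ 1 hw
      have h₁ := (ih (n := v) (by simpa [hw] using h)).within (n := n + 1) [σ.shift 1] []
        (m' := v + 1) (by simp [wd, Nat.add_comm n 1, hw', Nat.add_comm v 1]) le_rfl rfl rfl
      have h₂ := (eqv_sweep_slice s σ hw).within (n := n + 1) [] x rfl le_rfl rfl rfl
      simpa using h₁.trans₀ (by simpa using h₂)

theorem row_inverse (s : Bool) (j n N : ℕ) (h : j + n + 1 ≤ N) :
    Eqv N 0 (row s j n ++ (row (!s) j n).reverse) [] := by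
  induction n generalizing j with
  | zero => exact .refl _ _
  | succ n ih =>
    calc Eqv N 0 (row s j (n + 1) ++ (row (!s) j (n + 1)).reverse) [cross j s, cross j (!s)] :=
          (ih (j + 1) (by omega)).within [cross j s] [cross j (!s)] (m' := N)
            (by simp [wd, width]; omega) le_rfl (by simp [row]) (by simp)
      Eqv N 0 _ [] := (eqv_reidemeister2 j s).mono (by omega)

theorem reverse_row_inverse (s : Bool) (j n N : ℕ) (h : j + n + 1 ≤ N) :
    Eqv N 0 ((row s j n).reverse ++ row (!s) j n) [] := by
  induction n generalizing j with
  | zero => exact .refl _ _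
  | succ n ih =>
    have hr : wd (row s (j + 1) n).reverse N = some N := by
      clear ih
      generalize hl : row s (j + 1) n = l
      have hl' : ∀ σ ∈ l, σ.width N = some N := by
        subst hl
        have : ∀ n j, j + n + 1 ≤ N → ∀ σ ∈ row s j n, σ.width N = some N := by
          intro n
          induction n with
          | zero => simp [row]
          | succ n ih =>
            intro j hj σ hσ
            rcases List.mem_cons.1 hσ with rfl | hσ
            · simp [width]; omega
            · exact ih (j + 1) (by omega) σ hσ
        exact this n (j + 1) (by omega)
      clear hl
      induction l with
      | nil => rfl
      | cons σ l ih =>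
        rw [List.reverse_cons, wd_append, ih fun τ hτ => hl' τ (List.mem_cons_of_mem _ hτ)]
        simp [wd, hl' σ List.mem_cons_self]
    calc Eqv N 0 ((row s j (n + 1)).reverse ++ row (!s) j (n + 1))
            ((row s (j + 1) n).reverse ++ row (!s) (j + 1) n) :=
          (eqv_reidemeister2 j s).within (row s (j + 1) n).reverse (row (!s) (j + 1) n)
            hr (by omega) (by simp [row]) (by simp)
      Eqv N 0 _ [] := ih (j + 1) (by omega)

/-- The sweep with a strand that moves to the left. -/
theorem eqv_sweep_reverse (s : Bool) (x : List (Slice Unit)) {n m : ℕ} (h : wd x n = some m) :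
    Eqv (n + 1) 0 ((row s 0 n).reverse ++ sh 1 x) (x ++ (row s 0 m).reverse) := by
  have hx : wd x (n + 1) = some (m + 1) := wd_add x 1 h
  have hs := wd_sh x 1 h
  rw [Nat.add_comm 1 n, Nat.add_comm 1 m] at hs
  have hr : ∃ N, wd (row s 0 n).reverse (n + 1) = some N ∧ n + 1 ≤ N := by
    have : ∀ (x : List (Slice Unit)) (n : ℕ), (∀ σ ∈ x, ∃ i t, σ = cross i t ∧ i + 2 ≤ n) →
        wd x n = some n := by
      intro x n hx
      induction x with
      | nil => rfl
      | cons σ x ih =>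
        obtain ⟨i, t, rfl, hi⟩ := hx σ List.mem_cons_self
        simpa [wd, width, hi] using ih fun τ hτ => hx τ (List.mem_cons_of_mem _ hτ)
    refine ⟨n + 1, this _ _ fun σ hσ => ?_, le_rfl⟩
    rw [List.mem_reverse] at hσ
    have : ∀ n j, ∀ σ ∈ row s j n, ∃ i t, σ = cross i t ∧ i + 1 ≤ j + n := by
      intro n
      induction n with
      | zero => simp [row]
      | succ n ih =>
        intro j σ hσ
        rcases List.mem_cons.1 hσ with rfl | hσ
        · exact ⟨j, s, rfl, by omega⟩
        · obtain ⟨i, t, rfl, hi⟩ := ih (j + 1) σ hσ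
          exact ⟨i, t, rfl, by omega⟩
    obtain ⟨i, t, rfl, hi⟩ := this n 0 σ hσ
    exact ⟨i, t, rfl, by omega⟩
  obtain ⟨N, hN, hnN⟩ := hr
  calc
    Eqv (n + 1) 0 ((row s 0 n).reverse ++ sh 1 x)
        ((row s 0 n).reverse ++ sh 1 x ++ row (!s) 0 m ++ (row s 0 m).reverse) := by
      have := (row_inverse (!s) 0 m (m + 1) (by omega)).symm₀.ctx (n := n + 1)
        (sh 1 x) [] hs
      exact this.within (row s 0 n).reverse [] hN hnN (by simp) (by simp)
    Eqv (n + 1) 0 _ ((row s 0 n).reverse ++ row (!s) 0 n ++ x ++ (row s 0 m).reverse) :=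
      (eqv_sweep (!s) x h).within (row s 0 n).reverse (row s 0 m).reverse hN hnN
        (by simp) (by simp)
    Eqv (n + 1) 0 _ (x ++ (row s 0 m).reverse) :=
      (reverse_row_inverse s 0 n (n + 1) (by omega)).within [] (x ++ (row s 0 m).reverse) rfl
        le_rfl (by simp) (by simp)

/-! ### Rotations of tangles -/

/-- The tangle turned by a quarter turn to the left. -/
def rotL (x : List (Slice Unit)) : List (Slice Unit) := cup 2 () :: (sh 1 x ++ [cap 0])

/-- The tangle turned by a quarter turn to the right. -/
def rotR (x : List (Slice Unit)) : List (Slice Unit) := cup 0 () :: (sh 1 x ++ [cap 2])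

theorem wd_tangle_sh {x : List (Slice Unit)} (hx : wd x 2 = some 2) {k N : ℕ} (h : k + 2 ≤ N) :
    wd (sh k x) N = some N := by
  obtain ⟨e, rfl⟩ := Nat.exists_eq_add_of_le h
  exact wd_add _ e (wd_sh x k hx)

theorem wd_tangle {x : List (Slice Unit)} (hx : wd x 2 = some 2) {N : ℕ} (h : 2 ≤ N) :
    wd x N = some N := by
  obtain ⟨e, rfl⟩ := Nat.exists_eq_add_of_le h
  exact wd_add _ e hx

theorem wd_rotL {x : List (Slice Unit)} (hx : wd x 2 = some 2) : wd (rotL x) 2 = some 2 := by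
  have := wd_tangle_sh hx (k := 1) (N := 4) (by omega)
  simp only [sh] at this
  simp [rotL, wd, width, wd_append, this]

theorem wd_rotR {x : List (Slice Unit)} (hx : wd x 2 = some 2) : wd (rotR x) 2 = some 2 := by
  have := wd_tangle_sh hx (k := 1) (N := 4) (by omega)
  simp only [sh] at this
  simp [rotR, wd, width, wd_append, this]

theorem Eqv.rotL {k : ℤ} {x y : List (Slice Unit)} (h : Eqv 2 k x y) :
    Eqv 2 k (rotL x) (rotL y) :=
  (h.sh 1).within [cup 2 ()] [cap 0] (m' := 4) rfl (by omega) rfl rfl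

theorem Eqv.rotR {k : ℤ} {x y : List (Slice Unit)} (h : Eqv 2 k x y) :
    Eqv 2 k (rotR x) (rotR y) :=
  (h.sh 1).within [cup 0 ()] [cap 2] (m' := 4) rfl (by omega) rfl rfl

theorem rotR_rotL {x : List (Slice Unit)} (hx : wd x 2 = some 2) :
    Eqv 2 0 (rotR (rotL x)) x := by
  calc
    Eqv 2 0 (rotR (rotL x)) (cup 1 () :: x ++ [cup 0 (), cap 1, cap 2]) :=
      (eqv_commute [cup 0 ()] (cup 1 () :: x) (n := 0) (m := 2) rfl).within [] [cap 1, cap 2] rfl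
        (by omega) (by simp [rotL, rotR, shift, map_shift_shift, -List.map_map])
        (by have := sh_zero x; simp only [sh] at this; simp [shift, this])
    Eqv 2 0 _ (cup 1 () :: x ++ [cap 2]) :=
      (eqv_zigzag_left 0).within (cup 1 () :: x) [cap 2] (m' := 4)
        (by simp [wd, width, wd_tangle hx]) (by omega) (by simp) (by simp)
    Eqv 2 0 _ (cup 1 () :: cap 2 :: x) :=
      (eqv_commute x [cap 0] hx).within [cup 1 ()] [] (m' := 4) rfl (by omega) (by simp [shift])
        (by simp [shift])
    Eqv 2 0 _ x := (eqv_zigzag_left 1).within [] x rfl (by omega) (by simp) (by simp)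

theorem rotL_rotR {x : List (Slice Unit)} (hx : wd x 2 = some 2) :
    Eqv 2 0 (rotL (rotR x)) x := by
  calc
    Eqv 2 0 (rotL (rotR x)) (cup 2 () :: cup 1 () :: cap 0 :: x ++ [cap 1]) :=
      (eqv_commute [cap 0] (x ++ [cap 1]) (n := 2) (m := 0) rfl).symm₀.within
        [cup 2 (), cup 1 ()] [] (m' := 6) rfl
        (by omega) (by simp [rotL, rotR, shift, map_shift_shift, -List.map_map])
        (by have := sh_zero x; simp only [sh] at this; simp [shift, this])
    Eqv 2 0 _ (cup 2 () :: x ++ [cap 1]) :=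
      (eqv_zigzag_right 0).within [cup 2 ()] (x ++ [cap 1]) (m' := 4) rfl (by omega) (by simp)
        (by simp)
    Eqv 2 0 _ (x ++ [cup 2 (), cap 1]) :=
      (eqv_commute x [cup 0 ()] hx).symm₀.within [] [cap 1] rfl (by omega) (by simp [shift])
        (by simp [shift])
    Eqv 2 0 _ x := (eqv_zigzag_right 1).within x [] hx (by omega) (by simp) (by simp)

/-- A half turn moves a crossing below a tangle above it. -/
theorem rotL_rotL_cross {x : List (Slice Unit)} (hx : wd x 2 = some 2) (s : Bool) :
    Eqv 2 0 (rotL (rotL (cross 0 s :: x))) (rotL (rotL x) ++ [cross 0 s]) := by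
  calc
    Eqv 2 0 (rotL (rotL (cross 0 s :: x)))
        ([cup 2 (), cup 2 (), cross 3 (!s)] ++ sh 2 x ++ [cap 1, cap 0]) :=
      (eqv_slide_cup 2 (!s)).symm₀.within [cup 2 ()] (sh 2 x ++ [cap 1, cap 0]) (m' := 4) rfl
        (by omega) (by simp [rotL, shift, map_shift_shift, -List.map_map]) (by simp)
    Eqv 2 0 _ ([cup 2 (), cup 4 (), cross 3 (!s)] ++ sh 2 x ++ [cap 1, cap 0]) :=
      (eqv_commute [cup 2 ()] [cup 0 ()] (n := 2) (m := 4) rfl).symm₀.within []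
        (cross 3 (!s) :: (sh 2 x ++ [cap 1, cap 0])) rfl (by omega) (by simp [shift])
        (by simp [shift])
    Eqv 2 0 _ ([cup 2 (), cup 3 (), cross 4 s] ++ sh 2 x ++ [cap 1, cap 0]) :=
      (eqv_slide_cup 3 s).symm₀.within [cup 2 ()] (sh 2 x ++ [cap 1, cap 0]) (m' := 4) rfl
        (by omega) (by simp) (by simp)
    Eqv 2 0 _ (rotL (rotL x) ++ [cross 0 s]) :=
      (eqv_commute (sh 2 x ++ [cap 1, cap 0]) [cross 0 s] (n := 4) (m := 0)
        (by rw [wd_append, wd_tangle_sh hx (by omega)]; rfl)).symm₀.within [cup 2 (), cup 3 ()] []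
        (m' := 6) rfl (by omega) (by simp [shift])
        (by simp [rotL, shift, map_shift_shift, -List.map_map])

/-- The end of the tangle `x` in the north-west, which passes over (or under) two strands on the
right of it, is swept across the tangle and then passes over (or under) the one strand on the
left. -/
theorem rotL_cross_cross {x : List (Slice Unit)} (hx : wd x 2 = some 2) (s : Bool) :
    Eqv 2 (curlSign s) (rotL (x ++ [cross 0 s]) ++ [cross 0 s])
      (rotL (cross 0 (!s) :: rotL x)) := by
  have hz : wd (sh 1 x ++ [cap 0]) 4 = some 2 := by
    rw [wd_append, wd_tangle_sh hx (by omega)]; rfl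
  calc
    Eqv 2 0 (rotL (x ++ [cross 0 s]) ++ [cross 0 s])
        (cup 2 () :: sh 1 x ++ [cross 1 s, cross 2 s, cap 0]) :=
      (eqv_commute [cap 0] [cross 0 s] (n := 2) (m := 0) rfl).within
        (cup 2 () :: sh 1 x ++ [cross 1 s]) [] (m' := 4)
        (by rw [wd_append, wd]
            simp only [width, Nat.le_refl, if_true, Option.bind_some, Nat.reduceAdd]
            rw [wd_tangle_sh hx (by omega)]; rfl)
        (by omega) (by simp [rotL, shift]) (by simp [shift])
    Eqv 2 0 _ (cup 2 () :: sh 1 x ++ [cup 1 (), cap 2, cross 1 s, cross 2 s, cap 0]) :=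
      (eqv_zigzag_left 1).symm₀.within (cup 2 () :: sh 1 x) [cross 1 s, cross 2 s, cap 0] (m' := 4)
        (by simp only [wd, width, Nat.le_refl, if_true, Option.bind_some, Nat.reduceAdd]
            rw [wd_tangle_sh hx (by omega)])
        (by omega) (by simp) (by simp)
    Eqv 2 0 _ ([cup 2 (), cup 1 ()] ++ sh 3 x ++ [cap 2, cross 1 s, cross 2 s, cap 0]) :=
      ((eqv_commute [cup 0 ()] x (n := 0) (m := 2) rfl).symm₀.sh 1).within [cup 2 ()]
        [cap 2, cross 1 s, cross 2 s, cap 0] (m' := 4) rfl (by omega)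
        (by simp [shift, map_shift_shift, -List.map_map])
        (by simp [shift, map_shift_shift, -List.map_map])
    Eqv 2 0 _ ([cup 2 (), cup 1 (), cross 1 s, cross 2 s, cross 3 s, cross 4 s] ++ sh 2 x ++
        [cap 1, cap 0]) :=
      ((eqv_sweep s _ hz).sh 1).within [cup 2 (), cup 1 ()] [cap 0] (m' := 6) rfl (by omega)
        (by simp [row, shift, map_shift_shift, -List.map_map])
        (by simp [row, shift, map_shift_shift, -List.map_map])
    Eqv 2 (curlSign s) _ ([cup 2 (), cup 1 (), cross 2 s, cross 3 s, cross 4 s] ++ sh 2 x ++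
        [cap 1, cap 0]) :=
      (eqv_curl_cup 1 s).within [cup 2 ()]
        ([cross 2 s, cross 3 s, cross 4 s] ++ sh 2 x ++ [cap 1, cap 0]) (m' := 4) rfl (by omega)
        (by simp) (by simp)
    Eqv 2 0 _ ([cup 1 (), cup 4 (), cross 2 s, cross 3 s, cross 4 s] ++ sh 2 x ++
        [cap 1, cap 0]) :=
      (eqv_commute [cup 1 ()] [cup 1 ()] (n := 1) (m := 3) rfl).symm₀.within []
        ([cross 2 s, cross 3 s, cross 4 s] ++ sh 2 x ++ [cap 1, cap 0]) rfl (by omega)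
        (by simp [shift]) (by simp [shift])
    Eqv 2 0 _ ([cup 1 (), cross 2 s, cup 4 (), cross 3 s, cross 4 s] ++ sh 2 x ++
        [cap 1, cap 0]) :=
      (eqv_commute [cross 2 s] [cup 0 ()] (n := 4) (m := 4) rfl).symm₀.within [cup 1 ()]
        ([cross 3 s, cross 4 s] ++ sh 2 x ++ [cap 1, cap 0]) (m' := 4) rfl (by omega)
        (by simp [shift]) (by simp [shift])
    Eqv 2 0 _ ([cup 1 (), cross 2 s, cup 3 (), cross 4 (!s), cross 4 s] ++ sh 2 x ++
        [cap 1, cap 0]) :=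
      (eqv_slide_cup 3 (!s)).symm₀.within [cup 1 (), cross 2 s]
        ([cross 4 s] ++ sh 2 x ++ [cap 1, cap 0]) (m' := 4) rfl (by omega) (by simp) (by simp)
    Eqv 2 0 _ ([cup 1 (), cross 2 s, cup 3 ()] ++ sh 2 x ++ [cap 1, cap 0]) :=
      (eqv_reidemeister2' 4 s).within [cup 1 (), cross 2 s, cup 3 ()]
        (sh 2 x ++ [cap 1, cap 0]) (m' := 6) rfl (by omega) (by simp) (by simp)
    Eqv 2 0 _ (rotL (cross 0 (!s) :: rotL x)) :=
      (eqv_slide_cup 1 s).within [] (cup 3 () :: sh 2 x ++ [cap 1, cap 0]) rfl (by omega)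
        (by simp) (by simp [rotL, shift, map_shift_shift, -List.map_map])

/-- The mirror image of `rotL_cross_cross` in a horizontal axis. -/
theorem rotR_cross_cross {x : List (Slice Unit)} (hx : wd x 2 = some 2) (s : Bool) :
    Eqv 2 (curlSign s) (cross 0 s :: rotR (cross 0 s :: x))
      (rotR (rotR x ++ [cross 0 (!s)])) := by
  have hz : wd (cup 0 () :: sh 1 x) 2 = some 4 := by
    simp only [wd, width, Nat.zero_le, if_true, Option.bind_some, Nat.reduceAdd]
    rw [wd_tangle_sh hx (by omega)]
  have hx' : wd ([cup 0 (), cup 1 ()] ++ sh 2 x) 2 = some 6 := by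
    rw [wd_append]
    exact wd_tangle_sh hx (by omega)
  calc
    Eqv 2 0 (cross 0 s :: rotR (cross 0 s :: x))
        ([cup 0 (), cross 2 s, cross 1 s] ++ sh 1 x ++ [cap 2]) :=
      (eqv_commute [cup 0 ()] [cross 0 s] (n := 0) (m := 2) rfl).symm₀.within []
        ([cross 1 s] ++ sh 1 x ++ [cap 2]) rfl (by omega) (by simp [rotR, shift]) (by simp [shift])
    Eqv 2 0 _ ([cup 0 (), cross 2 s, cross 1 s, cup 2 (), cap 1] ++ sh 1 x ++ [cap 2]) :=
      (eqv_zigzag_right 1).symm₀.within [cup 0 (), cross 2 s, cross 1 s] (sh 1 x ++ [cap 2])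
        (m' := 4) rfl (by omega) (by simp) (by simp)
    Eqv 2 0 _ ([cup 0 (), cross 2 s, cross 1 s, cup 2 ()] ++ sh 3 x ++ [cap 1, cap 2]) :=
      ((eqv_commute [cap 0] x (n := 2) (m := 0) rfl).sh 1).within
        [cup 0 (), cross 2 s, cross 1 s, cup 2 ()] [cap 2] (m' := 6) rfl (by omega)
        (by simp [shift, map_shift_shift, -List.map_map])
        (by simp [shift, map_shift_shift, -List.map_map])
    Eqv 2 0 _ ([cup 0 (), cup 1 ()] ++ sh 2 x ++
        [cross 4 s, cross 3 s, cross 2 s, cross 1 s, cap 1, cap 2]) :=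
      ((eqv_sweep_reverse s _ hz).sh 1).within [cup 0 ()] [cap 1, cap 2] (m' := 4) rfl (by omega)
        (by simp [row, shift, map_shift_shift, -List.map_map])
        (by simp [row, shift, map_shift_shift, -List.map_map])
    Eqv 2 (curlSign s) _ ([cup 0 (), cup 1 ()] ++ sh 2 x ++
        [cross 4 s, cross 3 s, cross 2 s, cap 1, cap 2]) :=
      (eqv_curl_cap 1 s).within ([cup 0 (), cup 1 ()] ++ sh 2 x ++
        [cross 4 s, cross 3 s, cross 2 s]) [cap 2] (m' := 6) (by rw [wd_append, hx']; rfl)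
        (by omega) (by simp) (by simp)
    Eqv 2 0 _ ([cup 0 (), cup 1 ()] ++ sh 2 x ++
        [cross 4 s, cross 3 s, cross 2 s, cap 4, cap 1]) :=
      (eqv_commute [cap 1] [cap 1] (n := 3) (m := 1) rfl).within ([cup 0 (), cup 1 ()] ++ sh 2 x ++
        [cross 4 s, cross 3 s, cross 2 s]) [] (m' := 6) (by rw [wd_append, hx']; rfl)
        (by omega) (by simp [shift]) (by simp [shift])
    Eqv 2 0 _ ([cup 0 (), cup 1 ()] ++ sh 2 x ++
        [cross 4 s, cross 3 s, cap 4, cross 2 s, cap 1]) :=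
      (eqv_commute [cross 2 s] [cap 0] (n := 4) (m := 4) rfl).within ([cup 0 (), cup 1 ()] ++
        sh 2 x ++ [cross 4 s, cross 3 s]) [cap 1] (m' := 6) (by rw [wd_append, hx']; rfl)
        (by omega) (by simp [shift]) (by simp [shift])
    Eqv 2 0 _ ([cup 0 (), cup 1 ()] ++ sh 2 x ++
        [cross 4 s, cross 4 (!s), cap 3, cross 2 s, cap 1]) :=
      (eqv_slide_cap 3 s).within ([cup 0 (), cup 1 ()] ++
        sh 2 x ++ [cross 4 s]) [cross 2 s, cap 1] (m' := 6) (by rw [wd_append, hx']; rfl)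
        (by omega) (by simp) (by simp)
    Eqv 2 0 _ ([cup 0 (), cup 1 ()] ++ sh 2 x ++ [cap 3, cross 2 s, cap 1]) :=
      (eqv_reidemeister2 4 s).within ([cup 0 (), cup 1 ()] ++ sh 2 x) [cap 3, cross 2 s, cap 1]
        (m' := 6) hx' (by omega) (by simp) (by simp)
    Eqv 2 0 _ (rotR (rotR x ++ [cross 0 (!s)])) :=
      (eqv_slide_cap 1 (!s)).symm₀.within ([cup 0 (), cup 1 ()] ++ sh 2 x ++ [cap 3]) []
        (m' := 4) (by rw [wd_append, hx']; rfl) (by omega) (by simp)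
        (by simp [rotR, shift, map_shift_shift, -List.map_map])

/-! ### Rational tangles are invariant under flypes and half turns -/

/-- The properties of rational tangles that are used: a crossing can be moved across the tangle,
and the tangle does not change under a half turn in the plane. -/
structure FlypeInvariant (x : List (Slice Unit)) : Prop where
  wd_eq : wd x 2 = some 2
  cross_comm (s : Bool) : Eqv 2 0 (cross 0 s :: x) (x ++ [cross 0 s])
  rotL_rotL : Eqv 2 0 (rotL (rotL x)) x

namespace FlypeInvariant

variable {x y : List (Slice Unit)}

theorem rotR_eqv (h : FlypeInvariant x) : Eqv 2 0 (rotR x) (rotL x) :=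
  h.rotL_rotL.symm₀.rotR.trans₀ (rotR_rotL (wd_rotL h.wd_eq))

theorem of_eqv (h : FlypeInvariant x) (hy : wd y 2 = some 2) (hxy : Eqv 2 0 x y) :
    FlypeInvariant y where
  wd_eq := hy
  cross_comm s :=
    (hxy.symm₀.within [cross 0 s] [] rfl le_rfl (by simp) (by simp)).trans₀
      ((h.cross_comm s).trans₀
        (hxy.within [] [cross 0 s] rfl le_rfl (by simp) (by simp)))
  rotL_rotL := hxy.symm₀.rotL.rotL.trans₀ (h.rotL_rotL.trans₀ hxy)

theorem nil : FlypeInvariant [] where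
  wd_eq := rfl
  cross_comm s := .refl _ _
  rotL_rotL := by
    calc
      Eqv 2 0 (rotL (rotL [])) [cup 2 (), cap 1, cup 1 (), cap 0] :=
        (eqv_commute [cap 1] [cup 0 ()] (n := 3) (m := 1) rfl).symm₀.within [cup 2 ()] [cap 0]
          (m' := 4) rfl (by omega) rfl rfl
      Eqv 2 0 _ [cup 1 (), cap 0] :=
        (eqv_zigzag_right 1).within [] [cup 1 (), cap 0] rfl (by omega) rfl rfl
      Eqv 2 0 _ [] := (eqv_zigzag_right 0).mono (by omega)

theorem append_cross (h : FlypeInvariant x) (s : Bool) : FlypeInvariant (x ++ [cross 0 s]) where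
  wd_eq := by simp [wd_append, h.wd_eq, wd, width]
  cross_comm t := by
    by_cases hst : t = s
    · subst hst
      exact (h.cross_comm t).within [] [cross 0 t] rfl le_rfl (by simp) (by simp)
    · obtain rfl : t = !s := by cases s <;> cases t <;> simp_all
      calc
        Eqv 2 0 (cross 0 (!s) :: (x ++ [cross 0 s])) (x ++ [cross 0 (!s), cross 0 s]) :=
          (h.cross_comm (!s)).within [] [cross 0 s] rfl le_rfl (by simp) (by simp)
        Eqv 2 0 _ x := (eqv_reidemeister2' 0 s).within x [] h.wd_eq le_rfl (by simp) (by simp)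
        Eqv 2 0 _ (x ++ [cross 0 s] ++ [cross 0 (!s)]) :=
          (eqv_reidemeister2 0 s).symm₀.within x [] h.wd_eq le_rfl (by simp) (by simp)
  rotL_rotL := by
    calc
      Eqv 2 0 (_root_.rotL (_root_.rotL (x ++ [cross 0 s])))
          (_root_.rotL (_root_.rotL (cross 0 s :: x))) := (h.cross_comm s).symm₀.rotL.rotL
      Eqv 2 0 _ (_root_.rotL (_root_.rotL x) ++ [cross 0 s]) := rotL_rotL_cross h.wd_eq s
      Eqv 2 0 _ (x ++ [cross 0 s]) := h.rotL_rotL.within [] [cross 0 s] rfl le_rfl rfl rfl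

theorem cons_cross (h : FlypeInvariant x) (s : Bool) : FlypeInvariant (cross 0 s :: x) :=
  (h.append_cross s).of_eqv (by simp [h.wd_eq, wd, width]) (h.cross_comm s).symm₀

/-- The flype of a turned tangle: `rotL_cross_cross` and its mirror image describe the tangle with
the crossing on either side, and they agree by the invariance of the tangle under half turns. -/
theorem rotL (h : FlypeInvariant x) : FlypeInvariant (rotL x) where
  wd_eq := wd_rotL h.wd_eq
  rotL_rotL := h.rotL_rotL.rotL
  cross_comm s := by
    have hy := h.append_cross (!s)
    set y := x ++ [cross 0 (!s)] with hy_def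
    have hxy : Eqv 2 0 (y ++ [cross 0 s]) x :=
      (eqv_reidemeister2' 0 s).within x [] h.wd_eq le_rfl (by simp [hy_def]) (by simp)
    have hxy' : Eqv 2 0 (cross 0 s :: y) x := (hy.cross_comm s).trans₀ hxy
    -- `z` is the turned tangle `y`
    have hyz : Eqv 2 0 (_root_.rotR y) (_root_.rotL y) := hy.rotR_eqv
    have hz : wd (_root_.rotL y) 2 = some 2 := wd_rotL hy.wd_eq
    have h₁ : Eqv 2 (curlSign s) (_root_.rotL x ++ [cross 0 s])
        (_root_.rotL (cross 0 (!s) :: _root_.rotL y)) :=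
      Trans.trans (hxy.symm₀.rotL.within [] [cross 0 s] rfl le_rfl rfl rfl)
        (rotL_cross_cross hy.wd_eq s)
    have h₂ : Eqv 2 (curlSign s) (cross 0 s :: _root_.rotL x)
        (rotR (_root_.rotL y ++ [cross 0 (!s)])) := by
      calc
        Eqv 2 0 (cross 0 s :: _root_.rotL x) (cross 0 s :: rotR x) :=
          h.rotR_eqv.symm₀.within [cross 0 s] [] rfl le_rfl (by simp) (by simp)
        Eqv 2 0 _ (cross 0 s :: rotR (cross 0 s :: y)) :=
          hxy'.symm₀.rotR.within [cross 0 s] [] rfl le_rfl (by simp) (by simp)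
        Eqv 2 (curlSign s) _ (rotR (rotR y ++ [cross 0 (!s)])) := rotR_cross_cross hy.wd_eq s
        Eqv 2 0 _ (rotR (_root_.rotL y ++ [cross 0 (!s)])) :=
          (hyz.within [] [cross 0 (!s)] rfl le_rfl rfl rfl).rotR
    have h₃ : Eqv 2 0 (_root_.rotL (cross 0 (!s) :: _root_.rotL y))
        (rotR (_root_.rotL y ++ [cross 0 (!s)])) := by
      have hc : wd (cross 0 (!s) :: _root_.rotL y) 2 = some 2 := by simp [wd, width, hz]
      calc
        Eqv 2 0 (_root_.rotL (cross 0 (!s) :: _root_.rotL y))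
            (rotR (_root_.rotL (_root_.rotL (cross 0 (!s) :: _root_.rotL y)))) :=
          (rotR_rotL (wd_rotL hc)).symm₀
        Eqv 2 0 _ (rotR (_root_.rotL (_root_.rotL (_root_.rotL y)) ++ [cross 0 (!s)])) :=
          (rotL_rotL_cross hz (!s)).rotR
        Eqv 2 0 _ (rotR (_root_.rotL y ++ [cross 0 (!s)])) :=
          (hy.rotL_rotL.rotL.within [] [cross 0 (!s)] rfl le_rfl rfl rfl).rotR
    simpa using (h₂.trans h₃.symm₀).trans h₁.symm

theorem rotR (h : FlypeInvariant x) : FlypeInvariant (rotR x) :=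
  h.rotL.of_eqv (wd_rotR h.wd_eq) h.rotR_eqv.symm₀

end FlypeInvariant

/-! ### Rational tangles -/

theorem wd_add_tangle {x y : List (Slice Unit)} (hx : wd x 2 = some 2) (hy : wd y 2 = some 2) :
    wd (Tangle.add x y) 2 = some 2 := by
  have h₁ : wd x 4 = some 4 := wd_tangle hx (by omega)
  have h₂ : wd (sh 2 y) 4 = some 4 := wd_tangle_sh hy (by omega)
  simp only [sh] at h₂
  simp [Tangle.add, wd, wd_append, width, h₁, h₂]

/-- A quarter turn to the right puts the second summand below the first one. -/
theorem rotR_add {x y : List (Slice Unit)} (hx : wd x 2 = some 2) (hy : wd y 2 = some 2) :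
    Eqv 2 0 (rotR (Tangle.add x y)) (rotR y ++ rotR x) := by
  refine Eqv.symm₀ ?_
  calc
    Eqv 2 0 (rotR y ++ rotR x)
        ([cup 0 (), cup 2 ()] ++ sh 3 y ++ [cap 4] ++ sh 1 x ++ [cap 2]) :=
      (eqv_commute [cup 0 ()] (cup 0 () :: sh 1 y ++ [cap 2]) (n := 0) (m := 2) rfl).symm₀.within
        [] (sh 1 x ++ [cap 2]) rfl (by omega)
        (by have := sh_zero (sh 1 y); simp only [sh] at this
            simp [rotR, this, shift, -List.map_map])
        (by simp [shift, map_shift_shift, -List.map_map])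
    Eqv 2 0 _ ([cup 0 (), cup 2 ()] ++ sh 1 x ++ sh 3 y ++ [cap 4, cap 2]) :=
      ((eqv_commute x (y ++ [cap 1]) hx).symm₀.sh 1).within [cup 0 (), cup 2 ()] [cap 2]
        (m' := 6) rfl (by omega) (by simp [shift, map_shift_shift, -List.map_map])
        (by simp [shift, map_shift_shift, -List.map_map])
    Eqv 2 0 _ (rotR (Tangle.add x y)) :=
      (eqv_commute [cap 2] [cap 0] (n := 4) (m := 2) rfl).symm₀.within
        ([cup 0 (), cup 2 ()] ++ sh 1 x ++ sh 3 y) [] (m' := 6)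
        (by rw [wd_append, wd_append, show wd [cup 0 (), cup 2 ()] 2 = some 6 from rfl,
              Option.bind_some, wd_tangle_sh hx (by omega), Option.bind_some,
              wd_tangle_sh hy (by omega)])
        (by omega) (by simp [shift])
        (by simp [Tangle.add, rotR, shift, map_shift_shift, -List.map_map])

theorem rotR_cross (s : Bool) : Eqv 2 0 (rotR [cross 0 s]) [cross 0 (!s)] := by
  calc
    Eqv 2 0 (rotR [cross 0 s]) [cup 0 (), cross 2 (!s), cap 1] :=
      (eqv_slide_cap 1 s).within [cup 0 ()] [] (m' := 4) rfl (by omega) rfl rfl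
    Eqv 2 0 _ [cross 0 (!s), cup 0 (), cap 1] :=
      (eqv_commute [cup 0 ()] [cross 0 (!s)] (n := 0) (m := 2) rfl).within [] [cap 1] rfl
        (by omega) rfl rfl
    Eqv 2 0 _ [cross 0 (!s)] :=
      (eqv_zigzag_left 0).within [cross 0 (!s)] [] (m' := 2) rfl (by omega) rfl rfl

theorem rotR_nil : Eqv 2 0 (rotR []) [cap 0, cup 0 ()] :=
  (eqv_commute [cup 0 ()] [cap 0] (n := 0) (m := 2) rfl).mono (by omega)

theorem FlypeInvariant.zero : FlypeInvariant Tangle.zero :=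
  FlypeInvariant.nil.rotR.of_eqv rfl rotR_nil

theorem rotR_zero : Eqv 2 0 (rotR Tangle.zero) [] :=
  (rotR_nil.symm₀.trans₀ FlypeInvariant.nil.rotR_eqv).rotR.trans₀ (rotR_rotL rfl)

theorem rotR_add_one {x : List (Slice Unit)} (hx : wd x 2 = some 2) (s : Bool) :
    Eqv 2 0 (rotR (Tangle.add x (Tangle.one s))) (cross 0 (!s) :: rotR x) :=
  (rotR_add hx rfl).trans₀ ((rotR_cross s).within [] (rotR x) rfl le_rfl rfl rfl)

theorem FlypeInvariant.add_one {x : List (Slice Unit)} (h : FlypeInvariant x) (s : Bool) :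
    FlypeInvariant (Tangle.add x (Tangle.one s)) := by
  have hw : wd (Tangle.add x (Tangle.one s)) 2 = some 2 := wd_add_tangle h.wd_eq rfl
  exact (h.rotR.cons_cross (!s)).rotL.of_eqv hw
    ((rotR_add_one h.wd_eq s).symm₀.rotL.trans₀ (rotL_rotR hw))

theorem ratAux_zero_right (s : Bool) (p : ℕ) : Tangle.ratAux s p 0 = [] := by
  rw [Tangle.ratAux]; rfl

theorem ratAux_zero_left (s : Bool) {q : ℕ} (hq : 0 < q) :
    Tangle.ratAux s 0 q = Tangle.zero := by
  rw [Tangle.ratAux]; simp [hq.ne']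

theorem ratAux_self (s : Bool) {q : ℕ} (hq : 0 < q) : Tangle.ratAux s q q = [cross 0 s] := by
  rw [Tangle.ratAux]; simp [hq.ne', Tangle.one]

theorem ratAux_of_gt (s : Bool) {p q : ℕ} (hq : 0 < q) (h : q < p) :
    Tangle.ratAux s p q = Tangle.add (Tangle.ratAux s (p - q) q) (Tangle.one s) := by
  rw [Tangle.ratAux]; simp [hq.ne', h, h.ne', (hq.trans h).ne']

theorem ratAux_of_lt (s : Bool) {p q : ℕ} (hp : 0 < p) (h : p < q) :
    Tangle.ratAux s p q = cross 0 s :: Tangle.ratAux s p (q - p) := by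
  rw [Tangle.ratAux]; simp [hp.ne', h.ne, (hp.trans h).ne', h.not_gt, Tangle.mul, Tangle.one]

theorem ratAux_induction {P : ℕ → ℕ → Prop} (right : ∀ p, P p 0) (left : ∀ q, 0 < q → P 0 q)
    (self : ∀ q, 0 < q → P q q) (gt : ∀ p q, 0 < q → q < p → P (p - q) q → P p q)
    (lt : ∀ p q, 0 < p → p < q → P p (q - p) → P p q) (p q : ℕ) : P p q := by
  induction hn : p + q using Nat.strong_induction_on generalizing p q with
  | _ n ih =>
    rcases Nat.eq_zero_or_pos q with rfl | hq
    · exact right p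
    rcases Nat.eq_zero_or_pos p with rfl | hp
    · exact left q hq
    rcases lt_trichotomy p q with h | rfl | h
    · exact lt p q hp h (ih _ (by omega) p (q - p) rfl)
    · exact self p hp
    · exact gt p q hq h (ih _ (by omega) (p - q) q rfl)

theorem FlypeInvariant.ratAux (s : Bool) (p q : ℕ) : FlypeInvariant (Tangle.ratAux s p q) := by
  induction p, q using ratAux_induction with
  | right p => rw [ratAux_zero_right]; exact .nil
  | left q hq => rw [ratAux_zero_left s hq]; exact .zero
  | self q hq => rw [ratAux_self s hq]; exact FlypeInvariant.nil.append_cross s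
  | gt p q hq h ih => rw [ratAux_of_gt s hq h]; exact ih.add_one s
  | lt p q hp h ih => rw [ratAux_of_lt s hp h]; exact ih.cons_cross s

/-- A quarter turn maps the rational tangle `-q / p` to `p / q`. -/
theorem rotR_ratAux (s : Bool) {p q : ℕ} (hp : 0 < p) (hq : 0 < q) :
    Eqv 2 0 (rotR (Tangle.ratAux (!s) q p)) (Tangle.ratAux s p q) := by
  induction p, q using ratAux_induction with
  | right p => omega
  | left q _ => omega
  | self q _ => simpa [ratAux_self, hq] using rotR_cross (!s)
  | gt p q _ h ih =>
    have ih := ih (by omega) hq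
    have hT := FlypeInvariant.ratAux (!s) q (p - q)
    have hU := FlypeInvariant.ratAux s (p - q) q
    have hUs := hU.add_one s
    rw [ratAux_of_gt s hq h, ratAux_of_lt (!s) hq h]
    calc
      Eqv 2 0 (rotR (cross 0 (!s) :: Tangle.ratAux (!s) q (p - q)))
          (rotL (cross 0 (!s) :: Tangle.ratAux (!s) q (p - q))) := (hT.cons_cross (!s)).rotR_eqv
      Eqv 2 0 _ (rotL (cross 0 (!s) :: rotR (rotR (Tangle.ratAux (!s) q (p - q))))) :=
        (((hT.rotR_eqv.rotR.trans₀ (rotR_rotL hT.wd_eq)).symm₀).within [cross 0 (!s)] [] rfl le_rfl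
          (by simp) (by simp)).rotL
      Eqv 2 0 _ (rotL (cross 0 (!s) :: rotR (Tangle.ratAux s (p - q) q))) :=
        (ih.rotR.within [cross 0 (!s)] [] rfl le_rfl (by simp) (by simp)).rotL
      Eqv 2 0 _ (rotL (rotR (Tangle.add (Tangle.ratAux s (p - q) q) (Tangle.one s)))) :=
        (rotR_add_one hU.wd_eq s).symm₀.rotL
      Eqv 2 0 _ (Tangle.add (Tangle.ratAux s (p - q) q) (Tangle.one s)) := rotL_rotR hUs.wd_eq
  | lt p q _ h ih =>
    have ih := ih hp (by omega)
    rw [ratAux_of_lt s hp h, ratAux_of_gt (!s) hp h]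
    calc
      Eqv 2 0 (rotR (Tangle.add (Tangle.ratAux (!s) (q - p) p) (Tangle.one (!s))))
          (cross 0 s :: rotR (Tangle.ratAux (!s) (q - p) p)) := by
        simpa using rotR_add_one (FlypeInvariant.ratAux (!s) (q - p) p).wd_eq (!s)
      Eqv 2 0 _ (cross 0 s :: Tangle.ratAux s p (q - p)) :=
        ih.within [cross 0 s] [] rfl le_rfl (by simp) (by simp)

/-! ### Counting crossings -/

/-- Is the slice a crossing? -/
def Slice.isCross {O : Type} : Slice O → Bool
  | cross _ _ => true
  | _ => false

/-- The number of crossings. -/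
def nc {O : Type} (x : List (Slice O)) : ℕ := x.countP isCross

section
variable {O : Type} (x y : List (Slice O)) (i k : ℕ) (s : Bool) (o : O)

@[simp] theorem nc_nil : nc ([] : List (Slice O)) = 0 := rfl

@[simp] theorem nc_append : nc (x ++ y) = nc x + nc y := List.countP_append

@[simp] theorem nc_cross : nc (cross i s :: x) = nc x + 1 :=
  List.countP_cons_of_pos rfl

@[simp] theorem nc_cup : nc (cup i o :: x) = nc x :=
  List.countP_cons_of_neg (by simp [isCross])

@[simp] theorem nc_cap : nc (cap i :: x) = nc x :=
  List.countP_cons_of_neg (by simp [isCross])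

@[simp] theorem nc_shift : nc (x.map (Slice.shift k)) = nc x := by
  rw [nc, List.countP_map]
  congr 1
  funext σ
  cases σ <;> rfl

end

@[simp] theorem nc_rotL (x : List (Slice Unit)) : nc (rotL x) = nc x := by simp [rotL]

@[simp] theorem nc_rotR (x : List (Slice Unit)) : nc (rotR x) = nc x := by simp [rotR]

@[simp] theorem nc_add (x y : List (Slice Unit)) : nc (Tangle.add x y) = nc x + nc y := by
  simp [Tangle.add]

theorem nc_ratAux_swap (s t : Bool) (p q : ℕ) (hp : 0 < p) (hq : 0 < q) :
    nc (Tangle.ratAux s p q) = nc (Tangle.ratAux t q p) := by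
  induction p, q using ratAux_induction with
  | right p => omega
  | left q _ => omega
  | self q _ => simp [ratAux_self, hq]
  | gt p q _ h ih =>
    rw [ratAux_of_gt s hq h, ratAux_of_lt t hq h]
    simp [ih (by omega) hq, Tangle.one]
  | lt p q _ h ih =>
    rw [ratAux_of_lt s hp h, ratAux_of_gt t hp h]
    simp [ih hp (by omega), Tangle.one]

/-! ### Turned rational tangles -/

/-- A diagram of the rational tangle `p / q` or `-p / q`, turned by a quarter turn, in which the
horizontal twists that are added last have become vertical twists at the top. -/
def turned (s : Bool) (p q : ℕ) : List (Slice Unit) :=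
  if q = 0 then [cap 0, cup 0 ()]
  else if p = 0 then []
  else if p = q then [cross 0 (!s)]
  else if q < p then turned s (p - q) q ++ [cross 0 (!s)]
  else rotL (cross 0 s :: Tangle.ratAux s p (q - p))
termination_by p
decreasing_by omega

theorem turned_zero_right (s : Bool) (p : ℕ) : turned s p 0 = [cap 0, cup 0 ()] := by
  rw [turned]; rfl

theorem turned_zero_left (s : Bool) {q : ℕ} (hq : 0 < q) : turned s 0 q = [] := by
  rw [turned]; simp [hq.ne']

theorem turned_self (s : Bool) {q : ℕ} (hq : 0 < q) : turned s q q = [cross 0 (!s)] := by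
  rw [turned]; simp [hq.ne']

theorem turned_of_gt (s : Bool) {p q : ℕ} (hq : 0 < q) (h : q < p) :
    turned s p q = turned s (p - q) q ++ [cross 0 (!s)] := by
  rw [turned]; simp [hq.ne', h, h.ne', (hq.trans h).ne']

theorem turned_of_lt (s : Bool) {p q : ℕ} (hp : 0 < p) (h : p < q) :
    turned s p q = rotL (cross 0 s :: Tangle.ratAux s p (q - p)) := by
  rw [turned]; simp [hp.ne', h.ne, (hp.trans h).ne', h.not_gt]

theorem rotR_ratAux_turned (s : Bool) (p q : ℕ) :
    Eqv 2 0 (rotR (Tangle.ratAux s p q)) (turned s p q) := by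
  induction p, q using ratAux_induction with
  | right p => rw [ratAux_zero_right, turned_zero_right]; exact rotR_nil
  | left q hq => rw [ratAux_zero_left s hq, turned_zero_left s hq]; exact rotR_zero
  | self q hq => rw [ratAux_self s hq, turned_self s hq]; exact rotR_cross s
  | gt p q hq h ih =>
    rw [ratAux_of_gt s hq h, turned_of_gt s hq h]
    have hT := FlypeInvariant.ratAux s (p - q) q
    exact (rotR_add_one hT.wd_eq s).trans₀ ((hT.rotR.cross_comm (!s)).trans₀
      (ih.within [] [cross 0 (!s)] rfl le_rfl (by simp) (by simp)))
  | lt p q hp h ih =>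
    rw [ratAux_of_lt s hp h, turned_of_lt s hp h]
    exact ((FlypeInvariant.ratAux s p (q - p)).cons_cross s).rotR_eqv

theorem nc_turned (s : Bool) (p q : ℕ) : nc (turned s p q) = nc (Tangle.ratAux s p q) := by
  induction p, q using ratAux_induction with
  | right p => simp [ratAux_zero_right, turned_zero_right]
  | left q hq => simp [ratAux_zero_left s hq, turned_zero_left s hq, Tangle.zero]
  | self q hq => simp [ratAux_self s hq, turned_self s hq]
  | gt p q hq h ih => simp [ratAux_of_gt s hq h, turned_of_gt s hq h, ih, Tangle.one]
  | lt p q hp h ih => simp [ratAux_of_lt s hp h, turned_of_lt s hp h]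

theorem wd_turned (s : Bool) (p q : ℕ) : wd (turned s p q) 2 = some 2 := by
  induction p, q using ratAux_induction with
  | right p => simp [turned_zero_right, wd, width]
  | left q hq => simp [turned_zero_left s hq, wd]
  | self q hq => simp [turned_self s hq, wd, width]
  | gt p q hq h ih => simp [turned_of_gt s hq h, wd_append, ih, wd, width]
  | lt p q hp h ih =>
    rw [turned_of_lt s hp h]
    exact wd_rotL ((FlypeInvariant.ratAux s p (q - p)).cons_cross s).wd_eq

/-- The turned tangle `p / q` between `0` and `1`. -/
def posWord (b : ℕ × ℕ) : List (Slice Unit) :=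
  rotL (cross 0 true :: Tangle.ratAux true b.1 (b.2 - b.1))

/-- The turned tangle `p / q - 1` between `-1` and `0`. -/
def negWord (b : ℕ × ℕ) : List (Slice Unit) :=
  rotL (cross 0 false :: Tangle.ratAux false (b.2 - b.1) b.1)

theorem FlypeInvariant.posWord (b : ℕ × ℕ) : FlypeInvariant (posWord b) :=
  ((FlypeInvariant.ratAux true b.1 (b.2 - b.1)).cons_cross true).rotL

theorem FlypeInvariant.negWord (b : ℕ × ℕ) : FlypeInvariant (negWord b) :=
  ((FlypeInvariant.ratAux false (b.2 - b.1) b.1).cons_cross false).rotL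

theorem nc_negWord {b : ℕ × ℕ} (h : 0 < b.1 ∧ b.1 < b.2) : nc (negWord b) = nc (posWord b) := by
  simp [negWord, posWord, nc_ratAux_swap true false b.1 (b.2 - b.1) h.1 (by omega)]

/-- `p / q = (p / q - 1) + 1`; the isotopy removes a curl. -/
theorem posWord_eqv {b : ℕ × ℕ} (h : 0 < b.1 ∧ b.1 < b.2) :
    Eqv 2 1 (posWord b) (negWord b ++ [cross 0 false]) := by
  obtain ⟨p, q⟩ := b
  obtain ⟨hp, hpq⟩ := h
  simp only at hp hpq
  have hT := FlypeInvariant.ratAux false (q - p) p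
  have hU := FlypeInvariant.ratAux true p (q - p)
  have hTU : Eqv 2 0 (rotR (Tangle.ratAux false (q - p) p)) (Tangle.ratAux true p (q - p)) :=
    rotR_ratAux true hp (by omega)
  -- adding `-1` to a turned tangle amounts to adding a crossing before the tangle is turned
  have key : Eqv 2 1 (posWord (p, q) ++ [cross 0 true]) (negWord (p, q)) := by
    calc
      Eqv 2 0 (posWord (p, q) ++ [cross 0 true])
          (rotL (rotR (Tangle.ratAux false (q - p) p) ++ [cross 0 true]) ++ [cross 0 true]) :=
        ((hU.cross_comm true).trans₀ (hTU.symm₀.within [] [cross 0 true] rfl le_rfl rfl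
          rfl)).rotL.within [] [cross 0 true] rfl le_rfl rfl rfl
      Eqv 2 1 _ (rotL (cross 0 false :: rotL (rotR (Tangle.ratAux false (q - p) p)))) :=
        rotL_cross_cross hT.rotR.wd_eq true
      Eqv 2 0 _ (negWord (p, q)) :=
        ((rotL_rotR hT.wd_eq).within [cross 0 false] [] rfl le_rfl (by simp) (by simp)).rotL
  calc
    Eqv 2 0 (posWord (p, q)) (posWord (p, q) ++ [cross 0 true, cross 0 false]) :=
      (eqv_reidemeister2 0 true).symm₀.within (posWord (p, q)) []
        (FlypeInvariant.posWord (p, q)).wd_eq le_rfl (by simp) (by simp)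
    Eqv 2 1 _ (negWord (p, q) ++ [cross 0 false]) :=
      key.within [] [cross 0 false] rfl le_rfl (by simp) (by simp)

/-! ### Collecting the integral parts of the tangles -/

/-- `a` vertical half twists, which are the turned integral tangle `a`. -/
def twists (a : ℤ) : List (Slice Unit) :=
  if 0 ≤ a then List.replicate a.toNat (cross 0 false)
  else List.replicate (-a).toNat (cross 0 true)

theorem twists_natCast (n : ℕ) : twists n = List.replicate n (cross 0 false) := by
  simp [twists]

theorem twists_neg_natCast (n : ℕ) : twists (-n) = List.replicate n (cross 0 true) := by
  rcases n with _ | n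
  · simp [twists]
  · have : ¬ (0 : ℤ) ≤ -((n + 1 : ℕ) : ℤ) := by omega
    rw [twists, if_neg this]
    simp

theorem wd_replicate_cross (n : ℕ) (s : Bool) :
    wd (List.replicate n (cross 0 s)) 2 = some 2 := by
  induction n with
  | zero => rfl
  | succ n ih => simpa [List.replicate_succ, wd, width] using ih

@[simp] theorem nc_replicate_cross (n : ℕ) (s : Bool) :
    nc (List.replicate n (cross 0 s : Slice Unit)) = n := by
  induction n with
  | zero => rfl
  | succ n ih => simp [List.replicate_succ, ih]

theorem FlypeInvariant.replicate_comm {x : List (Slice Unit)} (h : FlypeInvariant x) (n : ℕ)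
    (s : Bool) :
    Eqv 2 0 (List.replicate n (cross 0 s) ++ x) (x ++ List.replicate n (cross 0 s)) := by
  induction n with
  | zero => simpa using Eqv.refl 2 x
  | succ n ih =>
    calc
      Eqv 2 0 (List.replicate (n + 1) (cross 0 s) ++ x)
          (cross 0 s :: x ++ List.replicate n (cross 0 s)) :=
        ih.within [cross 0 s] [] rfl le_rfl (by simp [List.replicate_succ]) (by simp)
      Eqv 2 0 _ (x ++ List.replicate (n + 1) (cross 0 s)) :=
        (h.cross_comm s).within [] (List.replicate n (cross 0 s)) rfl le_rfl (by simp)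
          (by simp [List.replicate_succ])

theorem FlypeInvariant.twists_comm {x : List (Slice Unit)} (h : FlypeInvariant x) (a : ℤ) :
    Eqv 2 0 (twists a ++ x) (x ++ twists a) := by
  unfold twists
  split <;> exact h.replicate_comm _ _

theorem twists_succ (a : ℤ) : Eqv 2 0 (twists a ++ [cross 0 false]) (twists (a + 1)) := by
  rcases le_or_gt 0 a with h | h
  · obtain ⟨n, rfl⟩ := Int.eq_ofNat_of_zero_le h
    rw [← Nat.cast_succ, twists_natCast, twists_natCast, List.replicate_succ']
    exact .refl _ _
  · obtain ⟨n, rfl⟩ : ∃ n : ℕ, a = -((n + 1 : ℕ) : ℤ) := ⟨(-a - 1).toNat, by omega⟩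
    rw [show -((n + 1 : ℕ) : ℤ) + 1 = -(n : ℤ) by push_cast; ring, twists_neg_natCast,
      twists_neg_natCast, List.replicate_succ']
    exact (eqv_reidemeister2 0 true).within (List.replicate n (cross 0 true)) []
      (wd_replicate_cross _ _) le_rfl (by simp) (by simp)

theorem twists_pred (a : ℤ) : Eqv 2 0 (twists a ++ [cross 0 true]) (twists (a - 1)) := by
  rcases le_or_gt a 0 with h | h
  · obtain ⟨n, rfl⟩ : ∃ n : ℕ, a = -(n : ℤ) := ⟨(-a).toNat, by omega⟩
    rw [show -(n : ℤ) - 1 = -((n + 1 : ℕ) : ℤ) by push_cast; ring, twists_neg_natCast,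
      twists_neg_natCast, List.replicate_succ']
    exact .refl _ _
  · obtain ⟨n, rfl⟩ : ∃ n : ℕ, a = ((n + 1 : ℕ) : ℤ) := ⟨(a - 1).toNat, by omega⟩
    rw [show ((n + 1 : ℕ) : ℤ) - 1 = (n : ℤ) by push_cast; ring, twists_natCast,
      twists_natCast, List.replicate_succ']
    exact (eqv_reidemeister2 0 false).within (List.replicate n (cross 0 false)) []
      (wd_replicate_cross _ _) le_rfl (by simp) (by simp)

theorem twists_add (a b : ℤ) : Eqv 2 0 (twists a ++ twists b) (twists (a + b)) := by
  rcases le_or_gt 0 b with h | h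
  · obtain ⟨n, rfl⟩ := Int.eq_ofNat_of_zero_le h
    clear h
    rw [twists_natCast]
    induction n with
    | zero => simpa using Eqv.refl 2 (twists a)
    | succ n ih =>
      have := ih.within (n := 2) [] [cross 0 false] rfl le_rfl rfl rfl
      rw [Nat.cast_succ, ← add_assoc]
      simpa [List.replicate_succ'] using this.trans₀ (twists_succ (a + n))
  · obtain ⟨n, rfl⟩ : ∃ n : ℕ, b = -(n : ℤ) := ⟨(-b).toNat, by omega⟩
    clear h
    rw [twists_neg_natCast]
    induction n with
    | zero => simpa using Eqv.refl 2 (twists a)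
    | succ n ih =>
      have := ih.within (n := 2) [] [cross 0 true] rfl le_rfl rfl rfl
      rw [Nat.cast_succ, neg_add, ← add_assoc, ← sub_eq_add_neg _ (1 : ℤ)]
      simpa [List.replicate_succ'] using this.trans₀ (twists_pred (a + -n))

/-- A proper fraction `p / q`, or `∞` for `none`. -/
def blockWord : Option (ℕ × ℕ) → List (Slice Unit)
  | none => [cap 0, cup 0 ()]
  | some b => posWord b

theorem FlypeInvariant.blockWord (b : Option (ℕ × ℕ)) : FlypeInvariant (blockWord b) := by
  cases b with
  | none => exact .zero
  | some b => exact .posWord b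

theorem FlypeInvariant.wd_flatMap {ι : Type} (f : ι → List (Slice Unit))
    (hf : ∀ i, FlypeInvariant (f i)) (l : List ι) : wd (l.flatMap f) 2 = some 2 := by
  induction l with
  | nil => rfl
  | cons i l ih => simp [wd_append, (hf i).wd_eq, ih]

theorem FlypeInvariant.twists_comm_flatMap {ι : Type} (f : ι → List (Slice Unit))
    (hf : ∀ i, FlypeInvariant (f i)) (l : List ι) (a : ℤ) :
    Eqv 2 0 (twists a ++ l.flatMap f) (l.flatMap f ++ twists a) := by
  induction l with
  | nil => simpa using Eqv.refl 2 (twists a)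
  | cons i l ih =>
    exact (((hf i).twists_comm a).within [] (l.flatMap f) rfl le_rfl (by simp) rfl).trans₀
      (ih.within (f i) [] (hf i).wd_eq le_rfl (by simp) (by simp))

/-- The word `x` is a product of turned proper fractions and of `a` half twists, up to an isotopy
that changes the writhe by `k`.  The relation between the numbers of crossings says that all the
crossings of the product have the sign `+` if this holds for `x` and `a` is not negative.  Negative
half twists come from negative fractions `-p / q = (1 - p / q) - 1`, so that there are at least as
many fractions as negative half twists. -/
structure IsProduct (x : List (Slice Unit)) (bs : List (Option (ℕ × ℕ))) (a k : ℤ) : Prop where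
  proper : ∀ b, some b ∈ bs → 0 < b.1 ∧ b.1 < b.2
  eqv : Eqv 2 k x (bs.flatMap blockWord ++ twists a)
  nc_eq : (nc x : ℤ) = nc (bs.flatMap blockWord) + a - k
  neg_le : -a ≤ bs.length

namespace IsProduct

theorem nil : IsProduct [] [] 0 0 :=
  ⟨by simp, by simpa [twists] using Eqv.refl 2 [], by simp, by simp⟩

theorem append {x y : List (Slice Unit)} {bs cs : List (Option (ℕ × ℕ))} {a b k l : ℤ}
    (hx : IsProduct x bs a k) (hy : IsProduct y cs b l) (hw : wd x 2 = some 2) :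
    IsProduct (x ++ y) (bs ++ cs) (a + b) (k + l) where
  proper c hc := (List.mem_append.1 hc).elim (hx.proper c) (hy.proper c)
  nc_eq := by
    have h₁ := hx.nc_eq
    have h₂ := hy.nc_eq
    simp only [nc_append, List.flatMap_append, Nat.cast_add]
    linarith
  neg_le := by
    have h₁ := hx.neg_le
    have h₂ := hy.neg_le
    simp only [List.length_append, Nat.cast_add]
    linarith
  eqv := by
    have hbs := FlypeInvariant.wd_flatMap blockWord .blockWord bs
    have hcs := FlypeInvariant.wd_flatMap blockWord .blockWord cs
    have h₁ : Eqv 2 (k + l) (x ++ y)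
        (bs.flatMap blockWord ++ twists a ++ (cs.flatMap blockWord ++ twists b)) := by
      rw [add_comm k l]
      exact (hy.eqv.within x [] hw le_rfl (by simp) rfl).trans
        (hx.eqv.within [] (cs.flatMap blockWord ++ twists b) rfl le_rfl (by simp) (by simp))
    calc
      Eqv 2 (k + l) (x ++ y)
        (bs.flatMap blockWord ++ twists a ++ (cs.flatMap blockWord ++ twists b)) := h₁
      Eqv 2 0 _ (bs.flatMap blockWord ++ cs.flatMap blockWord ++ twists a ++ twists b) :=
        (FlypeInvariant.twists_comm_flatMap blockWord .blockWord cs a).within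
          (bs.flatMap blockWord) (twists b) hbs le_rfl (by simp) (by simp)
      Eqv 2 0 _ ((bs ++ cs).flatMap blockWord ++ twists (a + b)) :=
        (twists_add a b).within (bs.flatMap blockWord ++ cs.flatMap blockWord) []
          (by simp [wd_append, hbs, hcs]) le_rfl (by simp) (by simp)

theorem cross : IsProduct [cross 0 false] [] 1 0 :=
  ⟨by simp, by simpa [twists] using Eqv.refl 2 _, by simp, by simp⟩

/-- A positive rational tangle is a proper fraction with a nonnegative number of half twists. -/
theorem turned_true (p q : ℕ) : ∃ bs a, IsProduct (turned true p q) bs a 0 := by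
  induction p, q using ratAux_induction with
  | right p =>
    rw [turned_zero_right]
    exact ⟨[none], 0, by simp, by simpa [twists, blockWord] using Eqv.refl 2 _,
      by simp [blockWord], by simp⟩
  | left q hq => rw [turned_zero_left _ hq]; exact ⟨_, _, nil⟩
  | self q hq => rw [turned_self _ hq]; exact ⟨_, _, cross⟩
  | gt p q hq h ih =>
    obtain ⟨bs, a, ih⟩ := ih
    rw [turned_of_gt _ hq h]
    exact ⟨_, _, by simpa using ih.append cross (wd_turned _ _ _)⟩
  | lt p q hp h ih =>
    rw [turned_of_lt _ hp h]
    exact ⟨[some (p, q)], 0, by simp [hp, h],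
      by simpa [twists, blockWord, posWord] using Eqv.refl 2 _,
      by simp [blockWord, posWord], by simp⟩

theorem turned_false {p q : ℕ} (hp : 0 < p) (h : p < q) :
    IsProduct (turned false p q) [some (q - p, q)] (-1) (-1) := by
  have hb : 0 < (q - p, q).1 ∧ (q - p, q).1 < (q - p, q).2 := by simp; omega
  have hn : turned false p q = negWord (q - p, q) := by
    rw [turned_of_lt _ hp h, negWord]
    simp only
    rw [show q - (q - p) = p by omega]
  refine ⟨fun b hb' => ?_, ?_, ?_, by simp⟩
  · obtain rfl : b = (q - p, q) := by simpa using hb'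
    exact hb
  · rw [hn]
    calc
      Eqv 2 0 (negWord (q - p, q))
          (negWord (q - p, q) ++ [Slice.cross 0 false, Slice.cross 0 true]) :=
        (eqv_reidemeister2 0 false).symm₀.within (negWord (q - p, q)) []
          (FlypeInvariant.negWord _).wd_eq le_rfl (by simp) (by simp)
      Eqv 2 (-1) _ ([some (q - p, q)].flatMap blockWord ++ twists (-1)) :=
        (posWord_eqv hb).symm.within [] [Slice.cross 0 true] rfl le_rfl (by simp)
          (by simp [blockWord, twists])
  · rw [hn, nc_negWord hb]
    simp [blockWord]

end IsProduct

/-! ### Checkerboard words -/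

/-- All crossings are of the same kind with respect to the checkerboard colouring of the plane: the
kind of a crossing of the strands `i` and `i + 1` is `c` if `i` is even, and `!c` if `i` is odd. -/
def Chk {O : Type} (c : Bool) (x : List (Slice O)) : Prop :=
  ∀ i s, cross i s ∈ x → s = xor c i.bodd

section
variable {O : Type} {c : Bool} {x y : List (Slice O)} {i k : ℕ} {s : Bool} {o : O}

@[simp] theorem chk_nil : Chk c ([] : List (Slice O)) := fun _ _ h => by simp at h

@[simp] theorem chk_cons_cup : Chk c (cup i o :: x) ↔ Chk c x := by simp [Chk]

@[simp] theorem chk_cons_cap : Chk c (cap i :: x) ↔ Chk c x := by simp [Chk]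

@[simp] theorem chk_cons_cross : Chk c (cross i s :: x) ↔ s = xor c i.bodd ∧ Chk c x := by
  simp only [Chk, List.mem_cons, cross.injEq]
  constructor
  · exact fun h => ⟨h i s (.inl ⟨rfl, rfl⟩), fun j t hj => h j t (.inr hj)⟩
  · rintro ⟨h₁, h₂⟩ j t (⟨rfl, rfl⟩ | h)
    · exact h₁
    · exact h₂ j t h

@[simp] theorem chk_append : Chk c (x ++ y) ↔ Chk c x ∧ Chk c y := by
  simp only [Chk, List.mem_append]
  exact ⟨fun h => ⟨fun i s hi => h i s (.inl hi), fun i s hi => h i s (.inr hi)⟩,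
    fun h i s hi => hi.elim (h.1 i s) (h.2 i s)⟩

@[simp] theorem chk_shift : Chk c (x.map (Slice.shift k)) ↔ Chk (xor c k.bodd) x := by
  induction x with
  | nil => simp
  | cons σ x ih => cases σ <;> simp [Slice.shift, ih]

end

theorem chk_rotL {c : Bool} {x : List (Slice Unit)} : Chk c (rotL x) ↔ Chk (!c) x := by
  simp [rotL]

theorem chk_rotR {c : Bool} {x : List (Slice Unit)} : Chk c (rotR x) ↔ Chk (!c) x := by
  simp [rotR]

theorem chk_ratAux (s : Bool) (p q : ℕ) : Chk s (Tangle.ratAux s p q) := by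
  induction p, q using ratAux_induction with
  | right p => simp [ratAux_zero_right]
  | left q hq => simp [ratAux_zero_left s hq, Tangle.zero]
  | self q hq => simp [ratAux_self s hq]
  | gt p q hq h ih => simp [ratAux_of_gt s hq h, Tangle.add, Tangle.one, ih, Slice.shift]
  | lt p q hp h ih => simp [ratAux_of_lt s hp h, ih]

theorem chk_flatMap {ι : Type} {c : Bool} (f : ι → List (Slice Unit)) (hf : ∀ i, Chk c (f i))
    (l : List ι) : Chk c (l.flatMap f) := by
  induction l with
  | nil => simp
  | cons i l ih => simp [hf i, ih]

theorem chk_posWord (b : ℕ × ℕ) : Chk false (posWord b) := by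
  simp [posWord, chk_rotL, chk_ratAux]

theorem chk_negWord (b : ℕ × ℕ) : Chk true (negWord b) := by
  simp [negWord, chk_rotL, chk_ratAux]

theorem chk_blockWord (b : Option (ℕ × ℕ)) : Chk false (blockWord b) := by
  cases b with
  | none => simp [blockWord]
  | some b => exact chk_posWord b

theorem chk_replicate (n : ℕ) : Chk false (List.replicate n (cross 0 false : Slice Unit)) := by
  intro i s h
  obtain ⟨rfl, rfl⟩ := cross.inj (List.eq_of_mem_replicate h)
  rfl

/-- The half twists on a tangle `∞` are curls. -/
theorem eqv_infty_twists (a : ℤ) :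
    Eqv 2 (-a) ([cap 0, cup 0 ()] ++ twists a) [cap 0, cup 0 ()] := by
  have key : ∀ (n : ℕ) (s : Bool), Eqv 2 (n * curlSign s)
      ([cap 0, cup 0 ()] ++ List.replicate n (cross 0 s)) [cap 0, cup 0 ()] := by
    intro n s
    induction n with
    | zero => simpa using Eqv.refl 2 [cap 0, cup 0 ()]
    | succ n ih =>
      rw [Nat.cast_succ, add_mul, one_mul, add_comm]
      exact ((eqv_curl_cup 0 s).within [cap 0] (List.replicate n (cross 0 s)) (m' := 0) rfl
        le_rfl (by simp [List.replicate_succ]) rfl).trans ih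
  rcases le_or_gt 0 a with h | h
  · obtain ⟨n, rfl⟩ := Int.eq_ofNat_of_zero_le h
    rw [twists_natCast]
    simpa [curlSign] using key n false
  · obtain ⟨n, rfl⟩ : ∃ n : ℕ, a = -(n : ℤ) := ⟨(-a).toNat, by omega⟩
    rw [twists_neg_natCast]
    simpa [curlSign] using key n true

/-- Negative half twists are absorbed by proper fractions: each of them turns one fraction `p / q`
into `p / q - 1`. -/
theorem eqv_absorb (bs : List (ℕ × ℕ)) (hbs : ∀ b ∈ bs, 0 < b.1 ∧ b.1 < b.2) :
    Eqv 2 bs.length (bs.flatMap posWord ++ twists (-bs.length)) (bs.flatMap negWord) := by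
  induction bs with
  | nil => simpa [twists] using Eqv.refl 2 []
  | cons b bs ih =>
    have ih := ih fun c hc => hbs c (List.mem_cons_of_mem _ hc)
    have hb := hbs b List.mem_cons_self
    have hP := FlypeInvariant.posWord b
    have hN := FlypeInvariant.negWord b
    rw [List.length_cons, Nat.cast_succ]
    have h₁ : Eqv 2 1 (posWord b ++ (twists (-1) ++ bs.flatMap posWord ++ twists (-bs.length)))
        (negWord b ++ (bs.flatMap posWord ++ twists (-bs.length))) := by
      calc
        Eqv 2 1 (posWord b ++ (twists (-1) ++ bs.flatMap posWord ++ twists (-bs.length)))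
          (negWord b ++ [cross 0 false, cross 0 true] ++
            (bs.flatMap posWord ++ twists (-bs.length))) :=
          (posWord_eqv hb).within [] (twists (-1) ++ bs.flatMap posWord ++ twists (-bs.length))
            rfl le_rfl (by simp) (by simp [twists])
        Eqv 2 0 _ (negWord b ++ (bs.flatMap posWord ++ twists (-bs.length))) :=
          (eqv_reidemeister2 0 false).within (negWord b)
            (bs.flatMap posWord ++ twists (-bs.length)) hN.wd_eq le_rfl (by simp) (by simp)
    have h₂ : Eqv 2 0 ((b :: bs).flatMap posWord ++ twists (-(bs.length + 1)))
        (posWord b ++ (twists (-1) ++ bs.flatMap posWord ++ twists (-bs.length))) := by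
      have hf := FlypeInvariant.wd_flatMap posWord .posWord bs
      calc
        Eqv 2 0 ((b :: bs).flatMap posWord ++ twists (-(bs.length + 1)))
            (posWord b ++ bs.flatMap posWord ++ (twists (-1) ++ twists (-bs.length))) := by
          have := (twists_add (-1) (-bs.length)).symm₀.within (n := 2)
            (posWord b ++ bs.flatMap posWord) [] (by simp [wd_append, hP.wd_eq, hf]) le_rfl rfl rfl
          simpa [neg_add, add_comm] using this
        Eqv 2 0 _ (posWord b ++ (twists (-1) ++ bs.flatMap posWord ++ twists (-bs.length))) :=
          (FlypeInvariant.twists_comm_flatMap posWord .posWord bs (-1)).symm₀.within (posWord b)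
            (twists (-bs.length)) hP.wd_eq le_rfl (by simp) (by simp)
    have h₃ : Eqv 2 bs.length (negWord b ++ (bs.flatMap posWord ++ twists (-bs.length)))
        ((b :: bs).flatMap negWord) := ih.within (negWord b) [] hN.wd_eq le_rfl (by simp) (by simp)
    have := (h₂.trans h₁).trans h₃
    simpa [add_comm] using this

/-- A product of fractions is isotopic either to a word all of whose crossings are of one kind, or
to a product of two words whose crossings are of opposite kinds.  The change of the writhe is the
change of the number of crossings. -/
theorem IsProduct.exists_eqv {x : List (Slice Unit)} {bs : List (Option (ℕ × ℕ))} {a k : ℤ}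
    (h : IsProduct x bs a k) :
    (∃ y l, Eqv 2 l x y ∧ (nc y : ℤ) = nc x + l ∧ Chk false y) ∨
    (∃ (cs : List (ℕ × ℕ)) (y : List (Slice Unit)) (l : ℤ), Eqv 2 l x (cs.flatMap negWord ++ y) ∧
      (nc (cs.flatMap negWord ++ y) : ℤ) = nc x + l ∧ Chk false y) := by
  rcases le_or_gt 0 a with ha | ha
  · left
    obtain ⟨n, rfl⟩ := Int.eq_ofNat_of_zero_le ha
    refine ⟨_, k, h.eqv, ?_, ?_⟩
    · rw [h.nc_eq, nc_append, twists_natCast, Nat.cast_add]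
      simp
    · rw [twists_natCast, chk_append]
      exact ⟨chk_flatMap _ chk_blockWord bs, chk_replicate n⟩
  by_cases hn : none ∈ bs
  -- the half twists are moved to a tangle `∞`, where they become curls
  · left
    obtain ⟨bs₁, bs₂, rfl⟩ := List.append_of_mem hn
    refine ⟨(bs₁ ++ none :: bs₂).flatMap blockWord, k + -a, h.eqv.trans ?_, ?_,
      chk_flatMap _ chk_blockWord _⟩
    · have h₁ := FlypeInvariant.wd_flatMap blockWord .blockWord bs₁
      calc
        Eqv 2 0 ((bs₁ ++ none :: bs₂).flatMap blockWord ++ twists a)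
            (bs₁.flatMap blockWord ++ ([cap 0, cup 0 ()] ++ twists a) ++ bs₂.flatMap blockWord) :=
          (FlypeInvariant.twists_comm_flatMap blockWord .blockWord bs₂ a).symm₀.within
            (bs₁.flatMap blockWord ++ [cap 0, cup 0 ()]) [] (by rw [wd_append, h₁]; rfl) le_rfl
            (by simp [blockWord]) (by simp)
        Eqv 2 (-a) _ ((bs₁ ++ none :: bs₂).flatMap blockWord) :=
          (eqv_infty_twists a).within (bs₁.flatMap blockWord) (bs₂.flatMap blockWord) h₁ le_rfl
            (by simp) (by simp [blockWord])
    · have := h.nc_eq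
      linarith
  · right
    obtain ⟨cs, rfl⟩ : ∃ cs : List (ℕ × ℕ), bs = cs.map some := by
      have : ∀ bs : List (Option (ℕ × ℕ)), none ∉ bs → ∃ cs : List (ℕ × ℕ), bs = cs.map some := by
        intro bs
        induction bs with
        | nil => exact fun _ => ⟨[], rfl⟩
        | cons b bs ih =>
          intro hn
          obtain ⟨cs, rfl⟩ := ih fun h => hn (List.mem_cons_of_mem _ h)
          cases b with
          | none => simp at hn
          | some b => exact ⟨b :: cs, rfl⟩
      exact this bs hn
    have hm : ∀ cs : List (ℕ × ℕ), (cs.map some).flatMap blockWord = cs.flatMap posWord :=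
      fun cs => by simp [List.flatMap_map, blockWord]
    obtain ⟨j, rfl⟩ : ∃ j : ℕ, a = -(j : ℤ) := ⟨(-a).toNat, by omega⟩
    -- the first `j` fractions absorb the half twists
    have hj : j ≤ cs.length := by have := h.neg_le; simpa using this
    have hp : ∀ b ∈ cs, 0 < b.1 ∧ b.1 < b.2 := fun b hb => h.proper b (by simpa using hb)
    have heqv := h.eqv
    have hnc := h.nc_eq
    rw [hm] at heqv hnc
    have hl : (cs.take j).length = j := by simp [hj]
    have hcs : cs.flatMap posWord = (cs.take j).flatMap posWord ++ (cs.drop j).flatMap posWord := by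
      rw [← List.flatMap_append, List.take_append_drop]
    have hwt := FlypeInvariant.wd_flatMap posWord .posWord (cs.take j)
    have ht : ∀ b ∈ cs.take j, 0 < b.1 ∧ b.1 < b.2 := fun b hb => hp b (List.mem_of_mem_take hb)
    refine ⟨cs.take j, (cs.drop j).flatMap posWord, k + j, heqv.trans ?_, ?_,
      chk_flatMap _ chk_posWord _⟩
    · calc
        Eqv 2 0 (cs.flatMap posWord ++ twists (-j))
            ((cs.take j).flatMap posWord ++ twists (-j) ++ (cs.drop j).flatMap posWord) :=
          (FlypeInvariant.twists_comm_flatMap posWord .posWord (cs.drop j) (-j)).symm₀.within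
            ((cs.take j).flatMap posWord) [] hwt le_rfl (by rw [hcs]; simp) (by simp)
        Eqv 2 j _ ((cs.take j).flatMap negWord ++ (cs.drop j).flatMap posWord) := by
          have := eqv_absorb (cs.take j) ht
          rw [hl] at this
          exact this.within [] ((cs.drop j).flatMap posWord) rfl le_rfl (by simp) (by simp)
    · have : ∀ l : List (ℕ × ℕ), (∀ b ∈ l, 0 < b.1 ∧ b.1 < b.2) →
          nc (l.flatMap negWord) = nc (l.flatMap posWord) := by
        intro l hl
        induction l with
        | nil => rfl
        | cons b l ih =>
          simp [nc_negWord (hl b List.mem_cons_self),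
            ih fun c hc => hl c (List.mem_cons_of_mem _ hc)]
      rw [nc_append, this _ ht, ← nc_append, ← hcs]
      linarith

/-! ### Checkerboard diagrams are alternating -/

namespace LinkDiagram

theorem exists_level (D : LinkDiagram) {k : ℕ} {σ : Slice Bool} (h : D.slices[k]? = some σ) :
    σ.act (D.level k) = some (D.level (k + 1)) := by
  obtain ⟨hk, hσ⟩ := List.getElem?_eq_some_iff.1 h
  have hc := D.closed
  rw [← List.take_append_drop (k + 1) D.slices, runSlices_append] at hc
  have ht : D.slices.take (k + 1) = D.slices.take k ++ [σ] := by
    rw [List.take_succ_eq_append_getElem hk, hσ]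
  cases h₁ : runSlices (D.slices.take (k + 1)) [] with
  | none => simp [h₁] at hc
  | some w' =>
    have h₂ := h₁
    rw [ht, runSlices_append] at h₂
    cases h₃ : runSlices (D.slices.take k) [] with
    | none => simp [h₃] at h₂
    | some w =>
      simp only [level, h₁, h₃, Option.getD_some]
      cases h₄ : σ.act w with
      | none => simp [h₃, runSlices, h₄] at h₂
      | some v => simpa [h₃, runSlices, h₄] using h₂

end LinkDiagram

/-- The direction of the strand at an end of a slice. -/
def endDir (w w' : List Bool) : ℕ ⊕ ℕ → Option Bool
  | .inl j => w[j]?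
  | .inr j => w'[j]?

theorem act_cup {i : ℕ} {b : Bool} {w w' : List Bool} (h : (cup i b).act w = some w') :
    ∃ u v, u.length = i ∧ w = u ++ v ∧ w' = u ++ b :: (!b) :: v := by
  simp only [act] at h
  split at h
  · rename_i hi
    exact ⟨w.take i, w.drop i, by simp [hi], by simp, (Option.some.inj h).symm⟩
  · simp at h

theorem act_cap {i : ℕ} {w w' : List Bool} (h : (cap i).act w = some w') :
    ∃ u v a, u.length = i ∧ w = u ++ a :: (!a) :: v ∧ w' = u ++ v := by
  simp only [act] at h
  rcases hd : List.drop i w with _ | ⟨a, _ | ⟨b, q⟩⟩ <;> simp only [hd] at h <;> try simp at h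
  have hi : i ≤ w.length := by
    by_contra hc
    rw [List.drop_eq_nil_of_le (by omega)] at hd
    simp at hd
  obtain ⟨hab, rfl⟩ := h
  obtain rfl : b = !a := by cases a <;> cases b <;> simp_all
  exact ⟨w.take i, q, a, by simp [hi], by rw [← hd]; simp, rfl⟩

theorem act_cross {i : ℕ} {s : Bool} {w w' : List Bool} (h : (cross i s).act w = some w') :
    ∃ u v a b, u.length = i ∧ w = u ++ a :: b :: v ∧ w' = u ++ b :: a :: v := by
  simp only [act] at h
  rcases hd : List.drop i w with _ | ⟨a, _ | ⟨b, q⟩⟩ <;> simp only [hd] at h <;> try simp at h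
  have hi : i ≤ w.length := by
    by_contra hc
    rw [List.drop_eq_nil_of_le (by omega)] at hd
    simp at hd
  exact ⟨w.take i, q, a, b, by simp [hi], by rw [← hd]; simp, h.symm⟩

theorem getElem?_append_cons_cons (u v : List Bool) (a b : Bool) (j : ℕ) :
    (u ++ a :: b :: v)[u.length + 2 + j]? = (u ++ v)[u.length + j]? := by
  rw [List.getElem?_append_right (by omega), List.getElem?_append_right (by omega),
    show u.length + 2 + j - u.length = j + 2 by omega, Nat.add_sub_cancel_left]
  rfl

/-- A strand that enters a slice at one end of a piece leaves it at the other end. -/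
theorem endDir_piece {σ : Slice Bool} {w w' : List Bool} {c : Option Bool} {e f : ℕ ⊕ ℕ}
    (h : σ.act w = some w') (hp : σ.Piece c e f ∨ σ.Piece c f e)
    (he : endDir w w' e = some e.isLeft) : endDir w w' f = some (!f.isLeft) := by
  have key : ∀ e f, σ.Piece c e f → (endDir w w' e = some e.isLeft ↔
      endDir w w' f = some (!f.isLeft)) ∧ (endDir w w' f = some f.isLeft →
      endDir w w' e = some (!e.isLeft)) := by
    intro e f hp
    cases hp with
    | cup_left i j o h' =>
      obtain ⟨u, v, rfl, rfl, rfl⟩ := act_cup h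
      simp [endDir, List.getElem?_append_left h']
    | cup_right i j o h' =>
      obtain ⟨u, v, rfl, rfl, rfl⟩ := act_cup h
      obtain ⟨j, rfl⟩ := Nat.exists_eq_add_of_le h'
      have := getElem?_append_cons_cons u v o (!o) j
      rw [Nat.add_right_comm] at this
      simp only [endDir, this]
      simp
    | cup i o =>
      obtain ⟨u, v, rfl, rfl, rfl⟩ := act_cup h
      have h₁ : (u ++ o :: (!o) :: v)[u.length]? = some o := by simp
      have h₂ : (u ++ o :: (!o) :: v)[u.length + 1]? = some (!o) := by simp
      simp only [endDir, h₁, h₂]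
      simp
    | cap_left i j h' =>
      obtain ⟨u, v, a, rfl, rfl, rfl⟩ := act_cap h
      simp [endDir, List.getElem?_append_left h']
    | cap_right i j h' =>
      obtain ⟨u, v, a, rfl, rfl, rfl⟩ := act_cap h
      obtain ⟨j, rfl⟩ := Nat.exists_eq_add_of_le h'
      have := getElem?_append_cons_cons u v a (!a) j
      rw [Nat.add_right_comm] at this
      simp only [endDir, this]
      simp
    | cap i =>
      obtain ⟨u, v, a, rfl, rfl, rfl⟩ := act_cap h
      have h₁ : (u ++ a :: (!a) :: v)[u.length]? = some a := by simp
      have h₂ : (u ++ a :: (!a) :: v)[u.length + 1]? = some (!a) := by simp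
      simp only [endDir, h₁, h₂]
      simp
    | cross_left i j s h' =>
      obtain ⟨u, v, a, b, rfl, rfl, rfl⟩ := act_cross h
      simp [endDir, List.getElem?_append_left h']
    | cross_right i j s h' =>
      obtain ⟨u, v, a, b, rfl, rfl, rfl⟩ := act_cross h
      obtain ⟨j, rfl⟩ := Nat.exists_eq_add_of_le h'
      simp only [endDir, getElem?_append_cons_cons]
      simp
    | cross_rising i s =>
      obtain ⟨u, v, a, b, rfl, rfl, rfl⟩ := act_cross h
      have h₁ : (u ++ a :: b :: v)[u.length]? = some a := by simp
      have h₂ : (u ++ b :: a :: v)[u.length + 1]? = some a := by simp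
      simp only [endDir, h₁, h₂]
      simp
    | cross_falling i s =>
      obtain ⟨u, v, a, b, rfl, rfl, rfl⟩ := act_cross h
      have h₁ : (u ++ a :: b :: v)[u.length + 1]? = some b := by simp
      have h₂ : (u ++ b :: a :: v)[u.length]? = some b := by simp
      simp only [endDir, h₁, h₂]
      simp
  rcases hp with hp | hp
  · exact (key e f hp).1.1 he
  · exact (key f e hp).2 he

/-- The position of an end of a slice. -/
def endPos : ℕ ⊕ ℕ → ℕ := Sum.elim id id

/-- Runs along a piece without crossings keep the parity of the sum of the direction and of the
position. -/
theorem piece_none_parity {σ : Slice Bool} {e f : ℕ ⊕ ℕ}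
    (hp : σ.Piece none e f ∨ σ.Piece none f e) :
    xor e.isLeft (endPos e).bodd = xor (!f.isLeft) (endPos f).bodd := by
  rcases hp with hp | hp <;> cases hp <;> simp [endPos]

/-- At a crossing of the kind `c`, the parity of the sum of the direction and of the position tells
the over-strand from the under-strand, and changes. -/
theorem piece_some_parity {σ : Slice Bool} {c s : Bool} {e f : ℕ ⊕ ℕ}
    (hσ : ∀ i t, σ = cross i t → t = xor c i.bodd)
    (hp : σ.Piece (some s) e f ∨ σ.Piece (some s) f e) :
    xor e.isLeft (endPos e).bodd = xor s (!c) ∧ xor (!f.isLeft) (endPos f).bodd = xor s c := by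
  rcases hp with hp | hp <;> cases hp
  · rename_i i
    rw [hσ i _ rfl]
    cases c <;> cases hb : i.bodd <;> simp [endPos, hb]
  · rename_i i t
    rw [hσ i _ rfl]
    cases c <;> cases hb : i.bodd <;> simp [endPos, hb]
  · rename_i i
    rw [hσ i _ rfl]
    cases c <;> cases hb : i.bodd <;> simp [endPos, hb]
  · rename_i i t
    rw [hσ i _ rfl]
    cases c <;> cases hb : i.bodd <;> simp [endPos, hb]

namespace LinkDiagram

/-- The crossings change the parity of the sum of the direction and of the position of a strand,
and the other pieces preserve it; in a checkerboard diagram this parity tells whether the strand is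
the over-strand of the next crossing. -/
theorem isAlternating_of_chk (D : LinkDiagram) {c : Bool} (h : Chk c D.slices) :
    D.IsAlternating := by
  have dir : ∀ {l P Q}, D.Runs l P Q → ∃ (σ : Slice Bool) (e f : ℕ ⊕ ℕ), σ ∈ D.slices ∧
      (σ.Piece l e f ∨ σ.Piece l f e) ∧ P.2 = endPos e ∧ Q.2 = endPos f ∧
      (D.level P.1)[P.2]? = some e.isLeft ∧ (D.level Q.1)[Q.2]? = some (!f.isLeft) := by
    rintro l P Q ⟨k, σ, e, f, hk, hp, rfl, rfl, hd⟩
    have hpt : ∀ e, (D.level (point k e).1)[(point k e).2]? =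
        endDir (D.level k) (D.level (k + 1)) e := by rintro (j | j) <;> rfl
    have hps : ∀ e, (point k e).2 = endPos e := by rintro (j | j) <;> rfl
    refine ⟨σ, e, f, List.mem_of_getElem? hk, hp, hps e, hps f, hd, ?_⟩
    rw [hpt] at hd ⊢
    exact endDir_piece (D.exists_level hk) hp hd
  intro s t P Q R S hPQ hQR hRS
  obtain ⟨σ, e, f, hσ, hp, -, hf, -, hd⟩ := dir hPQ
  have hQ : ∃ x, (D.level Q.1)[Q.2]? = some x ∧ xor x Q.2.bodd = xor s c :=
    ⟨_, hd, by rw [hf]; exact (piece_some_parity (fun i t ht => h i t (ht ▸ hσ)) hp).2⟩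
  have hR : ∃ x, (D.level R.1)[R.2]? = some x ∧ xor x R.2.bodd = xor s c := by
    clear hRS
    induction hQR with
    | refl => exact hQ
    | tail _ h₂ ih =>
      obtain ⟨x, hx, hxs⟩ := ih
      obtain ⟨σ, e, f, -, hp, he, hf, hd₁, hd₂⟩ := dir h₂
      refine ⟨_, hd₂, ?_⟩
      rw [hd₁] at hx
      obtain rfl := Option.some.inj hx
      rw [hf, ← piece_none_parity hp, ← he, hxs]
  obtain ⟨x, hx, hxs⟩ := hR
  obtain ⟨τ, e', f', hτ, hp', he', -, hd', -⟩ := dir hRS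
  rw [hd'] at hx
  obtain rfl := Option.some.inj hx
  have := (piece_some_parity (fun i t ht => h i t (ht ▸ hτ)) hp').1
  rw [← he', hxs] at this
  revert this
  cases s <;> cases t <;> cases c <;> simp

end LinkDiagram

/-! ### Positive diagrams and the writhe -/

theorem nc_forget (X : List (Slice Bool)) : nc (X.map Slice.forget) = nc X := by
  rw [nc, List.countP_map]
  congr 1
  funext σ
  cases σ <;> rfl

theorem chk_forget {c : Bool} {X : List (Slice Bool)} :
    Chk c (X.map Slice.forget) ↔ Chk c X := by
  induction X with
  | nil => simp
  | cons σ X ih => cases σ <;> simp [Slice.forget, ih]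

theorem sign_le (σ : Slice Bool) (w : List Bool) : σ.sign w ≤ nc [σ] := by
  cases σ with
  | cup i b => simp [sign]
  | cap i => simp [sign]
  | cross i s =>
    simp only [sign]
    rcases List.drop i w with _ | ⟨a, _ | ⟨b, q⟩⟩ <;> simp [crossingSign]
    split <;> simp

theorem writhe_le (X : List (Slice Bool)) (w : List Bool) : writhe X w ≤ nc X := by
  induction X generalizing w with
  | nil => simp [writhe]
  | cons σ X ih =>
    have h₁ := sign_le σ w
    have h₂ := ih ((σ.act w).getD [])
    have h₃ : nc (σ :: X) = nc [σ] + nc X := nc_append [σ] X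
    rw [h₃, writhe]
    push_cast
    linarith

theorem writhe_eq_nc_iff (X : List (Slice Bool)) {w w' : List Bool} (h : runSlices X w = some w') :
    writhe X w = nc X ↔ ∀ (k i : ℕ) (s : Bool), X[k]? = some (cross i s) → ∃ a b : Bool,
      ((runSlices (X.take k) w).getD [])[i]? = some a ∧
      ((runSlices (X.take k) w).getD [])[i + 1]? = some b ∧ crossingSign s a b = 1 := by
  induction X generalizing w with
  | nil => simp [writhe]
  | cons σ X ih =>
    simp only [runSlices] at h
    cases hw : σ.act w with
    | none => simp [hw] at h
    | some v =>
      have ih := ih (w := v) (by simpa [hw] using h)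
      have h₁ := sign_le σ w
      have h₂ := writhe_le X v
      have h₃ : nc (σ :: X) = nc [σ] + nc X := nc_append [σ] X
      have hsplit : writhe (σ :: X) w = nc (σ :: X) ↔ σ.sign w = nc [σ] ∧ writhe X v = nc X := by
        rw [h₃, writhe, hw, Option.getD_some]
        push_cast
        constructor
        · intro h; constructor <;> linarith
        · rintro ⟨h, h'⟩; linarith
      rw [hsplit, ih]
      have hσ : σ.sign w = nc [σ] ↔ ∀ i s, σ = cross i s → ∃ a b : Bool,
          w[i]? = some a ∧ w[i + 1]? = some b ∧ crossingSign s a b = 1 := by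
        cases σ with
        | cup i b => simp [sign]
        | cap i => simp [sign]
        | cross i s =>
          obtain ⟨u, r, a, b, rfl, rfl, -⟩ := act_cross hw
          simp only [sign, List.drop_left, nc_cross, nc_nil]
          cases a <;> cases b <;> simp
      rw [hσ]
      constructor
      · rintro ⟨ha, hb⟩ k i s hk
        cases k with
        | zero => simpa [runSlices] using ha i s (by simpa using hk)
        | succ k => simpa [runSlices, hw] using hb k i s (by simpa using hk)
      · intro H
        refine ⟨fun i s hs => ?_, fun k i s hk => ?_⟩
        · simpa [runSlices] using H 0 i s (by simpa using hs)
        · simpa [runSlices, hw] using H (k + 1) i s (by simpa using hk)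

/-- A diagram is positive if and only if its writhe is the number of its crossings. -/
theorem LinkDiagram.isPositive_iff (D : LinkDiagram) :
    D.IsPositive ↔ writhe D.slices [] = nc D.slices := (writhe_eq_nc_iff D.slices D.closed).symm

theorem act_cross_not (i : ℕ) (s t : Bool) (w : List Bool) :
    (cross i s).act w = (cross i t).act w := rfl

/-- A diagram with one negative crossing, such that the change of this crossing leads to a
checkerboard diagram. -/
theorem LinkDiagram.isAlmostPA_of_chk (D : LinkDiagram) {A B : List (Slice Bool)} {i : ℕ}
    {s c : Bool} {w : List Bool} (hD : D.slices = A ++ cross i s :: B)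
    (hA : runSlices A [] = some w) (hs : (cross i s).sign w = -1)
    (hw : writhe D.slices [] = nc D.slices - 2) (hc : Chk c (A ++ cross i (!s) :: B)) :
    D.IsAlmostPA := by
  have hclosed := D.closed
  rw [hD, runSlices_append, hA, Option.bind_some, runSlices, act_cross_not i s (!s)] at hclosed
  have hclosed' : runSlices (A ++ cross i (!s) :: B) [] = some [] := by
    rw [runSlices_append, hA]; exact hclosed
  refine ⟨⟨A ++ cross i (!s) :: B, hclosed'⟩, ⟨A, B, i, s, hD, rfl⟩, ?_,
    isAlternating_of_chk _ hc⟩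
  rw [isPositive_iff]
  have hs' : (cross i (!s)).sign w = 1 := by
    simp only [sign] at hs ⊢
    rcases hd : List.drop i w with _ | ⟨a, _ | ⟨b, q⟩⟩ <;> simp only [hd] at hs ⊢ <;>
      try simp at hs
    revert hs
    cases a <;> cases b <;> cases s <;> simp [crossingSign]
  rw [hD, writhe_append A _ hA, writhe, hs] at hw
  simp only
  rw [writhe_append A _ hA, writhe, hs', act_cross_not i (!s) s]
  simp only [nc_append, nc_cross, Nat.cast_add] at hw ⊢
  push_cast at hw ⊢
  linarith

/-- A curl with a negative crossing makes a positive checkerboard diagram almost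
positive-alternating. -/
theorem exists_isAlmostPA_of_chk {X : List (Slice Bool)} {b c : Bool}
    (h : runSlices (cup 0 b :: X) [] = some []) (hp : writhe (cup 0 b :: X) [] = nc (cup 0 b :: X))
    (hc : Chk c (cup 0 b :: X)) {L : OrientedLink}
    (hL : (LinkDiagram.mk (cup 0 b :: X) h).Represents L) :
    ∃ D : LinkDiagram, D.Represents L ∧ D.IsAlmostPA := by
  have hX : runSlices X [b, !b] = some [] := by simpa [runSlices, act] using h
  have hpX : writhe X [b, !b] = nc X := by simpa [writhe, sign, act] using hp
  have hcX : Chk c X := by simpa using hc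
  -- the curl is added on the left or on the right of the first strand, so that its crossing fits
  -- the checkerboard colouring after the change
  cases c with
  | false =>
    have hclosed :
        runSlices (cup 0 b :: cup 0 (!b) :: cross 1 false :: cap 0 :: X) [] = some [] := by
      cases b <;> simpa [runSlices, act] using hX
    refine ⟨⟨_, hclosed⟩, ?_, ?_⟩
    · rw [← hL]
      exact Quot.sound ⟨[cup 0 b], X, _, [], .reidemeister1_left 0 (!b) false, rfl, rfl⟩
    · refine LinkDiagram.isAlmostPA_of_chk _ (A := [cup 0 b, cup 0 (!b)]) (B := cap 0 :: X)
        (c := false) rfl rfl (by cases b <;> rfl) ?_ (by simpa using hcX)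
      cases b <;> simp [writhe, sign, act, crossingSign] at hpX ⊢ <;> linarith
  | true =>
    have hclosed : runSlices (cup 0 b :: cup 1 b :: cross 0 false :: cap 1 :: X) [] = some [] := by
      cases b <;> simpa [runSlices, act] using hX
    refine ⟨⟨_, hclosed⟩, ?_, ?_⟩
    · rw [← hL]
      exact Quot.sound ⟨[cup 0 b], X, _, [], .reidemeister1_right 0 b false, rfl, rfl⟩
    · refine LinkDiagram.isAlmostPA_of_chk _ (A := [cup 0 b, cup 1 b]) (B := cap 1 :: X)
        (c := true) rfl rfl (by cases b <;> rfl) ?_ (by simpa using hcX)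
      cases b <;> simp [writhe, sign, act, crossingSign] at hpX ⊢ <;> linarith

/-! ### From the standard diagram to a product of turned tangles -/

/-- The closure of a tangle by an arc on its left and an arc on its right. -/
def sideClosure (x : List (Slice Unit)) : List (Slice Unit) :=
  cup 0 () :: cup 2 () :: (sh 1 x ++ [cap 0, cap 0])

theorem Eqv.sideClosure {k : ℤ} {x y : List (Slice Unit)} (h : Eqv 2 k x y) :
    Eqv 0 k (sideClosure x) (sideClosure y) :=
  (h.sh 1).within [cup 0 (), cup 2 ()] [cap 0, cap 0] (m' := 4) rfl (by omega) rfl rfl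

theorem numerator_eqv {x : List (Slice Unit)} (hx : wd x 2 = some 2) :
    Eqv 0 0 (Tangle.numerator x) (sideClosure (rotR x)) :=
  (rotL_rotR hx).symm₀.within [cup 0 ()] [cap 0] (m' := 2) rfl le_rfl (by simp [Tangle.numerator])
    (by simp [rotL, sideClosure])

/-- The standard diagram of the rational tangle `p / q` or `-p / q` for `t = (s, p, q)`, where `s`
is the sign. -/
abbrev ratWord (t : Bool × ℕ × ℕ) : List (Slice Unit) := Tangle.ratAux t.1 t.2.1 t.2.2

/-- The rational tangle for `t` after a quarter turn. -/
abbrev turnedWord (t : Bool × ℕ × ℕ) : List (Slice Unit) := turned t.1 t.2.1 t.2.2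

theorem wd_sum (l : List (Bool × ℕ × ℕ)) : wd (Tangle.sum (l.map ratWord)) 2 = some 2 := by
  induction l with
  | nil => rfl
  | cons t l ih =>
    cases l with
    | nil => exact (FlypeInvariant.ratAux _ _ _).wd_eq
    | cons t' l => exact wd_add_tangle (FlypeInvariant.ratAux _ _ _).wd_eq ih

theorem rotR_sum (l : List (Bool × ℕ × ℕ)) :
    Eqv 2 0 (rotR (Tangle.sum (l.map ratWord))) (l.reverse.flatMap turnedWord) := by
  induction l with
  | nil => exact rotR_zero
  | cons t l ih =>
    have ht := rotR_ratAux_turned t.1 t.2.1 t.2.2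
    cases l with
    | nil => simpa [Tangle.sum, turnedWord] using ht
    | cons t' l =>
      have hs := wd_sum (t' :: l)
      have hr := (FlypeInvariant.ratAux t.1 t.2.1 t.2.2).wd_eq
      calc
        Eqv 2 0 (rotR (Tangle.sum ((t :: t' :: l).map ratWord)))
            (rotR (Tangle.sum ((t' :: l).map ratWord)) ++ rotR (ratWord t)) := rotR_add hr hs
        Eqv 2 0 _ (rotR (Tangle.sum ((t' :: l).map ratWord)) ++ turnedWord t) :=
          ht.within _ [] (wd_rotR hs) le_rfl (by simp) (by simp)
        Eqv 2 0 _ ((t :: t' :: l).reverse.flatMap turnedWord) :=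
          ih.within [] (turnedWord t) rfl le_rfl (by simp) (by simp)

theorem nc_sum (l : List (Bool × ℕ × ℕ)) :
    nc (Tangle.sum (l.map ratWord)) = nc (l.reverse.flatMap turnedWord) := by
  induction l with
  | nil => rfl
  | cons t l ih =>
    cases l with
    | nil => simp [Tangle.sum, nc_turned]
    | cons t' l =>
      have : Tangle.sum ((t :: t' :: l).map ratWord) =
        Tangle.add (ratWord t) (Tangle.sum ((t' :: l).map ratWord)) := rfl
      rw [this, nc_add, ih]
      simp [nc_turned, add_comm, add_assoc]

theorem chk_sum {c : Bool} (l : List (Bool × ℕ × ℕ)) (h : ∀ t ∈ l, Chk c (ratWord t)) :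
    Chk c (Tangle.sum (l.map ratWord)) := by
  induction l with
  | nil => simp [Tangle.sum, Tangle.zero]
  | cons t l ih =>
    cases l with
    | nil => simpa [Tangle.sum] using h
    | cons t' l =>
      have : Tangle.sum ((t :: t' :: l).map ratWord) =
        Tangle.add (ratWord t) (Tangle.sum ((t' :: l).map ratWord)) := rfl
      rw [this]
      simp only [Tangle.add, List.cons_append, chk_cons_cup, chk_append, chk_shift, chk_cons_cap,
        chk_nil, and_true]
      exact ⟨h t List.mem_cons_self, by
        simpa using ih fun t ht => h t (List.mem_cons_of_mem _ ht)⟩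

/-! ### Orientations of positive tangles -/

/-- The number of strands that are directed upwards minus the number of those directed downwards. -/
def flux (w : List Bool) : ℤ := (w.map fun b => if b then 1 else -1).sum

theorem flux_act {σ : Slice Bool} {w w' : List Bool} (h : σ.act w = some w') :
    flux w' = flux w := by
  cases σ with
  | cup i b =>
    obtain ⟨u, v, rfl, rfl, rfl⟩ := act_cup h
    cases b <;> simp [flux]
  | cap i =>
    obtain ⟨u, v, a, rfl, rfl, rfl⟩ := act_cap h
    cases a <;> simp [flux]
  | cross i s =>
    obtain ⟨u, v, a, b, rfl, rfl, rfl⟩ := act_cross h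
    simp only [flux, List.map_append, List.map_cons, List.sum_append, List.sum_cons]
    ring

theorem flux_runSlices {X : List (Slice Bool)} {w w' : List Bool} (h : runSlices X w = some w') :
    flux w' = flux w := by
  induction X generalizing w with
  | nil => rw [Option.some.inj h]
  | cons σ X ih =>
    simp only [runSlices] at h
    cases hw : σ.act w with
    | none => simp [hw] at h
    | some v => rw [ih (w := v) (by simpa [hw] using h), flux_act hw]

/-- Strands which enter a tangle from below in parallel leave it at the top in parallel. -/
theorem runSlices_tangle {X : List (Slice Bool)} {a b : Bool} {w' : List Bool}
    (hX : wd (X.map Slice.forget) 2 = some 2) (h : runSlices X [a, b] = some w') :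
    ∃ a' b', w' = [a', b'] ∧ (a = b → a' = a ∧ b' = a) ∧ (a ≠ b → a' ≠ b') := by
  have hl := wd_length X h
  simp only [List.length_cons, List.length_nil, Nat.zero_add, Nat.reduceAdd, hX] at hl
  have hf := flux_runSlices h
  match w', hl with
  | [a', b'], _ =>
    refine ⟨a', b', rfl, ?_⟩
    revert hf
    cases a <;> cases b <;> cases a' <;> cases b' <;> simp [flux]

/-- An orientation, from the strands `w` to the strands `w'`, for which all crossings are
positive. -/
def PosRun (X : List (Slice Bool)) (w w' : List Bool) : Prop :=
  runSlices X w = some w' ∧ writhe X w = nc X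

theorem PosRun.append {X Y : List (Slice Bool)} {w w'' : List Bool} (h : PosRun (X ++ Y) w w'') :
    ∃ w', PosRun X w w' ∧ PosRun Y w' w'' := by
  obtain ⟨h, hw⟩ := h
  rw [runSlices_append] at h
  cases h₁ : runSlices X w with
  | none => simp [h₁] at h
  | some w' =>
    rw [writhe_append X Y h₁, nc_append, Nat.cast_add] at hw
    have h₂ := writhe_le X w
    have h₃ := writhe_le Y w'
    exact ⟨w', ⟨h₁, by linarith⟩, by simpa [h₁] using h, by linarith⟩

theorem PosRun.cross {s a b : Bool} {v w' : List Bool} {X : List (Slice Bool)}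
    (h : PosRun (cross 0 s :: X) (a :: b :: v) w') :
    s = (a == b) ∧ PosRun X (b :: a :: v) w' := by
  obtain ⟨v', h₁, h₂⟩ := PosRun.append (X := [Slice.cross 0 s]) (Y := X) h
  obtain ⟨h₁, h₁'⟩ := h₁
  simp [runSlices, act] at h₁
  subst h₁
  refine ⟨?_, h₂⟩
  simp only [writhe, sign, List.drop_zero, nc_cross, nc_nil, crossingSign] at h₁'
  by_contra hs
  rw [if_neg hs] at h₁'
  norm_num at h₁'

theorem exists_of_forget_rotL {X : List (Slice Bool)} {x : List (Slice Unit)} {c d : Bool}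
    {w' : List Bool} (hx : wd x 2 = some 2) (hX : X.map Slice.forget = rotL x)
    (h : runSlices X [c, d] = some w') :
    ∃ (e g : Bool) (Y : List (Slice Bool)), X = cup 2 e :: (Y.map (Slice.shift 1) ++ [cap 0]) ∧
      Y.map Slice.forget = x ∧ runSlices Y [d, e] = some [!c, g] ∧ w' = [g, !e] ∧
      writhe X [c, d] = writhe Y [d, e] := by
  simp only [rotL, List.map_eq_cons_iff, List.map_eq_append_iff, List.map_eq_nil_iff,
    forget_eq_cup, forget_eq_cap] at hX
  obtain ⟨_, _, rfl, ⟨e, rfl⟩, Y', _, rfl, hY, _, _, rfl, rfl, rfl⟩ := hX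
  obtain ⟨Y, rfl, rfl⟩ := exists_map_shift_of_forget hY
  have hrun : runSlices (Y.map (Slice.shift 1)) [c, d, e, !e] =
      ((runSlices Y [d, e]).map (· ++ [!e])).map ([c] ++ ·) := by
    have := runSlices_shift Y [c] ([d, e] ++ [!e])
    rw [runSlices_append_of_wd Y [d, e] [!e] hx] at this
    exact this
  have h' : (runSlices (Y.map (Slice.shift 1)) [c, d, e, !e]).bind (runSlices [cap 0]) =
      some w' := by
    rw [← runSlices_append]; exact h
  rw [hrun] at h'
  cases hYr : runSlices Y [d, e] with
  | none => simp [hYr] at h'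
  | some v =>
    obtain ⟨f, g, rfl, -⟩ := runSlices_tangle hx hYr
    simp only [hYr, Option.map_some, List.cons_append, List.nil_append, Option.bind_some, runSlices,
      act, List.drop_zero, List.take_zero] at h'
    have hcf : f = !c := by cases c <;> cases f <;> simp_all
    subst hcf
    refine ⟨e, g, Y, rfl, rfl, hYr, by cases c <;> simpa using h'.symm, ?_⟩
    rw [writhe, show (cup 2 e).act [c, d] = some [c, d, e, !e] from rfl, Option.getD_some,
      writhe_append _ _ (w' := [c, !c, g, !e]) (by rw [hrun, hYr]; rfl)]
    have h₁ := writhe_shift Y [c] (w := [d, e] ++ [!e]) (runSlices_append_right Y _ hYr)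
    rw [writhe_append_right Y _ hYr] at h₁
    simp only [List.length_singleton, List.cons_append, List.nil_append] at h₁
    rw [h₁]
    simp [sign, writhe]

theorem PosRun.of_rotL {X : List (Slice Bool)} {x : List (Slice Unit)} {c d : Bool}
    {w' : List Bool} (hx : wd x 2 = some 2) (hX : X.map Slice.forget = rotL x)
    (h : PosRun X [c, d] w') :
    ∃ (e g : Bool) (Y : List (Slice Bool)), Y.map Slice.forget = x ∧
      PosRun Y [d, e] [!c, g] ∧ w' = [g, !e] := by
  obtain ⟨e, g, Y, rfl, hY, hYr, hw', hw⟩ := exists_of_forget_rotL hx hX h.1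
  refine ⟨e, g, Y, hY, ⟨hYr, ?_⟩, hw'⟩
  rw [← hw, h.2]
  simp

/-- Between parallel strands, a positive orientation exists only for tangles `-p / q` and `0`. -/
theorem turned_of_parallel {X : List (Slice Bool)} {s c : Bool} {p q : ℕ} {w' : List Bool}
    (hX : X.map Slice.forget = turned s p q) (h : PosRun X [c, c] w') :
    q ≠ 0 ∧ (p = 0 ∨ s = false) := by
  rcases Nat.eq_zero_or_pos q with rfl | hq
  · simp only [turned_zero_right, List.map_eq_cons_iff, List.map_eq_nil_iff, forget_eq_cap,
      forget_eq_cup] at hX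
    obtain ⟨_, _, rfl, rfl, _, _, rfl, ⟨b, rfl⟩, rfl⟩ := hX
    have := h.1
    simp [runSlices, act] at this
  refine ⟨hq.ne', ?_⟩
  rcases Nat.eq_zero_or_pos p with rfl | hp
  · exact .inl rfl
  right
  rcases lt_trichotomy p q with hpq | rfl | hpq
  · rw [turned_of_lt s hp hpq] at hX
    have hT := FlypeInvariant.ratAux s p (q - p)
    obtain ⟨e, g, Y, hY, hYr, -⟩ := PosRun.of_rotL (hT.cons_cross s).wd_eq hX h
    simp only [List.map_eq_cons_iff, forget_eq_cross] at hY
    obtain ⟨_, T, rfl, rfl, hT'⟩ := hY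
    obtain ⟨hs, hr⟩ := hYr.cross
    obtain ⟨a', b', hab, heq, -⟩ := runSlices_tangle (by rw [hT', hT.wd_eq]) hr.1
    cases s with
    | false => rfl
    | true =>
      obtain rfl : c = e := by simpa using hs
      have := (heq rfl).1
      simp at hab
      have h1 := hab.1
      rw [this] at h1
      cases c <;> simp at h1
  · rw [turned_self s hp] at hX
    simp only [List.map_eq_cons_iff, List.map_eq_nil_iff, forget_eq_cross] at hX
    obtain ⟨_, _, rfl, rfl, rfl⟩ := hX
    simpa using h.cross.1
  · rw [turned_of_gt s hq hpq] at hX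
    obtain ⟨X₁, X₂, rfl, h₁, h₂⟩ := List.map_eq_append_iff.1 hX
    simp only [List.map_eq_cons_iff, List.map_eq_nil_iff, forget_eq_cross] at h₂
    obtain ⟨_, _, rfl, rfl, rfl⟩ := h₂
    obtain ⟨v, hv, hx⟩ := h.append
    obtain ⟨a', b', rfl, heq, -⟩ := runSlices_tangle (by rw [h₁, wd_turned]) hv.1
    obtain ⟨rfl, rfl⟩ := heq rfl
    simpa using hx.cross.1

/-- Between antiparallel strands, a positive orientation of `-p / q` exists only for `p < q`. -/
theorem turned_of_antiparallel {X : List (Slice Bool)} {s c d : Bool} {p q : ℕ} {w' : List Bool}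
    (hcd : c ≠ d) (hX : X.map Slice.forget = turned s p q) (h : PosRun X [c, d] w') :
    s = true ∨ p = 0 ∨ q = 0 ∨ p < q := by
  rcases Nat.eq_zero_or_pos q with rfl | hq
  · simp
  rcases lt_trichotomy p q with hpq | rfl | hpq
  · simp [hpq]
  · rw [turned_self s hq] at hX
    simp only [List.map_eq_cons_iff, List.map_eq_nil_iff, forget_eq_cross] at hX
    obtain ⟨_, _, rfl, rfl, rfl⟩ := hX
    left
    have h1 := h.cross.1
    revert h1 hcd
    cases s <;> cases c <;> cases d <;> simp
  · rw [turned_of_gt s hq hpq] at hX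
    obtain ⟨X₁, X₂, rfl, h₁, h₂⟩ := List.map_eq_append_iff.1 hX
    simp only [List.map_eq_cons_iff, List.map_eq_nil_iff, forget_eq_cross] at h₂
    obtain ⟨_, _, rfl, rfl, rfl⟩ := h₂
    obtain ⟨v, hv, hx⟩ := h.append
    obtain ⟨a', b', rfl, -, hne⟩ := runSlices_tangle (by rw [h₁, wd_turned]) hv.1
    left
    have h1 := hx.cross.1
    have h2 := hne hcd
    revert h1 h2
    cases s <;> cases a' <;> cases b' <;> simp

theorem forall_of_parallel {l : List (Bool × ℕ × ℕ)} {X : List (Slice Bool)} {c : Bool}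
    {w' : List Bool} (hX : X.map Slice.forget = l.flatMap turnedWord) (h : PosRun X [c, c] w') :
    ∀ t ∈ l, t.2.2 ≠ 0 ∧ (t.2.1 = 0 ∨ t.1 = false) := by
  induction l generalizing X with
  | nil => simp
  | cons t l ih =>
    rw [List.flatMap_cons] at hX
    obtain ⟨X₁, X₂, rfl, h₁, h₂⟩ := List.map_eq_append_iff.1 hX
    obtain ⟨v, hv, hx⟩ := h.append
    obtain ⟨a', b', rfl, heq, -⟩ := runSlices_tangle (by rw [h₁, wd_turned]) hv.1
    obtain ⟨rfl, rfl⟩ := heq rfl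
    intro t' ht'
    rcases List.mem_cons.1 ht' with rfl | ht'
    · exact turned_of_parallel h₁ hv
    · exact ih h₂ hx t' ht'

/-- Between antiparallel strands, a positive product of rational tangles has no fractions `≤ -1`, so
that its negative fractions contribute one negative half twist each. -/
theorem isProduct_of_antiparallel {l : List (Bool × ℕ × ℕ)} {X : List (Slice Bool)} {c d : Bool}
    {w' : List Bool} (hcd : c ≠ d) (hX : X.map Slice.forget = l.flatMap turnedWord)
    (h : PosRun X [c, d] w') : ∃ bs a k, IsProduct (l.flatMap turnedWord) bs a k := by
  induction l generalizing X c d with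
  | nil => exact ⟨_, _, _, .nil⟩
  | cons t l ih =>
    rw [List.flatMap_cons] at hX
    obtain ⟨X₁, X₂, rfl, h₁, h₂⟩ := List.map_eq_append_iff.1 hX
    obtain ⟨v, hv, hx⟩ := h.append
    obtain ⟨a', b', rfl, -, hne⟩ := runSlices_tangle (by rw [h₁, wd_turned]) hv.1
    obtain ⟨bs, a, k, hl⟩ := ih (hne hcd) h₂ hx
    obtain ⟨cs, b, j, ht⟩ : ∃ cs b j, IsProduct (turnedWord t) cs b j := by
      obtain ⟨s, p, q⟩ := t
      rcases Nat.eq_zero_or_pos q with rfl | hq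
      · obtain ⟨cs, b, ht⟩ := IsProduct.turned_true p 0
        exact ⟨cs, b, 0, by simpa [turnedWord, turned_zero_right] using ht⟩
      rcases Nat.eq_zero_or_pos p with rfl | hp
      · exact ⟨[], 0, 0, by simpa [turnedWord, turned_zero_left s hq] using .nil⟩
      cases s with
      | true =>
        obtain ⟨cs, b, ht⟩ := IsProduct.turned_true p q
        exact ⟨cs, b, 0, ht⟩
      | false =>
        have : false = true ∨ p = 0 ∨ q = 0 ∨ p < q := turned_of_antiparallel hcd h₁ hv
        have hpq : p < q := by simp at this; omega
        exact ⟨_, _, _, IsProduct.turned_false hp hpq⟩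
    exact ⟨_, _, _, ht.append hl (wd_turned _ _ _)⟩

/-- The directions at the top of a positive fraction between `-1` and `0` agree with those at its
bottom. -/
theorem PosRun.negWord_eq {cs : List (ℕ × ℕ)} {X : List (Slice Bool)} {c d : Bool}
    {w' : List Bool} (hcd : c ≠ d) (hX : X.map Slice.forget = cs.flatMap negWord)
    (h : PosRun X [c, d] w') : w' = [c, d] := by
  induction cs generalizing X with
  | nil =>
    obtain rfl := List.map_eq_nil_iff.1 hX
    exact (Option.some.inj h.1).symm
  | cons b cs ih =>
    rw [List.flatMap_cons] at hX
    obtain ⟨X₁, X₂, rfl, h₁, h₂⟩ := List.map_eq_append_iff.1 hX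
    obtain ⟨v, hv, hx⟩ := h.append
    suffices hv' : v = [c, d] by subst hv'; exact ih h₂ hx
    have hT := FlypeInvariant.ratAux false (b.2 - b.1) b.1
    obtain ⟨e, g, Y, hY, hYr, rfl⟩ := PosRun.of_rotL (hT.cons_cross false).wd_eq h₁ hv
    obtain ⟨a', b', hab, -, hne⟩ :=
      runSlices_tangle (by rw [hY, (hT.cons_cross false).wd_eq]) hYr.1
    simp only [List.map_eq_cons_iff, forget_eq_cross] at hY
    obtain ⟨_, T, rfl, rfl, -⟩ := hY
    obtain ⟨hs, -⟩ := hYr.cross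
    have hde : d ≠ e := by simpa using hs
    have hg := hne hde
    simp at hab
    obtain ⟨h1, rfl⟩ := hab
    revert hcd hde hg h1
    cases c <;> cases d <;> cases e <;> cases g <;> cases a' <;> simp

/-! ### The almost positive-alternating diagram -/

/-- For a product `x` of negative tangles, the result is a positive tangle with one crossing of the
wrong kind, the one at the bottom of the outer `rotL`, and with a positive twist on top.  Two
cancelling pairs of crossings are added, one above `x` and one at its side; `rotL_cross_cross`
replaces one crossing of each pair by the crossing of the wrong kind. -/
theorem eqv_dealternator {x : List (Slice Unit)} (hx : wd x 2 = some 2) :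
    Eqv 2 1 x (rotL (cross 0 false :: rotL (rotR x ++ [cross 0 false])) ++ [cross 0 false]) := by
  have hr := wd_rotR hx
  calc
    Eqv 2 0 x (x ++ [cross 0 true, cross 0 false]) :=
      (eqv_reidemeister2 0 true).symm₀.within x [] hx le_rfl (by simp) (by simp)
    Eqv 2 0 _ (rotL (rotR x) ++ [cross 0 true, cross 0 false]) :=
      (rotL_rotR hx).symm₀.within [] [cross 0 true, cross 0 false] rfl le_rfl rfl rfl
    Eqv 2 0 _ (rotL (rotR x ++ [cross 0 false] ++ [cross 0 true]) ++
        [cross 0 true, cross 0 false]) :=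
      ((eqv_reidemeister2 0 false).symm₀.within (rotR x) [] hr le_rfl (by simp)
        (by simp)).rotL.within [] [cross 0 true, cross 0 false] rfl le_rfl rfl rfl
    Eqv 2 1 _ (rotL (cross 0 false :: rotL (rotR x ++ [cross 0 false])) ++ [cross 0 false]) :=
      (rotL_cross_cross (x := rotR x ++ [cross 0 false])
        (by simp [wd_append, hr, wd, width]) true).within [] [cross 0 false] rfl le_rfl
        (by simp) (by simp)

/-- The oriented closure of an oriented tangle. -/
def orientedClosure (c d : Bool) (X : List (Slice Bool)) : List (Slice Bool) :=
  cup 0 (!c) :: cup 2 d :: (X.map (Slice.shift 1) ++ [cap 0, cap 0])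

theorem runSlices_closure_start (c d : Bool) :
    runSlices [cup 0 (!c), cup 2 d] [] = some ([!c] ++ ([c, d] ++ [!d])) := by
  cases c <;> rfl

theorem runSlices_orientedClosure {c d : Bool} {X : List (Slice Bool)}
    (h : runSlices X [c, d] = some [c, d]) :
    runSlices (orientedClosure c d X) [] = some [] := by
  have h₁ := runSlices_shift X [!c] ([c, d] ++ [!d])
  rw [runSlices_append_right X _ h] at h₁
  have h₂ : orientedClosure c d X =
      [cup 0 (!c), cup 2 d] ++ (X.map (Slice.shift 1) ++ [cap 0, cap 0]) := rfl
  rw [h₂, runSlices_append, runSlices_closure_start, Option.bind_some, runSlices_append]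
  simp only [List.length_singleton] at h₁
  rw [h₁]
  cases c <;> cases d <;> rfl

theorem writhe_orientedClosure {c d : Bool} {X : List (Slice Bool)}
    (h : runSlices X [c, d] = some [c, d]) :
    writhe (orientedClosure c d X) [] = writhe X [c, d] := by
  have h₁ := runSlices_shift X [!c] ([c, d] ++ [!d])
  have h₃ := writhe_shift X [!c] (w := [c, d] ++ [!d]) (runSlices_append_right X _ h)
  rw [runSlices_append_right X _ h] at h₁
  rw [writhe_append_right X _ h] at h₃
  have h₂ : orientedClosure c d X =
      [cup 0 (!c), cup 2 d] ++ (X.map (Slice.shift 1) ++ [cap 0, cap 0]) := rfl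
  simp only [List.length_singleton] at h₁ h₃
  rw [h₂, writhe_append _ _ (runSlices_closure_start c d), writhe_append _ _ h₁, h₃]
  simp [writhe, sign]

theorem nc_orientedClosure (c d : Bool) (X : List (Slice Bool)) :
    nc (orientedClosure c d X) = nc X := by
  simp [orientedClosure]

theorem Conn.orientedClosure {c d : Bool} {X Y : List (Slice Bool)}
    (h : Conn [c, d] [c, d] X Y) :
    Conn [] [] (orientedClosure c d X) (orientedClosure c d Y) := by
  have := ((h.append_right [!d]).shift [!c]).ctx [cup 0 (!c), cup 2 d] [cap 0, cap 0]
    (runSlices_closure_start c d) (v := []) (by cases c <;> cases d <;> rfl)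
  exact this

theorem exists_of_forget_sideClosure {Y : List (Slice Bool)} {x : List (Slice Unit)}
    (hx : wd x 2 = some 2) (hY : Y.map Slice.forget = sideClosure x)
    (h : runSlices Y [] = some []) :
    ∃ c d X, Y = orientedClosure c d X ∧ X.map Slice.forget = x ∧
      runSlices X [c, d] = some [c, d] := by
  simp only [sideClosure, List.map_eq_cons_iff, List.map_eq_append_iff, List.map_eq_nil_iff,
    forget_eq_cup, forget_eq_cap] at hY
  obtain ⟨_, _, rfl, ⟨b, rfl⟩, _, _, rfl, ⟨d, rfl⟩, X', _, rfl, hX, _, _, rfl, rfl, _, _, rfl, rfl,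
    rfl⟩ := hY
  obtain ⟨X, rfl, rfl⟩ := exists_map_shift_of_forget hX
  obtain ⟨c, rfl⟩ : ∃ c, b = !c := ⟨!b, by simp⟩
  refine ⟨c, d, X, rfl, rfl, ?_⟩
  have h₁ := runSlices_shift X [!c] ([c, d] ++ [!d])
  rw [runSlices_append_of_wd X [c, d] _ hx] at h₁
  have h₂ : runSlices ([cup 0 (!c), cup 2 d] ++ (X.map (Slice.shift 1) ++ [cap 0, cap 0])) [] =
    some [] := h
  simp only [List.length_singleton] at h₁
  rw [runSlices_append, runSlices_closure_start, Option.bind_some, runSlices_append, h₁] at h₂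
  cases hXr : runSlices X [c, d] with
  | none => simp [hXr] at h₂
  | some v =>
    obtain ⟨a', b', rfl, -⟩ := runSlices_tangle hx hXr
    rw [hXr] at h₂
    revert h₂
    cases a' <;> cases b' <;> cases c <;> cases d <;> simp [runSlices, act]

/-- If the strands below the product of the turned tangles are antiparallel, then either it is
isotopic to a positive checkerboard word, or `eqv_dealternator` applies to the fractions which have
absorbed half twists. -/
theorem exists_isAlmostPA_of_antiparallel {l : List (Bool × ℕ × ℕ)} {X : List (Slice Bool)}
    {c d : Bool} (hcd : c ≠ d) (hX : X.map Slice.forget = l.flatMap turnedWord)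
    (h : PosRun X [c, d] [c, d]) {L : OrientedLink}
    (hL : (LinkDiagram.mk _ (runSlices_orientedClosure h.1)).Represents L) :
    ∃ D : LinkDiagram, D.Represents L ∧ D.IsAlmostPA := by
  obtain ⟨bs, a, k, hp⟩ := isProduct_of_antiparallel hcd hX h
  rcases hp.exists_eqv with ⟨y, j, hy, hnc, hchk⟩ | ⟨cs, y, j, hy, hnc, hchk⟩
  · obtain ⟨Y, rfl, hYr, hconn, hw⟩ := hy.fwd _ _ X le_rfl hX h.1
    refine exists_isAlmostPA_of_chk (c := true) (runSlices_orientedClosure hYr) ?_ ?_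
      (hconn.orientedClosure.represents _ _ hL)
    · have : writhe (orientedClosure c d Y) [] = nc (orientedClosure c d Y) := by
        rw [writhe_orientedClosure hYr, nc_orientedClosure, hw, h.2, ← nc_forget Y, hnc, ← hX,
          nc_forget]
      exact this
    · simpa [chk_forget] using hchk
  · obtain ⟨Y, hYf, hYr, hconn, hw⟩ := hy.fwd _ _ X le_rfl hX h.1
    have hL' := hconn.orientedClosure.represents _ (runSlices_orientedClosure hYr) hL
    -- all crossings are still positive, since the writhe and their number have changed alike
    have hYp : PosRun Y [c, d] [c, d] :=
      ⟨hYr, by rw [hw, h.2, ← nc_forget Y, hYf, hnc, ← hX, nc_forget]⟩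
    obtain ⟨Q, R, rfl, hQ, hR⟩ := List.map_eq_append_iff.1 hYf
    obtain ⟨v, hQr, hRr⟩ := hYp.append
    obtain rfl := hQr.negWord_eq hcd hQ
    have hwQ := FlypeInvariant.wd_flatMap negWord .negWord cs
    obtain ⟨Z, hZ, hZr, hZc, hZw⟩ := (eqv_dealternator hwQ).fwd _ _ Q le_rfl hQ hQr.1
    -- three crossings more, but only one more in the writhe: exactly one crossing is negative
    have hncZ : nc Z = nc Q + 3 := by
      rw [← nc_forget Z, ← nc_forget Q, hZ, hQ]
      simp
    have hZR : runSlices (Z ++ R) [c, d] = some [c, d] := by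
      rw [runSlices_append, hZr]; exact hRr.1
    refine ⟨⟨_, runSlices_orientedClosure hZR⟩, ?_, ?_⟩
    · refine Conn.represents (Conn.orientedClosure ?_) _ _ hL'
      simpa using hZc.ctx [] R rfl hRr.1
    · have hwZ : writhe (orientedClosure c d (Z ++ R)) [] =
          nc (orientedClosure c d (Z ++ R)) - 2 := by
        rw [writhe_orientedClosure hZR, nc_orientedClosure, writhe_append Z R hZr, hZw, hQr.2,
          hRr.2, nc_append, hncZ]
        push_cast
        ring
      obtain ⟨Z₁, Z₂, rfl, hZ₁, hZ₂⟩ := List.map_eq_append_iff.1 hZ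
      simp only [List.map_eq_cons_iff, List.map_eq_nil_iff, forget_eq_cross] at hZ₂
      obtain ⟨_, _, rfl, rfl, rfl⟩ := hZ₂
      rw [runSlices_append] at hZr
      cases hZ₁r : runSlices Z₁ [c, d] with
      | none => simp [hZ₁r] at hZr
      | some v =>
        have hwx : wd (cross 0 false :: rotL (rotR (cs.flatMap negWord) ++ [cross 0 false])) 2 =
            some 2 := by
          have := wd_rotL (x := rotR (cs.flatMap negWord) ++ [cross 0 false])
            (by rw [wd_append, wd_rotR hwQ]; rfl)
          simp [wd, width, this]
        obtain ⟨e, g, T, rfl, hT, -, rfl, -⟩ := exists_of_forget_rotL hwx hZ₁ hZ₁r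
        -- the crossing of the wrong kind has parallel strands and so is the negative one
        have hed : d = e := by
          rw [hZ₁r] at hZr
          revert hcd
          simp [runSlices, act] at hZr
          rw [hZr.1]
          cases c <;> cases d <;> simp
        subst hed
        simp only [List.map_eq_cons_iff, forget_eq_cross] at hT
        obtain ⟨_, T, rfl, rfl, hT⟩ := hT
        refine LinkDiagram.isAlmostPA_of_chk _ (A := [cup 0 (!c), cup 2 d, cup 3 d]) (i := 2)
          (s := false) (c := true) (w := [!c, c, d, d, !d, !d])
          (B := T.map (Slice.shift 2) ++ cap 1 :: cross 1 false ::
            (R.map (Slice.shift 1) ++ [cap 0, cap 0])) ?_ (by cases c <;> rfl)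
          (by cases d <;> simp [sign, crossingSign]) hwZ ?_
        · simp only [orientedClosure, Slice.shift, List.map_append, List.map_cons, List.map_map]
          simp
          simp [shift_shift]
        · have hcT : Chk true T := by
            rw [← chk_forget, hT]
            simp [chk_rotL, chk_rotR, chk_flatMap _ chk_negWord]
          have hcR : Chk false R := by rw [← chk_forget, hR]; exact hchk
          simp [hcT, hcR]

/-- The statement for all sums of standard diagrams of rational tangles. -/
theorem exists_isAlmostPA (l : List (Bool × ℕ × ℕ)) (L : OrientedLink) (D : LinkDiagram)
    (hL : D.Represents L)
    (hD : D.slices.map Slice.forget = Tangle.numerator (Tangle.sum (l.map ratWord)))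
    (hpos : D.IsPositive) : ∃ D' : LinkDiagram, D'.Represents L ∧ D'.IsAlmostPA := by
  rw [LinkDiagram.isPositive_iff] at hpos
  have hwx : wd (l.reverse.flatMap turnedWord) 2 = some 2 := by
    induction l.reverse with
    | nil => rfl
    | cons t l ih => simp [wd_append, wd_turned, ih]
  have heqv := (numerator_eqv (wd_sum l)).trans₀ (rotR_sum l).sideClosure
  obtain ⟨Y, hY, hYr, hconn, hw⟩ := heqv.fwd [] [] D.slices le_rfl hD D.closed
  have hL₁ := hconn.represents D.closed hYr hL
  have hnc : nc Y = nc D.slices := by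
    rw [← nc_forget Y, ← nc_forget D.slices, hY, hD]
    simp [sideClosure, Tangle.numerator, nc_sum]
  obtain ⟨c, d, X, rfl, hX, hXr⟩ := exists_of_forget_sideClosure hwx hY hYr
  have hXp : PosRun X [c, d] [c, d] := by
    refine ⟨hXr, ?_⟩
    rw [← writhe_orientedClosure hXr, hw, hpos, ← hnc, nc_orientedClosure, add_zero]
  by_cases hcd : c = d
  -- all tangles are `0` or negative, so the standard diagram is alternating itself
  · subst hcd
    have hall := forall_of_parallel hX hXp
    have hchk : Chk false D.slices := by
      rw [← chk_forget, hD]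
      simp only [Tangle.numerator, List.cons_append, chk_cons_cup, chk_append, chk_cons_cap,
        chk_nil, and_true]
      refine chk_sum l fun t ht => ?_
      obtain ⟨hq, h⟩ := hall t (List.mem_reverse.2 ht)
      obtain ⟨s, p, q⟩ := t
      rcases h with h | h
      · obtain rfl : p = 0 := h
        simp [ratWord, ratAux_zero_left s (Nat.pos_of_ne_zero hq), Tangle.zero]
      · obtain rfl : s = false := h
        exact chk_ratAux _ _ _
    obtain ⟨Z, hZ⟩ := D
    cases Z with
    | nil => simp [Tangle.numerator] at hD
    | cons σ Z =>
      have hσ : σ.forget = cup 0 () := by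
        simp only [Tangle.numerator, List.map_cons, List.cons_append, List.cons.injEq] at hD
        exact hD.1
      obtain ⟨b, rfl⟩ := forget_eq_cup.1 hσ
      exact exists_isAlmostPA_of_chk hZ hpos hchk hL
  · exact exists_isAlmostPA_of_antiparallel hcd hX hXp hL₁

theorem proposition4p1 (n : ℕ) (hn : 1 ≤ n) (α β : Fin n → ℤ)
    (hαβ : ∀ i, IsCoprime (α i) (β i))
    (L : OrientedLink) (D : LinkDiagram) (hL : D.Represents L)
    (hD : D.IsStandardMontesinos α β) (hpos : D.IsPositive) :
    ∃ D' : LinkDiagram, D'.Represents L ∧ D'.IsAlmostPA := by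
  refine exists_isAlmostPA
    (List.ofFn fun i => (decide (0 ≤ α i * β i), (α i).natAbs, (β i).natAbs)) L D hL ?_ hpos
  rw [List.map_ofFn]
  exact hD
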